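/- **Proposition 3.1.** Let $(\lambda_n)_{n\ge 1}$ be complex numbers with $\sum_n|\lambda_n|<\infty$, let $p_k=\sum_n\lambda_n^k$ for $k\ge 1$, and let $$f(z)=\prod_{n\ge1}(1-\lambda_n z)=\sum_{k\ge0}(-1)^k e_k z^k\qquad(z\in\mathbb C).$$ The product and the series $p_k$ converge, and the coefficients $e_k$ exist and are unique. (A) If all $e_k\in\mathbb Q$, then all $p_k\in\mathbb Q$. (B) Let $q_1,\dots,q_\ell\in\mathbb C$. If all $e_k\in\mathbb Q(q_1,\dots,q_\ell)$, then all $p_k\in\mathbb Q(q_1,\dots,q_\ell)$. The same holds with $q_1,\dots,q_\ell$ as variables: call a function on a set $D\subseteq\mathbb C^\ell$ *rational over $\mathbb Q$ on $D$* if it equals $P/R$ on $D$ for polynomials $P,R$ with rational coefficients such that $R$ has no zero on $D$; if $\lambda_n=\lambda_n(q)$ depends on $q\in D$, with $\sum_n|\lambda_n(q)|<\infty$ for each $q\in D$, and every $e_k(q)$ is rational over $\mathbb Q$ on $D$, then so is every $p_k(q)$, $k\ge1$. (C) An entire function has genus $0$ if it has the form $Cz^m\prod_n(1-\lambda_nz)$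 with $C\ne0$, $m\ge 0$ and $\sum_n|\lambda_n|<\infty$. Let $D$ be a set of parameters $(a_1,\dots,a_r,b_1,\dots,b_s)$ with no $b_j\in\{0,-1,-2,\dots\}$, let $c$ be rational over $\mathbb Q$ on $D$, and suppose that for all parameters in $D$ the series $$f(z)=\sum_{n\ge0}\frac{(a_1)_n\cdots(a_r)_n}{(b_1)_n\cdots(b_s)_n\,n!}(cz)^n$$ converges for all $z$ and has genus $0$. Then $f(z)=\prod_n(1-\lambda_nz)$ for some absolutely summable $(\lambda_n)$, and for any such choice every $p_k$, $k\ge1$, is rational over $\mathbb Q$ on $D$ in the parameters; in particular $p_k\in\mathbb Q(a_1,\dots,a_r,b_1,\dots,b_s)$. The same holds, with parameters $(q,a_1,\dots,a_r,b_1,\dots,b_s)$, $0<|q|<1$, $b_jq^n\neq1$ for all $n\ge0$, for $$f(z)=\sum_{n\ge0}\frac{(a_1,\dots,a_r;q)_n}{(q,b_1,\dots,b_s;q)_n}\Bigl((-1)^nq^{n(n-1)/2}\Bigr)^{1+s-r}(cz)^n,$$ and in particular $p_k\in\mathbb Q(q,a_1,\dots,a_r,b_1,\dots,b_s)$. Here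 $(a)_n=a(a+1)\cdots(a+n-1)$, $(a;q)_n=\prod_{0\le k<n}(1-aq^k)$ for $0\le n\le\infty$, and several arguments denote a product. (D) Examples, for every integer $n\ge1$ (all the series converge absolutely): 1. $\zeta(2n)\in\mathbb Q(\pi^2)$. 2. There is a rational function $R_n\in\mathbb Q(X)$ without poles in $(-1,\infty)$ such that for all $\nu>-1$ one has $\sum_k j_{\nu,k}^{-2n}=R_n(\nu)\in\mathbb Q(\nu)$, where $j_{\nu,k}$ are the positive zeros of the Bessel function $J_\nu(x)=\sum_{i\ge0}\frac{(-1)^i}{\Gamma(i+\nu+1)\,i!}(x/2)^{\nu+2i}$. 3. $\sum_k i_k^{-2n}\in\mathbb Q(\sqrt3,\pi,\Gamma(1/3))$, where $i_k$ are the positive zeros of $A(x)=\pi 3^{-1/3}\,\mathrm{Ai}(-3^{-1/3}x)$. 4. There is a rational function $R_n\in\mathbb Q(X,Y)$ such that for all $\nu>-1$ and $0<q<1$ its denominator does not vanish at $(q,q^\nu)$ and $\sum_k j_{\nu,k}(q)^{-2n}=R_n(q,q^\nu)\in\mathbb Q(q,q^\nu)$, where $j_{\nu,k}(q)$ are the positive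 zeros of $J^{(2)}_\nu(x;q)=\frac{(q^{\nu+1};q)_\infty}{(q;q)_\infty}\sum_{i\ge0}\frac{(-q^{i+\nu})^i}{(q,q^{\nu+1};q)_i}(x/2)^{\nu+2i}$. 5. There is a rational function $R_n\in\mathbb Q(X)$ without poles in $(0,1)$ such that for all $0<q<1$ one has $\sum_k i_k(q)^{-n}=R_n(q)\in\mathbb Q(q)$, where $i_k(q)$ are the positive zeros of Ramanujan's function $A_q(x)=\sum_{i\ge0}\frac{q^{i^2}(-x)^i}{(q;q)_i}$. 6. $\sum_k z_k^{-2n}\in\mathbb Q\bigl(\tfrac{b_2}{b_0},\dots,\tfrac{b_{2n}}{b_0}\bigr)$, where $z_k$ are the zeros with positive real part, with multiplicity, of the entire function $$\Xi(z)=-\frac{1+4z^2}{8\pi^{(1+2iz)/4}}\,\Gamma\Bigl(\frac{1+2iz}{4}\Bigr)\zeta\Bigl(\frac{1+2iz}{2}\Bigr),$$ and $b_k=\int_{\mathbb R}t^k\phi(t)\,dt$ with $\phi(t)=2\pi\sum_{j\ge1}(2\pi j^4e^{-9t/2}-3j^2e^{-5t/2})\exp(-j^2\pi e^{-2t})$.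 7. Let $m\geq 2$, let $\chi$ be a real primitive Dirichlet character modulo $m$, $a=0$ if $\chi(-1)=1$ and $a=1$ otherwise, and $\phi(t,\chi)=\sum_{j\in\mathbb Z}j^a\chi(j)\exp\bigl(-\frac{j^2\pi}{me^{2t}}-\frac{1+2a}{2}t\bigr)$. Assume $\phi(t,\chi)\ge0$ for all real $t$. Then $\sum_k z_k(\chi)^{-2n}\in\mathbb Q\bigl(\tfrac{b_2(\chi)}{b_0(\chi)},\dots,\tfrac{b_{2n}(\chi)}{b_0(\chi)}\bigr)$, where $b_k(\chi)=\int_{\mathbb R}t^k\phi(t,\chi)\,dt$ and $z_k(\chi)$ are the zeros with positive real part, with multiplicity, of the entire function $$\Xi(z,\chi)=\Bigl(\frac{\pi}{m}\Bigr)^{-(1+2a+2iz)/4}\Gamma\Bigl(\frac{1+2a+2iz}{4}\Bigr)L\Bigl(\frac{1+2iz}{2},\chi\Bigr).$$ -/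

import Mathlib

open Real Complex MeasureTheory

noncomputable section

/-! ### Power sums and coefficients of genus zero products -/

/-- `e` is the sequence of signed Taylor coefficients of the product: for every `z`,
`∏ₙ (1 - λₙ z) = ∑ₖ (-1)ᵏ eₖ zᵏ`. -/
def IsCoeffSeq (lam e : ℕ → ℂ) : Prop :=
  ∀ z : ℂ, HasSum (fun k : ℕ => (-1) ^ k * e k * z ^ k) (∏' n, (1 - lam n * z))

/-- The power sum `pₖ = ∑ₙ λₙᵏ` (used for `k ≥ 1` and absolutely summable sequences). -/
def powerSum (lam : ℕ → ℂ) (k : ℕ) : ℂ := ∑' n, lam n ^ k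

/-- `g` is given on `D` by a rational function with rational coefficients in the coordinates,
whose denominator has no zero on `D`. -/
def IsRationalOn {σ : Type} (D : Set (σ → ℂ)) (g : (σ → ℂ) → ℂ) : Prop :=
  ∃ P Q : MvPolynomial σ ℚ, ∀ x ∈ D,
    MvPolynomial.aeval x Q ≠ 0 ∧ g x = MvPolynomial.aeval x P / MvPolynomial.aeval x Q

/-- The value at `x` of a rational function over `ℚ` lies in the field generated by the
coordinates of `x`. -/
theorem IsRationalOn.mem_adjoin {σ : Type} {D : Set (σ → ℂ)} {g : (σ → ℂ) → ℂ}
    (h : IsRationalOn D g) {x : σ → ℂ} (hx : x ∈ D) :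
    g x ∈ IntermediateField.adjoin ℚ (Set.range x) := by
  obtain ⟨P, Q, hPQ⟩ := h
  rw [(hPQ x hx).2]
  have key : ∀ R : MvPolynomial σ ℚ,
      MvPolynomial.aeval x R ∈ IntermediateField.adjoin ℚ (Set.range x) := by
    intro R
    apply IntermediateField.algebra_adjoin_le_adjoin
    rw [Algebra.adjoin_range_eq_range_aeval]
    exact ⟨R, rfl⟩
  exact div_mem (key P) (key Q)

/-- `f(z) = ∏ₙ (1 - λₙ z)` with `∑ |λₙ| < ∞`; the nonzero `λₙ` are then the reciprocals of the
zeros of `f`, repeated according to multiplicity. -/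
def IsGenusZeroFactorization (f : ℂ → ℂ) (lam : ℕ → ℂ) : Prop :=
  Summable (fun n => ‖lam n‖) ∧ ∀ z, f z = ∏' n, (1 - lam n * z)

/-- Entire functions of genus `0`: Hadamard factorization
`f(z) = C zᵐ ∏ₙ (1 - z / zₙ)` with `C ≠ 0` and `∑ 1 / |zₙ| < ∞`. Here `λₙ = 1 / zₙ`, and `λₙ = 0`
is allowed so that finite products are included. -/
def HasGenusZero (f : ℂ → ℂ) : Prop :=
  ∃ (C : ℂ) (m : ℕ) (lam : ℕ → ℂ), C ≠ 0 ∧ Summable (fun n => ‖lam n‖) ∧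
    ∀ z, f z = C * z ^ m * ∏' n, (1 - lam n * z)

/-! ### Hypergeometric and basic hypergeometric series -/

/-- The coefficient `(a₁)ₙ ⋯ (aᵣ)ₙ / ((b₁)ₙ ⋯ (bₛ)ₙ n!)`. -/
def hypCoeff {r s : ℕ} (a : Fin r → ℂ) (b : Fin s → ℂ) (n : ℕ) : ℂ :=
  (∏ i, (ascPochhammer ℂ n).eval (a i)) /
    ((∏ j, (ascPochhammer ℂ n).eval (b j)) * (n.factorial : ℂ))

/-- The hypergeometric series `ᵣFₛ(a; b; z)`. -/
def hypSeries {r s : ℕ} (a : Fin r → ℂ) (b : Fin s → ℂ) (z : ℂ) : ℂ :=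
  ∑' n, hypCoeff a b n * z ^ n

/-- The finite `q`-shifted factorial `(a; q)ₙ = ∏_{k < n} (1 - a qᵏ)`. -/
def qPoch {K : Type} [Field K] (a q : K) (n : ℕ) : K :=
  ∏ k ∈ Finset.range n, (1 - a * q ^ k)

/-- The coefficient of the basic hypergeometric series `ᵣφₛ`:
`(a₁, …, aᵣ; q)ₙ / (q, b₁, …, bₛ; q)ₙ · ((-1)ⁿ q^{n(n-1)/2})^{1+s-r}`. -/
def qHypCoeff {r s : ℕ} (q : ℂ) (a : Fin r → ℂ) (b : Fin s → ℂ) (n : ℕ) : ℂ :=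
  (∏ i, qPoch (a i) q n) / ((∏ j, qPoch (b j) q n) * qPoch q q n) *
    ((-1) ^ n * q ^ n.choose 2) ^ (1 + (s : ℤ) - (r : ℤ))

/-- The basic hypergeometric series `ᵣφₛ(a; b; q, z)`. -/
def qHypSeries {r s : ℕ} (q : ℂ) (a : Fin r → ℂ) (b : Fin s → ℂ) (z : ℂ) : ℂ :=
  ∑' n, qHypCoeff q a b n * z ^ n

/-! ### Bessel, Airy, `q`-Bessel and Ramanujan functions -/

/-- The Bessel function `J_ν(x)`, for real `ν > -1` and `x > 0`. -/
def besselJ (ν x : ℝ) : ℝ :=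
  ∑' n : ℕ, (-1) ^ n / (Real.Gamma (n + ν + 1) * n.factorial) * (x / 2) ^ (ν + 2 * n)

/-- The Airy function `Ai` on the real line, by its Maclaurin series
`Ai(0) ∑ₖ 3ᵏ (1/3)ₖ x³ᵏ / (3k)! + Ai'(0) ∑ₖ 3ᵏ (2/3)ₖ x³ᵏ⁺¹ / (3k+1)!`, where
`Ai(0) = 3^{-2/3} / Γ(2/3)` and `Ai'(0) = -3^{-1/3} / Γ(1/3)`. -/
def airyAi (x : ℝ) : ℝ :=
  (3 : ℝ) ^ (-2 / 3 : ℝ) / Real.Gamma (2 / 3) *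
      (∑' k : ℕ, 3 ^ k * (ascPochhammer ℝ k).eval (1 / 3) * x ^ (3 * k) / (3 * k).factorial) -
    (3 : ℝ) ^ (-1 / 3 : ℝ) / Real.Gamma (1 / 3) *
      (∑' k : ℕ, 3 ^ k * (ascPochhammer ℝ k).eval (2 / 3) * x ^ (3 * k + 1) /
        (3 * k + 1).factorial)

/-- The normalization `A(x) = π / ∛3 · Ai(-x / ∛3)`. -/
def airyA (x : ℝ) : ℝ :=
  π / (3 : ℝ) ^ (1 / 3 : ℝ) * airyAi (-x / (3 : ℝ) ^ (1 / 3 : ℝ))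

/-- The infinite `q`-shifted factorial `(a; q)_∞`. -/
def qPochInf (a q : ℝ) : ℝ := ∏' k : ℕ, (1 - a * q ^ k)

/-- The `q`-Bessel function `J_ν^{(2)}(x; q)`, for `ν > -1`, `0 < q < 1` and `x > 0`. -/
def qBesselJ (ν q x : ℝ) : ℝ :=
  qPochInf (q ^ (ν + 1)) q / qPochInf q q *
    ∑' n : ℕ, (-q ^ ((n : ℝ) + ν)) ^ n / (qPoch q q n * qPoch (q ^ (ν + 1)) q n) *
      (x / 2) ^ (ν + 2 * n)

/-- Ramanujan's entire function `A_q(x) = ∑ₙ q^{n²} (-x)ⁿ / (q; q)ₙ`. -/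
def ramanujanA (q x : ℝ) : ℝ := ∑' n : ℕ, q ^ n ^ 2 * (-x) ^ n / qPoch q q n

/-! ### The Riemann Xi function -/

/-- `Ξ(z) = ξ(1/2 + iz)` with `ξ(s) = s (s - 1) / 2 · π^{-s/2} Γ(s/2) ζ(s)`, written through
Mathlib's entire function `completedRiemannZeta₀ s = π^{-s/2} Γ(s/2) ζ(s) + 1/s + 1/(1-s)` so that
the removable singularities are filled in. -/
def riemannXi (z : ℂ) : ℂ :=
  ((1 / 2 + I * z) * (1 / 2 + I * z - 1) * completedRiemannZeta₀ (1 / 2 + I * z) + 1) / 2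

/-- The classical formula
`Ξ(z) = -(1 + 4z²) / (8 π^{(1+2iz)/4}) · Γ((1+2iz)/4) ζ((1+2iz)/2)` holds wherever its right side
has no pole among its factors. -/
theorem riemannXi_eq (z : ℂ) (h1 : 1 / 2 + I * z ≠ 1)
    (hG : ∀ n : ℕ, (1 + 2 * I * z) / 4 ≠ -n) :
    riemannXi z = -(1 + 4 * z ^ 2) / (8 * (π : ℂ) ^ ((1 + 2 * I * z) / 4)) *
      Complex.Gamma ((1 + 2 * I * z) / 4) * riemannZeta ((1 + 2 * I * z) / 2) := by
  have hs : (1 + 2 * I * z) / 2 = 1 / 2 + I * z := by ring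
  have hs2 : (1 + 2 * I * z) / 4 = (1 / 2 + I * z) / 2 := by ring
  have hz2 : -(1 + 4 * z ^ 2) = 4 * ((1 / 2 + I * z) * (1 / 2 + I * z - 1)) := by
    linear_combination (-4 * z ^ 2) * I_sq
  rw [hs2] at hG
  rw [hs, hs2, hz2]
  have hG' : Complex.Gamma ((1 / 2 + I * z) / 2) ≠ 0 := Complex.Gamma_ne_zero hG
  have h0 : 1 / 2 + I * z ≠ 0 := by
    intro h
    exact hG 0 (by rw [h]; simp)
  unfold riemannXi
  generalize 1 / 2 + I * z = s at *
  have hpi : (π : ℂ) ^ (s / 2) ≠ 0 := by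
    rw [Ne, cpow_eq_zero_iff]
    simp [Real.pi_ne_zero]
  rw [riemannZeta_def_of_ne_zero h0, completedRiemannZeta_eq, Gammaℝ, neg_div, cpow_neg]
  have h1' : 1 - s ≠ 0 := sub_ne_zero.mpr (Ne.symm h1)
  field_simp
  ring

/-- `φ(t) = 2π ∑_{n ≥ 1} (2π n⁴ e^{-9t/2} - 3 n² e^{-5t/2}) exp(-n² π e^{-2t})`. -/
def xiPhi (t : ℝ) : ℝ :=
  2 * π * ∑' n : ℕ, (2 * π * ((n : ℝ) + 1) ^ 4 * Real.exp (-(9 * t / 2)) -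
    3 * ((n : ℝ) + 1) ^ 2 * Real.exp (-(5 * t / 2))) *
      Real.exp (-(((n : ℝ) + 1) ^ 2 * π * Real.exp (-(2 * t))))

/-- The moment `b_k = ∫ tᵏ φ(t) dt` over the real line. -/
def xiMoment (k : ℕ) : ℝ := ∫ t : ℝ, t ^ k * xiPhi t

/-! ### The Xi function of a real primitive Dirichlet character -/

open scoped Classical in
/-- The parity of a Dirichlet character: `0` if `χ(-1) = 1`, and `1` otherwise. -/
def charParity {m : ℕ} (χ : DirichletCharacter ℂ m) : ℕ := if χ.Even then 0 else 1

/-- `Ξ(z, χ) = (π/m)^{-(s+a)/2} Γ((s+a)/2) L(s, χ)` with `s = 1/2 + iz` and `a` the parity of `χ`,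
written through Mathlib's completed L-function
`completedLFunction χ s = π^{-(s+a)/2} Γ((s+a)/2) L(s, χ)`, which is entire for `χ ≠ 1`. -/
def dirichletXi {m : ℕ} [NeZero m] (χ : DirichletCharacter ℂ m) (z : ℂ) : ℂ :=
  (m : ℂ) ^ ((1 / 2 + I * z + charParity χ) / 2) * χ.completedLFunction (1 / 2 + I * z)

/-- The classical formula
`Ξ(z, χ) = (π/m)^{-(1+2a+2iz)/4} Γ((1+2a+2iz)/4) L((1+2iz)/2, χ)` holds off the poles of `Γ`. -/
theorem dirichletXi_eq {m : ℕ} [NeZero m] (hm : m ≠ 1) (χ : DirichletCharacter ℂ m) (z : ℂ)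
    (hG : ∀ n : ℕ, (1 + 2 * charParity χ + 2 * I * z) / 4 ≠ -n) :
    dirichletXi χ z = ((π / m : ℝ) : ℂ) ^ (-(1 + 2 * charParity χ + 2 * I * z) / 4) *
      Complex.Gamma ((1 + 2 * charParity χ + 2 * I * z) / 4) *
        χ.LFunction ((1 + 2 * I * z) / 2) := by
  have hs : (1 + 2 * I * z) / 2 = 1 / 2 + I * z := by ring
  have hw : (1 + 2 * charParity χ + 2 * I * z) / 4 = (1 / 2 + I * z + charParity χ) / 2 := by ring
  have hpi : ∀ w : ℂ, (π : ℂ) ^ w ≠ 0 := by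
    intro w
    rw [Ne, cpow_eq_zero_iff]
    simp [Real.pi_ne_zero]
  have hpow : ∀ w : ℂ, ((π / m : ℝ) : ℂ) ^ (-w) = (m : ℂ) ^ w * (π : ℂ) ^ (-w) := by
    intro w
    have h := Complex.mul_cpow_ofReal_nonneg (a := π / m) (b := m) (by positivity)
      (by positivity) (-w)
    have h2 : ((π / m : ℝ) : ℂ) * ((m : ℝ) : ℂ) = (π : ℂ) := by
      rw [← Complex.ofReal_mul, div_mul_cancel₀ _ (by simpa using NeZero.ne m)]
    rw [h2] at h
    rw [h, Complex.ofReal_natCast, cpow_neg (m : ℂ)]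
    have : (m : ℂ) ^ w ≠ 0 := by
      rw [Ne, cpow_eq_zero_iff]
      simp [NeZero.ne m]
    field_simp
  rw [neg_div, hs, hpow, χ.LFunction_eq_completed_div_gammaFactor _ (Or.inr hm)]
  rw [hw] at hG ⊢
  have hG' := Complex.Gamma_ne_zero hG
  have hfac : χ.gammaFactor (1 / 2 + I * z) =
      (π : ℂ) ^ (-((1 / 2 + I * z + charParity χ) / 2)) *
        Complex.Gamma ((1 / 2 + I * z + charParity χ) / 2) := by
    unfold charParity DirichletCharacter.gammaFactor
    split_ifs
    · rw [Gammaℝ, neg_div]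
      simp only [Nat.cast_zero, add_zero]
    · rw [Gammaℝ, neg_div]
      simp only [Nat.cast_one]
  rw [hfac]
  unfold dirichletXi
  have hp := hpi (-((1 / 2 + I * z + charParity χ) / 2))
  generalize (1 / 2 + I * z + charParity χ) / 2 = w at *
  generalize (π : ℂ) ^ (-w) = p at *
  field_simp

/-- `φ(t, χ) = ∑_{n ∈ ℤ} nᵃ χ(n) exp(-n² π / (m e^{2t}) - (1 + 2a) t / 2)`, where `a` is the parity
of `χ`. Only real characters are considered, so that `χ(n)` equals its real part. -/
def dirichletPhi {m : ℕ} (χ : DirichletCharacter ℂ m) (t : ℝ) : ℝ :=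
  ∑' n : ℤ, (n : ℝ) ^ charParity χ * (χ (n : ZMod m)).re *
    Real.exp (-((n : ℝ) ^ 2 * π / (m * Real.exp (2 * t))) - (1 + 2 * charParity χ) / 2 * t)

/-- The moment `b_k(χ) = ∫ tᵏ φ(t, χ) dt` over the real line. -/
def dirichletMoment {m : ℕ} (χ : DirichletCharacter ℂ m) (k : ℕ) : ℝ :=
  ∫ t : ℝ, t ^ k * dirichletPhi χ t

end

/-! Put `f(z) = ∏ (1 - λₙ z)`. Then `-f'/f = ∑ p_{k+1} z^k`; comparing coefficients in `f' = -f · ∑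
p_{k+1} z^k` gives Newton's identities. They express each power sum through the Taylor coefficients
by field operations in which the only division is by `f(0)`. Hence power sums stay in any field
containing the coefficients, and stay rational on any parameter set on which the coefficients are.
The carriers are `NewtonRel` with `NewtonRel.mem_subfield` and `IsRationalOn.of_newtonRel`; the
identities pass from finite products to the infinite one by locally uniform convergence
(`newtonRel_genusZeroProd`). Hypergeometric coefficients are visibly rational in the parameters.

The zero-sum examples use no global factorization. For an entire `g`, the zeros in a disc are
divided out; the quotient is the exponential of some `F`, and Borel-Carathéodory with Cauchy's
estimate bounds the Taylor coefficients of `F`, which are the gap between the sum over zeros in the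
disc and the Newton sum (`norm_powerSum_zeros_sub_le`). If `g` grows slower than every
`exp(ε|z|^d)`, the gap tends to `0` for exponents `k ≥ d` (`tendsto_sum_zeros`). When almost all
`ρ⁻ᵏ` lie in a sector about the positive axis, the convergence is absolute (`hasSum_zeros`). What
remains for each function is a growth bound and the location of the zeros, and, where the sums run
without multiplicity, their simplicity.

Bessel, q-Bessel and Ramanujan functions start a chain `Uₙ = Uₙ₊₁ - cₙ z Uₙ₊₂` with `cₙ > 0` and `Uₙ
→ 1`; positivity of Wronskian-like quantities makes all zeros positive and simple. For Airy the same
follows from an energy identity for `g'' = -(z/3) g`. Both `Ξ` functions are Fourier transforms of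
nonnegative densities, found by Mellin inversion-free comparison with theta series: their Taylor
coefficients are moments, they are even, and their zeros lie in a strip and off the imaginary axis.
Even zeta values come from Euler's formula. -/

open Filter Topology

/-! ### Newton's identities -/

/-- Newton's identities between the coefficients `c` of a power series `C` with `C 0 ≠ 0` and the
coefficients of `-C' / C = ∑ s (k + 1) X ^ k`. -/
def NewtonRel {R : Type*} [CommRing R] (c s : ℕ → R) : Prop :=
  ∀ k : ℕ, c (k + 1) * (k + 1) + ∑ i ∈ Finset.range (k + 1), c i * s (k - i + 1) = 0

namespace NewtonRel

/-- The convolution in Newton's identities is a Cauchy product, so they say `C' = -C S`. Closure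
under products then reduces to the Leibniz rule. -/
theorem iff_powerSeries {R : Type*} [CommRing R] {c s : ℕ → R} :
    NewtonRel c s ↔ PowerSeries.derivative R (PowerSeries.mk c) =
      -(PowerSeries.mk c * PowerSeries.mk fun k => s (k + 1)) := by
  rw [PowerSeries.ext_iff]
  refine forall_congr' fun k => ?_
  rw [PowerSeries.coeff_derivative, map_neg, PowerSeries.coeff_mul,
    Finset.Nat.sum_antidiagonal_eq_sum_range_succ_mk, eq_neg_iff_add_eq_zero]
  simp [PowerSeries.coeff_mk]

/-- Isolates the term `i = 0`. This recursion drives membership, uniqueness and rationality alike.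
-/
theorem solve {K : Type*} [Field K] {c s : ℕ → K} (h : NewtonRel c s) (h0 : c 0 ≠ 0) (k : ℕ) :
    s (k + 1) = -(c (k + 1) * (k + 1) + ∑ i ∈ Finset.range k, c (i + 1) * s (k - (i + 1) + 1)) /
      c 0 := by
  have := h k
  rw [Finset.sum_range_succ'] at this
  rw [eq_div_iff h0]
  simp only [Nat.sub_zero] at this
  linear_combination this

/-- Only the coefficients up to index `k + 1` are required; this is why finitely many moments
suffice for the `Ξ` functions. -/
theorem mem_subfield {K S : Type*} [Field K] [SetLike S K] [SubfieldClass S K] {F : S}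
    {c s : ℕ → K} (h : NewtonRel c s) (h0 : c 0 ≠ 0) :
    ∀ k : ℕ, (∀ i ≤ k + 1, c i ∈ F) → s (k + 1) ∈ F := by
  intro k
  induction k using Nat.strong_induction_on with
  | _ k ih =>
    intro hc
    rw [h.solve h0]
    refine div_mem (neg_mem (add_mem (mul_mem (hc _ le_rfl) ?_) (sum_mem fun i hi => ?_)))
      (hc 0 (Nat.zero_le _))
    · exact_mod_cast natCast_mem F (k + 1)
    · have hi' := Finset.mem_range.mp hi
      exact mul_mem (hc _ (by omega)) (ih _ (by omega) fun j hj => hc j (by omega))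

theorem unique {K : Type*} [Field K] {c s t : ℕ → K} (hs : NewtonRel c s) (ht : NewtonRel c t)
    (h0 : c 0 ≠ 0) (k : ℕ) : s (k + 1) = t (k + 1) := by
  induction k using Nat.strong_induction_on with
  | _ k ih =>
    rw [hs.solve h0, ht.solve h0]
    congr 3
    refine Finset.sum_congr rfl fun i hi => ?_
    have hi' := Finset.mem_range.mp hi
    rw [ih _ (by omega)]

theorem exists_of_ne_zero {K : Type*} [Field K] {c : ℕ → K} (h0 : c 0 ≠ 0) :
    ∃ s, NewtonRel c s := by
  -- Truncated subtraction makes `s 0` repeat `s 1`. This is harmless: Newton's identities never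
  -- read `s 0`.
  refine ⟨fun k => PowerSeries.coeff (k - 1)
    (-((PowerSeries.mk c)⁻¹ * PowerSeries.derivative K (PowerSeries.mk c))), ?_⟩
  rw [iff_powerSeries]
  have : (PowerSeries.mk fun k => PowerSeries.coeff (k + 1 - 1)
      (-((PowerSeries.mk c)⁻¹ * PowerSeries.derivative K (PowerSeries.mk c)))) =
      -((PowerSeries.mk c)⁻¹ * PowerSeries.derivative K (PowerSeries.mk c)) := by
    ext k
    simp
  rw [this, mul_neg, neg_neg, ← mul_assoc, PowerSeries.mul_inv_cancel _ (by simpa using h0),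
    one_mul]

/-- Logarithmic derivatives of products add. -/
theorem mul {R : Type*} [CommRing R] {C D : PowerSeries R} {s t : ℕ → R}
    (hs : NewtonRel (fun k => PowerSeries.coeff k C) s)
    (ht : NewtonRel (fun k => PowerSeries.coeff k D) t) :
    NewtonRel (fun k => PowerSeries.coeff k (C * D)) (fun k => s k + t k) := by
  rw [iff_powerSeries] at *
  have h1 : ∀ E : PowerSeries R, (PowerSeries.mk fun k => PowerSeries.coeff k E) = E := by
    intro E; ext; simp
  rw [h1] at *
  have h2 : (PowerSeries.mk fun k => s (k + 1) + t (k + 1)) =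
      (PowerSeries.mk fun k => s (k + 1)) + PowerSeries.mk fun k => t (k + 1) := by
    ext; simp
  rw [h2, Derivation.leibniz, hs, ht]
  simp only [smul_eq_mul]
  ring

theorem smul {R : Type*} [CommRing R] {c s : ℕ → R} (hs : NewtonRel c s) (a : R) :
    NewtonRel (fun k => a * c k) s := by
  intro k
  have := hs k
  have h2 : ∑ i ∈ Finset.range (k + 1), a * c i * s (k - i + 1) =
      a * ∑ i ∈ Finset.range (k + 1), c i * s (k - i + 1) := by
    rw [Finset.mul_sum]
    exact Finset.sum_congr rfl fun i _ => by ring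
  rw [h2]
  linear_combination a * this

theorem map {R S : Type*} [CommRing R] [CommRing S] (φ : R →+* S) {c s : ℕ → R}
    (hs : NewtonRel c s) : NewtonRel (fun k => φ (c k)) (fun k => φ (s k)) := by
  intro k
  have := congrArg φ (hs k)
  simpa using this

/-- For `C = 1 - aX`, the quotient `-C'/C` is the geometric series `a / (1 - aX)`. -/
theorem linear {R : Type*} [CommRing R] (a : R) :
    NewtonRel (fun k => PowerSeries.coeff k (1 - PowerSeries.C a * PowerSeries.X))
      (fun k => a ^ k) := by
  intro k
  rw [Finset.sum_range_succ']
  rcases k with _ | k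
  · simp [PowerSeries.coeff_one]
  · rw [Finset.sum_range_succ']
    simp [PowerSeries.coeff_one]
    ring

theorem one {R : Type*} [CommRing R] :
    NewtonRel (fun k => PowerSeries.coeff k (1 : PowerSeries R)) (fun _ => 0) := by
  intro k
  simp [PowerSeries.coeff_one]

theorem prod {R ι : Type*} [CommRing R] (S : Finset ι) (C : ι → PowerSeries R) (s : ι → ℕ → R)
    (h : ∀ i ∈ S, NewtonRel (fun k => PowerSeries.coeff k (C i)) (s i)) :
    NewtonRel (fun k => PowerSeries.coeff k (∏ i ∈ S, C i)) (fun k => ∑ i ∈ S, s i k) := by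
  classical
  induction S using Finset.induction_on with
  | empty => simpa only [Finset.prod_empty, Finset.sum_empty] using one
  | insert a S ha ih =>
    simp only [Finset.prod_insert ha, Finset.sum_insert ha]
    exact (h a (Finset.mem_insert_self _ _)).mul
      (ih fun i hi => h i (Finset.mem_insert_of_mem hi))

/-- Each identity is polynomial in finitely many terms, hence closed under pointwise limits.
Convergence of `s` is asked only from index `1` on, since the zeroth power sums of finite products
count factors and diverge. -/
theorem tendsto {R ι : Type*} [CommRing R] [TopologicalSpace R] [IsTopologicalRing R] [T2Space R]
    {l : Filter ι} [l.NeBot] {c s : ι → ℕ → R} {c' s' : ℕ → R} (h : ∀ i, NewtonRel (c i) (s i))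
    (hc : ∀ k, Tendsto (fun i => c i k) l (𝓝 (c' k)))
    (hs : ∀ k, Tendsto (fun i => s i (k + 1)) l (𝓝 (s' (k + 1)))) : NewtonRel c' s' := by
  intro k
  refine tendsto_nhds_unique (f := fun i => c i (k + 1) * (k + 1) +
    ∑ j ∈ Finset.range (k + 1), c i j * s i (k - j + 1)) (l := l) ?_ ?_
  · exact ((hc _).mul tendsto_const_nhds).add
      (tendsto_finsetSum _ fun j _ => (hc j).mul (hs _))
  · simp [h _ k]

end NewtonRel

/-! ### Taylor series at the origin -/

/-- The Taylor series of `f` at `0`. -/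
noncomputable def taylorPS (f : ℂ → ℂ) : PowerSeries ℂ :=
  PowerSeries.mk fun k => iteratedDeriv k f 0 / k.factorial

theorem coeff_taylorPS (f : ℂ → ℂ) (k : ℕ) :
    PowerSeries.coeff k (taylorPS f) = iteratedDeriv k f 0 / k.factorial := by
  simp [taylorPS]

theorem taylorPS_mul {f g : ℂ → ℂ} (hf : AnalyticAt ℂ f 0) (hg : AnalyticAt ℂ g 0) :
    taylorPS (f * g) = taylorPS f * taylorPS g := by
  ext k
  rw [coeff_taylorPS, PowerSeries.coeff_mul, iteratedDeriv_mul hf.contDiffAt hg.contDiffAt,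
    Finset.Nat.sum_antidiagonal_eq_sum_range_succ_mk, Finset.sum_div]
  refine Finset.sum_congr rfl fun i hi => ?_
  have hi' : i ≤ k := Nat.lt_succ_iff.mp (Finset.mem_range.mp hi)
  rw [coeff_taylorPS, coeff_taylorPS, Nat.cast_choose ℂ hi']
  have h1 : (k.factorial : ℂ) ≠ 0 := Nat.cast_ne_zero.mpr k.factorial_ne_zero
  field_simp

theorem taylorPS_deriv (f : ℂ → ℂ) :
    taylorPS (deriv f) = PowerSeries.derivative ℂ (taylorPS f) := by
  ext k
  rw [coeff_taylorPS, PowerSeries.coeff_derivative, coeff_taylorPS, ← iteratedDeriv_succ',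
    Nat.factorial_succ]
  have := Nat.factorial_ne_zero k
  push_cast
  field_simp

theorem taylorPS_congr {f g : ℂ → ℂ} (h : f =ᶠ[𝓝 0] g) : taylorPS f = taylorPS g := by
  ext k
  rw [coeff_taylorPS, coeff_taylorPS, h.iteratedDeriv_eq]

theorem taylorPS_prod {ι : Type*} (S : Finset ι) (f : ι → ℂ → ℂ)
    (hf : ∀ i ∈ S, AnalyticAt ℂ (f i) 0) :
    taylorPS (∏ i ∈ S, f i) = ∏ i ∈ S, taylorPS (f i) := by
  classical
  induction S using Finset.induction_on with
  | empty =>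
    ext k
    rw [coeff_taylorPS, Finset.prod_empty, Finset.prod_empty, Pi.one_def, iteratedDeriv_const,
      PowerSeries.coeff_one]
    split_ifs with h <;> simp [h]
  | insert a S ha ih =>
    rw [Finset.prod_insert ha, Finset.prod_insert ha, taylorPS_mul
      (hf a (Finset.mem_insert_self _ _)) (Finset.analyticAt_prod _ fun i hi =>
        hf i (Finset.mem_insert_of_mem hi)), ih fun i hi => hf i (Finset.mem_insert_of_mem hi)]

/-- Convergence at a point of modulus `s < r` makes the terms there tend to `0`, which puts `s`
below the radius of convergence. -/
theorem hasFPowerSeriesOnBall_of_hasSum {f : ℂ → ℂ} {c : ℕ → ℂ} {r : ℝ} (hr : 0 < r)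
    (h : ∀ z : ℂ, ‖z‖ < r → HasSum (fun k => c k * z ^ k) (f z)) :
    HasFPowerSeriesOnBall f (FormalMultilinearSeries.ofScalars ℂ c) 0 (ENNReal.ofReal r) := by
  refine ⟨?_, by simpa using hr, fun {y} hy => ?_⟩
  · refine ENNReal.le_of_forall_nnreal_lt fun s hs => ?_
    refine FormalMultilinearSeries.le_radius_of_tendsto _ (l := 0) ?_
    have hs' : ‖((s : ℝ) : ℂ)‖ < r := by
      simpa using (ENNReal.lt_ofReal_iff_toReal_lt ENNReal.coe_ne_top).mp hs
    have := (h _ hs').summable.tendsto_atTop_zero.norm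
    simpa [FormalMultilinearSeries.ofScalars_norm] using this
  · have hy' : ‖y‖ < r := by
      rwa [Metric.mem_eball, edist_zero_right, ← ofReal_norm,
        ENNReal.ofReal_lt_ofReal_iff hr] at hy
    simpa [FormalMultilinearSeries.ofScalars_apply_eq, mul_comm] using h y hy'

theorem differentiable_of_hasSum {f : ℂ → ℂ} {c : ℕ → ℂ}
    (h : ∀ z : ℂ, HasSum (fun k => c k * z ^ k) (f z)) : Differentiable ℂ f := by
  intro z
  have hz : 0 < ‖z‖ + 1 := by positivity
  refine ((hasFPowerSeriesOnBall_of_hasSum hz fun w _ => h w).analyticAt_of_mem ?_).differentiableAt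
  rw [Metric.mem_eball, edist_zero_right, ← ofReal_norm, ENNReal.ofReal_lt_ofReal_iff hz]
  exact lt_add_one _

theorem coeff_taylorPS_of_hasSum {f : ℂ → ℂ} {c : ℕ → ℂ} {r : ℝ} (hr : 0 < r)
    (h : ∀ z : ℂ, ‖z‖ < r → HasSum (fun k => c k * z ^ k) (f z)) (k : ℕ) :
    PowerSeries.coeff k (taylorPS f) = c k := by
  have hp := hasFPowerSeriesOnBall_of_hasSum hr h
  have := hp.hasFPowerSeriesAt.eq_formalMultilinearSeries
    (hp.analyticAt.hasFPowerSeriesAt)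
  have h2 := congrArg (fun p => FormalMultilinearSeries.coeff p k) this
  simp only [FormalMultilinearSeries.coeff_ofScalars] at h2
  rw [coeff_taylorPS, h2]

theorem hasSum_taylorPS {f : ℂ → ℂ} (hf : Differentiable ℂ f) (z : ℂ) :
    HasSum (fun k => PowerSeries.coeff k (taylorPS f) * z ^ k) (f z) := by
  refine (Complex.hasSum_taylorSeries_of_entire hf 0 z).congr_fun ?_
  intro k
  rw [coeff_taylorPS, sub_zero, smul_eq_mul, smul_eq_mul]
  ring

theorem taylorPS_one_sub_mul (a : ℂ) :
    taylorPS (fun z => 1 - a * z) = 1 - PowerSeries.C a * PowerSeries.X := by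
  ext k
  refine coeff_taylorPS_of_hasSum (c := fun k =>
    PowerSeries.coeff k (1 - PowerSeries.C a * PowerSeries.X)) one_pos (fun z _ => ?_) k
  have := hasSum_sum_of_ne_finset_zero (L := SummationFilter.unconditional ℕ) (f := fun k =>
    PowerSeries.coeff k (1 - PowerSeries.C a * PowerSeries.X) * z ^ k)
    (s := {0, 1}) (by
      intro b hb
      simp only [Finset.mem_insert, Finset.mem_singleton, not_or] at hb
      obtain ⟨b, rfl⟩ := Nat.exists_eq_succ_of_ne_zero hb.1
      simp_all [PowerSeries.coeff_one, PowerSeries.coeff_C])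
  convert this using 1
  simp [PowerSeries.coeff_one, PowerSeries.coeff_X]
  ring

/-- Here `h` behaves like a constant times `exp F`, so `-h'/h = -F'`: a zero-free factor contributes
`-k Fₖ` to the Newton sums. -/
theorem newtonRel_taylorPS_of_deriv {h F : ℂ → ℂ} (hh : AnalyticAt ℂ h 0) (hF : AnalyticAt ℂ F 0)
    (H : ∀ᶠ z in 𝓝 0, deriv h z = h z * deriv F z) :
    NewtonRel (fun k => PowerSeries.coeff k (taylorPS h))
      (fun k => -(k * PowerSeries.coeff k (taylorPS F))) := by
  rw [NewtonRel.iff_powerSeries]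
  have h1 : (PowerSeries.mk fun k => PowerSeries.coeff k (taylorPS h)) = taylorPS h := by
    ext; simp
  have h2 : (PowerSeries.mk fun k => -(((k + 1 : ℕ) : ℂ) *
      PowerSeries.coeff (k + 1) (taylorPS F))) = -PowerSeries.derivative ℂ (taylorPS F) := by
    ext k
    simp [PowerSeries.coeff_derivative, mul_comm]
  rw [h1, h2, ← taylorPS_deriv, ← taylorPS_deriv, taylorPS_congr (g := h * deriv F) H,
    taylorPS_mul hh hF.deriv]
  ring

/-! ### Genus zero products -/

/-- The genus zero product `∏ₙ (1 - λₙ z)`. -/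
noncomputable def genusZeroProd (lam : ℕ → ℂ) (z : ℂ) : ℂ := ∏' n, (1 - lam n * z)

section GenusZero

variable {lam : ℕ → ℂ}

theorem multipliable_one_sub_mul (h : Summable fun n => ‖lam n‖) (z : ℂ) :
    Multipliable fun n => 1 - lam n * z := by
  simpa [sub_eq_add_neg] using multipliable_one_add_of_summable (f := fun n => -(lam n * z))
    (by simpa using h.mul_right ‖z‖)

theorem summable_pow_of_summable_norm (h : Summable fun n => ‖lam n‖) {k : ℕ} (hk : 1 ≤ k) :
    Summable fun n => lam n ^ k := by
  refine Summable.of_norm_bounded_eventually h ?_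
  -- All but finitely many `λₙ` have modulus at most `1`, and for those `|λₙ|ᵏ ≤ |λₙ|`.
  filter_upwards [h.tendsto_cofinite_zero.eventually_le_const one_pos] with n hn
  rw [norm_pow]
  exact pow_le_of_le_one (norm_nonneg _) hn (by omega)

/-- On a compact set with `|z| ≤ B`, the factors differ from `1` by at most the summable `|λₙ| B`.
-/
theorem tendstoLocallyUniformlyOn_genusZeroProd (h : Summable fun n => ‖lam n‖) :
    TendstoLocallyUniformlyOn (fun N z => ∏ n ∈ Finset.range N, (1 - lam n * z))
      (genusZeroProd lam) atTop Set.univ := by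
  have key : HasProdLocallyUniformlyOn (fun n z => 1 + -(lam n * z))
      (fun z => ∏' n, (1 + -(lam n * z))) Set.univ := by
    refine hasProdLocallyUniformlyOn_of_forall_compact isOpen_univ fun K _ hK => ?_
    obtain ⟨B, hB⟩ := hK.isBounded.exists_norm_le
    refine Summable.hasProdUniformlyOn_one_add hK (h.mul_right B)
      (Eventually.of_forall fun n z hz => ?_) (fun n => by fun_prop)
    rw [norm_neg, norm_mul]
    exact mul_le_mul_of_nonneg_left (hB z hz) (norm_nonneg _)
  simpa only [← sub_eq_add_neg] using! key.tendstoLocallyUniformlyOn_finsetRange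

theorem differentiable_genusZeroProd (h : Summable fun n => ‖lam n‖) :
    Differentiable ℂ (genusZeroProd lam) :=
  differentiableOn_univ.mp <| (tendstoLocallyUniformlyOn_genusZeroProd h).differentiableOn
    (Eventually.of_forall fun N => by fun_prop) isOpen_univ

/-- Weierstrass: locally uniform convergence of holomorphic functions is inherited by derivatives.
-/
theorem tendsto_iteratedDeriv_of_entire {F : ℕ → ℂ → ℂ} {f : ℂ → ℂ}
    (h : TendstoLocallyUniformlyOn F f atTop Set.univ) (hF : ∀ n, Differentiable ℂ (F n))
    (k : ℕ) (z : ℂ) :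
    Tendsto (fun n => iteratedDeriv k (F n) z) atTop (𝓝 (iteratedDeriv k f z)) := by
  suffices TendstoLocallyUniformlyOn (fun n => iteratedDeriv k (F n)) (iteratedDeriv k f) atTop
      Set.univ from this.tendsto_at (Set.mem_univ z)
  induction k with
  | zero => simpa using h
  | succ k ih =>
    simp only [iteratedDeriv_succ]
    refine ih.deriv (Eventually.of_forall fun n => ?_) isOpen_univ
    exact ((hF n).contDiff (n := k + 1).differentiable_iteratedDeriv k
      (by exact_mod_cast Nat.lt_succ_self k)).differentiableOn

/-- Newton's identities hold for the partial products; their Taylor coefficients and their power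
sums both converge. -/
theorem newtonRel_genusZeroProd (h : Summable fun n => ‖lam n‖) :
    NewtonRel (fun k => PowerSeries.coeff k (taylorPS (genusZeroProd lam))) (powerSum lam) := by
  refine NewtonRel.tendsto (l := atTop)
    (c := fun N k => PowerSeries.coeff k
      (taylorPS (∏ n ∈ Finset.range N, fun z => 1 - lam n * z)))
    (s := fun N k => ∑ n ∈ Finset.range N, lam n ^ k) ?_ ?_ ?_
  · intro N
    rw [taylorPS_prod _ _ fun i _ => by fun_prop]
    refine NewtonRel.prod _ _ _ fun n _ => ?_
    simpa only [taylorPS_one_sub_mul] using NewtonRel.linear (lam n)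
  · intro k
    simp only [coeff_taylorPS]
    refine (tendsto_iteratedDeriv_of_entire (F := fun N => ∏ n ∈ Finset.range N,
      fun z => 1 - lam n * z) ?_ (fun N => ?_) k 0).div_const _
    · convert tendstoLocallyUniformlyOn_genusZeroProd h using 2 with N
      ext z
      simp
    · exact fun z => DifferentiableAt.finsetProd fun i _ => by fun_prop
  · intro k
    exact (summable_pow_of_summable_norm h (by omega)).hasSum.tendsto_sum_nat

theorem coeff_taylorPS_genusZeroProd_zero (lam : ℕ → ℂ) :
    PowerSeries.coeff 0 (taylorPS (genusZeroProd lam)) = 1 := by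
  simp [coeff_taylorPS, genusZeroProd]

theorem IsCoeffSeq.coeff_eq {e : ℕ → ℂ} (he : IsCoeffSeq lam e) (k : ℕ) :
    PowerSeries.coeff k (taylorPS (genusZeroProd lam)) = (-1) ^ k * e k :=
  coeff_taylorPS_of_hasSum one_pos (fun z _ => he z) k

theorem existsUnique_isCoeffSeq (h : Summable fun n => ‖lam n‖) :
    ∃! e : ℕ → ℂ, IsCoeffSeq lam e := by
  have sq : ∀ k : ℕ, ((-1 : ℂ) ^ k) * (-1) ^ k = 1 := fun k => by
    rw [← mul_pow]; norm_num
  refine ⟨fun k => (-1) ^ k * PowerSeries.coeff k (taylorPS (genusZeroProd lam)), ?_, ?_⟩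
  · intro z
    refine (hasSum_taylorPS (differentiable_genusZeroProd h) z).congr_fun fun k => ?_
    rw [← mul_assoc, sq, one_mul]
  · intro e he
    ext k
    rw [he.coeff_eq, ← mul_assoc, sq, one_mul]

theorem IsCoeffSeq.newtonRel {e : ℕ → ℂ} (h : Summable fun n => ‖lam n‖)
    (he : IsCoeffSeq lam e) : NewtonRel (fun k => (-1) ^ k * e k) (powerSum lam) := by
  simpa only [he.coeff_eq] using newtonRel_genusZeroProd h

theorem IsCoeffSeq.zero {e : ℕ → ℂ} (he : IsCoeffSeq lam e) : e 0 = 1 := by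
  have := he.coeff_eq 0
  rw [coeff_taylorPS_genusZeroProd_zero] at this
  simpa using this.symm

theorem IsCoeffSeq.powerSum_mem {S : Type*} [SetLike S ℂ] [SubfieldClass S ℂ] {F : S} {e : ℕ → ℂ}
    (h : Summable fun n => ‖lam n‖) (he : IsCoeffSeq lam e) (hF : ∀ k, e k ∈ F) {k : ℕ}
    (hk : 1 ≤ k) : powerSum lam k ∈ F := by
  obtain ⟨k, rfl⟩ := Nat.exists_eq_add_of_le' hk
  exact (he.newtonRel h).mem_subfield (by simp [he.zero]) k
    fun i _ => mul_mem (pow_mem (neg_mem (one_mem F)) _) (hF i)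

end GenusZero

/-! ### Rational functions on a set of parameters -/

namespace IsRationalOn

variable {σ : Type} {D : Set (σ → ℂ)} {f g : (σ → ℂ) → ℂ}

theorem congr (hf : IsRationalOn D f) (h : ∀ x ∈ D, g x = f x) : IsRationalOn D g := by
  obtain ⟨P, Q, hPQ⟩ := hf
  exact ⟨P, Q, fun x hx => ⟨(hPQ x hx).1, (h x hx).trans (hPQ x hx).2⟩⟩

theorem const (D : Set (σ → ℂ)) (a : ℚ) : IsRationalOn D fun _ => (a : ℂ) :=
  ⟨MvPolynomial.C a, 1, fun x _ => by simp⟩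

theorem natCast (D : Set (σ → ℂ)) (n : ℕ) : IsRationalOn D fun _ => (n : ℂ) :=
  (const D n).congr fun _ _ => by simp

theorem coord (D : Set (σ → ℂ)) (i : σ) : IsRationalOn D fun x => x i :=
  ⟨MvPolynomial.X i, 1, fun x _ => by simp⟩

theorem add (hf : IsRationalOn D f) (hg : IsRationalOn D g) :
    IsRationalOn D fun x => f x + g x := by
  obtain ⟨P, Q, hPQ⟩ := hf
  obtain ⟨P', Q', hPQ'⟩ := hg
  refine ⟨P * Q' + P' * Q, Q * Q', fun x hx => ?_⟩
  obtain ⟨h1, h2⟩ := hPQ x hx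
  obtain ⟨h3, h4⟩ := hPQ' x hx
  simp only [h2, h4, map_mul, map_add]
  refine ⟨mul_ne_zero h1 h3, ?_⟩
  field_simp

theorem mul (hf : IsRationalOn D f) (hg : IsRationalOn D g) :
    IsRationalOn D fun x => f x * g x := by
  obtain ⟨P, Q, hPQ⟩ := hf
  obtain ⟨P', Q', hPQ'⟩ := hg
  refine ⟨P * P', Q * Q', fun x hx => ?_⟩
  obtain ⟨h1, h2⟩ := hPQ x hx
  obtain ⟨h3, h4⟩ := hPQ' x hx
  simp only [h2, h4, map_mul]
  refine ⟨mul_ne_zero h1 h3, ?_⟩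
  field_simp

theorem neg (hf : IsRationalOn D f) : IsRationalOn D fun x => -f x :=
  ((const D (-1)).mul hf).congr fun x _ => by simp

theorem inv (hf : IsRationalOn D f) (h : ∀ x ∈ D, f x ≠ 0) : IsRationalOn D fun x => (f x)⁻¹ := by
  obtain ⟨P, Q, hPQ⟩ := hf
  refine ⟨Q, P, fun x hx => ?_⟩
  obtain ⟨h1, h2⟩ := hPQ x hx
  have := h x hx
  simp only [h2] at this ⊢
  exact ⟨fun h0 => this (by simp [h0]), inv_div _ _⟩

theorem div (hf : IsRationalOn D f) (hg : IsRationalOn D g) (h : ∀ x ∈ D, g x ≠ 0) :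
    IsRationalOn D fun x => f x / g x :=
  (hf.mul (hg.inv h)).congr fun _ _ => div_eq_mul_inv _ _

theorem pow (hf : IsRationalOn D f) (n : ℕ) : IsRationalOn D fun x => f x ^ n := by
  induction n with
  | zero => simpa using const D 1
  | succ n ih => simpa only [pow_succ] using ih.mul hf

theorem zpow (hf : IsRationalOn D f) (h : ∀ x ∈ D, f x ≠ 0) (n : ℤ) :
    IsRationalOn D fun x => f x ^ n := by
  obtain ⟨n, rfl | rfl⟩ := n.eq_nat_or_neg
  · simpa using hf.pow n
  · simpa using (hf.pow n).inv fun x hx => pow_ne_zero _ (h x hx)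

theorem sum {ι : Type*} (S : Finset ι) {F : ι → (σ → ℂ) → ℂ} (h : ∀ i ∈ S, IsRationalOn D (F i)) :
    IsRationalOn D fun x => ∑ i ∈ S, F i x := by
  classical
  induction S using Finset.induction_on with
  | empty => simpa using const D 0
  | insert a S ha ih =>
    simp only [Finset.sum_insert ha]
    exact (h a (Finset.mem_insert_self _ _)).add
      (ih fun i hi => h i (Finset.mem_insert_of_mem hi))

theorem prod {ι : Type*} (S : Finset ι) {F : ι → (σ → ℂ) → ℂ}
    (h : ∀ i ∈ S, IsRationalOn D (F i)) : IsRationalOn D fun x => ∏ i ∈ S, F i x := by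
  classical
  induction S using Finset.induction_on with
  | empty => simpa using const D 1
  | insert a S ha ih =>
    simp only [Finset.prod_insert ha]
    exact (h a (Finset.mem_insert_self _ _)).mul
      (ih fun i hi => h i (Finset.mem_insert_of_mem hi))

/-- The recursion of `NewtonRel.solve` read over functions on `D`. The only new denominator at each
stage is `c 0`, which has no zero on `D`. -/
theorem of_newtonRel {c s : (σ → ℂ) → ℕ → ℂ} (hc : ∀ k, IsRationalOn D fun x => c x k)
    (h0 : ∀ x ∈ D, c x 0 ≠ 0) (h : ∀ x ∈ D, NewtonRel (c x) (s x)) (k : ℕ) :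
    IsRationalOn D fun x => s x (k + 1) := by
  induction k using Nat.strong_induction_on with
  | _ k ih =>
    refine IsRationalOn.congr ?_ fun x hx => (h x hx).solve (h0 x hx) k
    refine ((((hc _).mul ?_).add (sum _ fun i hi => ?_)).neg).div (hc 0) h0
    · simpa using natCast D (k + 1)
    · have hi' := Finset.mem_range.mp hi
      exact (hc _).mul (ih _ (by omega))

end IsRationalOn

theorem IsRationalOn.powerSum {σ : Type} {D : Set (σ → ℂ)} {lam e : (σ → ℂ) → ℕ → ℂ}
    (hs : ∀ x ∈ D, Summable fun n => ‖lam x n‖) (he : ∀ x ∈ D, IsCoeffSeq (lam x) (e x))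
    (hr : ∀ k, IsRationalOn D fun x => e x k) {k : ℕ} (hk : 1 ≤ k) :
    IsRationalOn D fun x => powerSum (lam x) k := by
  obtain ⟨k, rfl⟩ := Nat.exists_eq_add_of_le' hk
  refine IsRationalOn.of_newtonRel (c := fun x k => (-1) ^ k * e x k) (fun k => ?_) ?_
    (fun x hx => (he x hx).newtonRel (hs x hx)) k
  · exact ((IsRationalOn.const D ((-1) ^ k)).mul (hr k)).congr fun x _ => by simp
  · intro x hx
    simp [(he x hx).zero]

/-! ### Entire functions of genus zero with rational Taylor coefficients -/

/-- The value `1` at the origin forces `m = 0` and then `C = 1`. -/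
theorem HasGenusZero.exists_factorization {f : ℂ → ℂ} (hf : HasGenusZero f) (h0 : f 0 = 1) :
    ∃ lam, IsGenusZeroFactorization f lam := by
  obtain ⟨C, m, lam, hC, hs, h⟩ := hf
  have := h 0
  rw [h0] at this
  have hm : m = 0 := by
    by_contra hm
    simp [zero_pow hm] at this
  subst hm
  have hC1 : C = 1 := by simpa using this.symm
  exact ⟨lam, hs, fun z => by rw [h, hC1]; simp⟩

theorem IsRationalOn.powerSum_of_series {σ : Type} {D : Set (σ → ℂ)} {a : (σ → ℂ) → ℕ → ℂ}
    {c : (σ → ℂ) → ℂ} (ha : ∀ n, IsRationalOn D fun x => a x n) (hc : IsRationalOn D c)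
    (hs : ∀ x ∈ D, ∀ z : ℂ, Summable fun n => a x n * (c x * z) ^ n)
    {lam : (σ → ℂ) → ℕ → ℂ} (hl : ∀ x ∈ D, IsGenusZeroFactorization
      (fun z => ∑' n, a x n * (c x * z) ^ n) (lam x)) {k : ℕ} (hk : 1 ≤ k) :
    IsRationalOn D fun x => _root_.powerSum (lam x) k := by
  refine IsRationalOn.powerSum (e := fun x n => (-1) ^ n * (a x n * c x ^ n))
    (fun x hx => (hl x hx).1) (fun x hx z => ?_) (fun n => ?_) hk
  · rw [← (hl x hx).2 z]
    refine (hs x hx z).hasSum.congr_fun fun n => ?_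
    have : ((-1 : ℂ) ^ n) * (-1) ^ n = 1 := by rw [← mul_pow]; norm_num
    rw [← mul_assoc ((-1 : ℂ) ^ n), this, mul_pow]
    ring
  · exact ((IsRationalOn.const D ((-1) ^ n)).mul ((ha n).mul (hc.pow n))).congr
      fun x _ => by simp

theorem ascPochhammer_eval_eq_prod_range {R : Type*} [CommSemiring R] (n : ℕ) (x : R) :
    (ascPochhammer R n).eval x = ∏ k ∈ Finset.range n, (x + k) := by
  induction n with
  | zero => simp
  | succ n ih => rw [ascPochhammer_succ_eval, ih, Finset.prod_range_succ]

theorem isRationalOn_hypCoeff {r s : ℕ} {D : Set (Fin r ⊕ Fin s → ℂ)}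
    (hD : ∀ x ∈ D, ∀ (j : Fin s) (n : ℕ), x (Sum.inr j) ≠ -(n : ℂ)) (n : ℕ) :
    IsRationalOn D fun x => hypCoeff (fun i => x (Sum.inl i)) (fun j => x (Sum.inr j)) n := by
  have hp : ∀ i, IsRationalOn D fun x => (ascPochhammer ℂ n).eval (x i) := fun i => by
    simp only [ascPochhammer_eval_eq_prod_range]
    exact IsRationalOn.prod _ fun k _ => (IsRationalOn.coord D i).add (IsRationalOn.natCast D k)
  refine (IsRationalOn.prod _ fun i _ => hp _).div
    ((IsRationalOn.prod _ fun j _ => hp _).mul (IsRationalOn.natCast D _)) fun x hx => ?_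
  refine mul_ne_zero (Finset.prod_ne_zero_iff.mpr fun j _ => ?_)
    (Nat.cast_ne_zero.mpr n.factorial_ne_zero)
  rw [ascPochhammer_eval_eq_prod_range]
  refine Finset.prod_ne_zero_iff.mpr fun k _ h => hD x hx j k ?_
  linear_combination h

theorem IsRationalOn.qPoch {σ : Type} {D : Set (σ → ℂ)} {a q : (σ → ℂ) → ℂ}
    (ha : IsRationalOn D a) (hq : IsRationalOn D q) (n : ℕ) :
    IsRationalOn D fun x => _root_.qPoch (a x) (q x) n :=
  IsRationalOn.prod _ fun k _ => ((IsRationalOn.const D 1).add (ha.mul (hq.pow k)).neg).congr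
    fun x _ => by simp [sub_eq_add_neg]

/-- The exponent `1 + s - r` may be negative, so `q ≠ 0` is needed as well as nonvanishing
denominators. -/
theorem isRationalOn_qHypCoeff {r s : ℕ} {D : Set (Option (Fin r ⊕ Fin s) → ℂ)}
    (hq : ∀ x ∈ D, 0 < ‖x none‖ ∧ ‖x none‖ < 1)
    (hD : ∀ x ∈ D, ∀ (j : Fin s) (n : ℕ), x (some (Sum.inr j)) * x none ^ n ≠ 1) (n : ℕ) :
    IsRationalOn D fun x => qHypCoeff (x none) (fun i => x (some (Sum.inl i)))
      (fun j => x (some (Sum.inr j))) n := by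
  have hp : ∀ i, IsRationalOn D fun x => qPoch (x i) (x none) n := fun i =>
    (IsRationalOn.coord D i).qPoch (IsRationalOn.coord D none) n
  have hq0 : ∀ x ∈ D, x none ≠ 0 := fun x hx => norm_pos_iff.mp (hq x hx).1
  refine ((IsRationalOn.prod _ fun i _ => hp _).div
    ((IsRationalOn.prod _ fun j _ => hp _).mul (hp none)) fun x hx => ?_).mul
    (IsRationalOn.zpow ?_ (fun x hx => ?_) _)
  · refine mul_ne_zero (Finset.prod_ne_zero_iff.mpr fun j _ =>
      Finset.prod_ne_zero_iff.mpr fun k _ h => hD x hx j k ?_)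
      (Finset.prod_ne_zero_iff.mpr fun k _ h => ?_)
    · linear_combination -h
    -- A vanishing factor of `(q; q)ₙ` would make `q` a root of unity, against `|q| < 1`.
    · have h1 : x none ^ (k + 1) = 1 := by rw [pow_succ']; linear_combination -h
      have h2 := congrArg norm h1
      rw [norm_pow, norm_one] at h2
      exact (pow_lt_one₀ (norm_nonneg _) (hq x hx).2 (Nat.succ_ne_zero k)).ne h2
  · exact ((IsRationalOn.const D ((-1) ^ n)).mul
      ((IsRationalOn.coord D none).pow (n.choose 2))).congr fun x _ => by simp
  · exact mul_ne_zero (pow_ne_zero _ (by norm_num)) (pow_ne_zero _ (hq0 x hx))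

theorem hypSeries_zero {r s : ℕ} (a : Fin r → ℂ) (b : Fin s → ℂ) : hypSeries a b 0 = 1 := by
  rw [hypSeries, tsum_eq_single 0 fun n hn => by simp [hn]]
  simp [hypCoeff]

theorem qHypSeries_zero {r s : ℕ} (q : ℂ) (a : Fin r → ℂ) (b : Fin s → ℂ) :
    qHypSeries q a b 0 = 1 := by
  rw [qHypSeries, tsum_eq_single 0 fun n hn => by simp [hn]]
  simp [qHypCoeff, qPoch]

/-! ### Even zeta values -/

theorem riemannZeta_two_mul_mem_adjoin {n : ℕ} (hn : 1 ≤ n) :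
    riemannZeta (2 * n) ∈ IntermediateField.adjoin ℚ {(π : ℂ) ^ 2} := by
  rw [riemannZeta_two_mul_nat (by omega)]
  have hπ : (π : ℂ) ^ (2 * n) ∈ IntermediateField.adjoin ℚ {(π : ℂ) ^ 2} := by
    rw [pow_mul]
    exact pow_mem (IntermediateField.mem_adjoin_simple_self ℚ _) _
  have hQ : ∀ a : ℚ, (a : ℂ) ∈ IntermediateField.adjoin ℚ {(π : ℂ) ^ 2} := fun a =>
    (IntermediateField.adjoin ℚ {(π : ℂ) ^ 2}).algebraMap_mem a
  have : (-1 : ℂ) ^ (n + 1) * 2 ^ (2 * n - 1) * (π : ℂ) ^ (2 * n) * (bernoulli (2 * n) : ℂ) /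
      ((2 * n).factorial : ℂ) = (((-1) ^ (n + 1) * 2 ^ (2 * n - 1) * bernoulli (2 * n) /
        (2 * n).factorial : ℚ) : ℂ) * (π : ℂ) ^ (2 * n) := by
    push_cast
    ring
  rw [this]
  exact mul_mem (hQ _) hπ

/-! ### Power sums of the zeros of an entire function -/

theorem analyticOrderAt_ne_top_of_entire {g : ℂ → ℂ} (hg : Differentiable ℂ g) {w : ℂ}
    (hw : g w ≠ 0) (ρ : ℂ) : analyticOrderAt g ρ ≠ ⊤ := by
  intro h
  rw [analyticOrderAt_eq_top] at h
  have := AnalyticOnNhd.eqOn_zero_of_preconnected_of_eventuallyEq_zero (U := Set.univ)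
    (fun z _ => hg.analyticAt z) isPreconnected_univ (Set.mem_univ ρ) h (Set.mem_univ w)
  exact hw this

theorem finite_zeros {g : ℂ → ℂ} (hg : Differentiable ℂ g) {w : ℂ} (hw : g w ≠ 0) (R : ℝ) :
    {z : ℂ | g z = 0 ∧ ‖z‖ ≤ R}.Finite := by
  by_contra hinf
  obtain ⟨x, _, hx⟩ := Set.Infinite.exists_accPt_of_subset_isCompact hinf
    (isCompact_closedBall (0 : ℂ) R) fun z hz => by simpa using hz.2
  have hf : ∃ᶠ z in 𝓝[≠] x, g z = 0 := by
    rw [accPt_iff_frequently_nhdsNE] at hx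
    exact hx.mono fun z hz => hz.1
  exact hw (AnalyticOnNhd.eqOn_zero_of_preconnected_of_frequently_eq_zero (U := Set.univ)
    (fun z _ => hg.analyticAt z) isPreconnected_univ (Set.mem_univ x) hf (Set.mem_univ w))

/-- The full order of the zero is divided out in the normalized form `(1 - z/ρ)^m`, so that the
factor equals `1` at the origin. -/
theorem exists_entire_div_pow {f : ℂ → ℂ} (hf : Differentiable ℂ f) {w : ℂ} (hw : f w ≠ 0)
    {ρ : ℂ} (hρ : ρ ≠ 0) :
    ∃ h : ℂ → ℂ, Differentiable ℂ h ∧ h ρ ≠ 0 ∧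
      ∀ z, f z = (1 - ρ⁻¹ * z) ^ analyticOrderNatAt f ρ * h z := by
  obtain ⟨G, hG, hG0, hfG⟩ := (hf.analyticAt ρ).analyticOrderAt_ne_top.mp
    (analyticOrderAt_ne_top_of_entire hf hw ρ)
  set m := analyticOrderNatAt f ρ
  have hne : ∀ z, z ≠ ρ → 1 - ρ⁻¹ * z ≠ 0 := fun z hz h => hz (by
    field_simp at h
    linear_combination -h)
  have hsub : ∀ z, z - ρ = (-ρ) * (1 - ρ⁻¹ * z) := fun z => by field_simp; ring
  -- The value at `ρ` is the one that fills the removable singularity: `(z - ρ)^m = (-ρ)^m (1 -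
  -- z/ρ)^m`.
  let h : ℂ → ℂ := fun z => if z = ρ then (-ρ) ^ m * G ρ else f z / (1 - ρ⁻¹ * z) ^ m
  have heq : h =ᶠ[𝓝 ρ] fun z => (-ρ) ^ m * G z := by
    filter_upwards [hfG] with z hz
    by_cases hzρ : z = ρ
    · simp [h, hzρ]
    · simp only [h, if_neg hzρ]
      rw [div_eq_iff (pow_ne_zero _ (hne z hzρ)), hz, smul_eq_mul, hsub, mul_pow]
      ring
  refine ⟨h, fun z => ?_, ?_, fun z => ?_⟩
  · by_cases hzρ : z = ρ
    · subst hzρ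
      exact heq.differentiableAt_iff.mpr (hG.differentiableAt.const_mul _)
    · have : h =ᶠ[𝓝 z] fun z => f z / (1 - ρ⁻¹ * z) ^ m := by
        filter_upwards [isOpen_ne.mem_nhds hzρ] with y hy
        exact if_neg hy
      rw [this.differentiableAt_iff]
      exact (hf z).div (by fun_prop) (pow_ne_zero _ (hne z hzρ))
  · simp [h, hρ, hG0]
  · by_cases hzρ : z = ρ
    · have := hfG.self_of_nhds
      subst hzρ
      rw [this]
      simp only [h, if_true]
      rw [smul_eq_mul, hsub, mul_pow]
      ring
    · simp only [h, if_neg hzρ]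
      rw [mul_div_cancel₀ _ (pow_ne_zero _ (hne z hzρ))]

theorem exists_entire_div_prod {g : ℂ → ℂ} (hg : Differentiable ℂ g) (h0 : g 0 ≠ 0)
    (S : Finset ℂ) (hS : ∀ ρ ∈ S, ρ ≠ 0) :
    ∃ h : ℂ → ℂ, Differentiable ℂ h ∧ (∀ ρ ∈ S, h ρ ≠ 0) ∧
      ∀ z, g z = (∏ ρ ∈ S, (1 - ρ⁻¹ * z) ^ analyticOrderNatAt g ρ) * h z := by
  classical
  induction S using Finset.induction_on with
  | empty => exact ⟨g, hg, by simp, by simp⟩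
  | insert a S ha ih =>
    obtain ⟨h, hd, hne, hgh⟩ := ih fun ρ hρ => hS ρ (Finset.mem_insert_of_mem hρ)
    have ha0 := hS a (Finset.mem_insert_self _ _)
    have hh0 : h 0 ≠ 0 := by
      have := hgh 0
      intro h1
      simp [h1] at this
      exact h0 this
    obtain ⟨h', hd', hne', hhh⟩ := exists_entire_div_pow hd hh0 ha0
    set P : ℂ → ℂ := fun z => ∏ ρ ∈ S, (1 - ρ⁻¹ * z) ^ analyticOrderNatAt g ρ with hP
    have hPd : Differentiable ℂ P := fun z => DifferentiableAt.fun_finsetProd fun i _ => by fun_prop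
    have hPa : P a ≠ 0 := by
      refine Finset.prod_ne_zero_iff.mpr fun ρ hρ => pow_ne_zero _ fun h1 => ha ?_
      have hρ0 := hS ρ (Finset.mem_insert_of_mem hρ)
      field_simp at h1
      have : a = ρ := by linear_combination -h1
      exact this ▸ hρ
    -- The factors already removed do not vanish at `a`, so the quotient `h` has the same order
    -- there as `g`.
    have hord : analyticOrderNatAt g a = analyticOrderNatAt h a := by
      have hg' : g = P * h := funext hgh
      rw [analyticOrderNatAt, analyticOrderNatAt, hg',
        analyticOrderAt_mul (hPd.analyticAt a) (hd.analyticAt a),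
        (hPd.analyticAt a).analyticOrderAt_eq_zero.mpr hPa, zero_add]
    refine ⟨h', hd', fun ρ hρ h1 => ?_, fun z => ?_⟩
    · rcases Finset.mem_insert.mp hρ with rfl | hρ
      · exact hne' h1
      · exact hne ρ hρ (by rw [hhh, h1, mul_zero])
    · rw [Finset.prod_insert ha, hord, hgh z, hhh z]
      ring

/-! ### Comparison of sums over zeros with Newton sums. -/

theorem newtonRel_prod_pow (S : Finset ℂ) (m : ℂ → ℕ) :
    NewtonRel (fun k => PowerSeries.coeff k
        (taylorPS (∏ ρ ∈ S, fun z => (1 - ρ⁻¹ * z) ^ m ρ)))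
      (fun k => ∑ ρ ∈ S, m ρ * ρ⁻¹ ^ k) := by
  rw [taylorPS_prod _ _ fun i _ => by fun_prop]
  refine NewtonRel.prod _ _ _ fun ρ _ => ?_
  have h1 : (fun z => (1 - ρ⁻¹ * z) ^ m ρ) = ∏ _i ∈ Finset.range (m ρ), fun z => 1 - ρ⁻¹ * z := by
    ext z
    simp
  rw [h1, taylorPS_prod _ _ fun i _ => by fun_prop, taylorPS_one_sub_mul]
  simpa using NewtonRel.prod (Finset.range (m ρ)) _ _ fun _ _ => NewtonRel.linear ρ⁻¹

/-- An entire function without zeros on a disc is the exponential of a function there. -/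
theorem exists_log_of_ne_zero {h : ℂ → ℂ} {R : ℝ} (hR : 0 < R)
    (hd : DifferentiableOn ℂ h (Metric.ball 0 R)) (hne : ∀ z ∈ Metric.ball (0 : ℂ) R, h z ≠ 0) :
    ∃ F : ℂ → ℂ, DifferentiableOn ℂ F (Metric.ball 0 R) ∧ F 0 = 0 ∧
      (∀ z ∈ Metric.ball (0 : ℂ) R, deriv h z = h z * deriv F z) ∧
      ∀ z ∈ Metric.ball (0 : ℂ) R, h z = h 0 * Complex.exp (F z) := by
  have h0 : (0 : ℂ) ∈ Metric.ball (0 : ℂ) R := by simpa using hR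
  obtain ⟨F, hF0, hF⟩ := ((hd.deriv Metric.isOpen_ball).div hd
    hne).isExactOn_ball.with_val_at 0 0
  have hF' : ∀ z ∈ Metric.ball (0 : ℂ) R, HasDerivAt F (deriv h z / h z) z := fun z hz => hF z hz
  have hh' : ∀ z ∈ Metric.ball (0 : ℂ) R, HasDerivAt h (deriv h z) z := fun z hz =>
    (hd.differentiableAt (Metric.isOpen_ball.mem_nhds hz)).hasDerivAt
  refine ⟨F, fun z hz => (hF' z hz).differentiableAt.differentiableWithinAt, hF0,
    fun z hz => ?_, fun z hz => ?_⟩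
  · rw [(hF' z hz).deriv, mul_div_cancel₀ _ (hne z hz)]
  -- The derivative of `h · exp(-F)` vanishes on the disc, so this function keeps its value `h 0`.
  · have hk : ∀ y ∈ Metric.ball (0 : ℂ) R, HasDerivAt (fun y => h y * Complex.exp (-F y)) 0 y := by
      intro y hy
      refine ((hh' y hy).fun_mul ((hF' y hy).fun_neg.cexp)).congr_deriv ?_
      have := hne y hy
      field_simp
      simp
    have := (convex_ball (0 : ℂ) R).is_const_of_fderivWithin_eq_zero (𝕜 := ℂ)
      (f := fun y => h y * Complex.exp (-F y))
      (fun y hy => (hk y hy).differentiableAt.differentiableWithinAt) (fun y hy => by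
        rw [fderivWithin_of_isOpen Metric.isOpen_ball hy]
        have := (hk y hy).hasFDerivAt.fderiv
        rw [this]
        ext
        simp) hz h0
    simp only [hF0, neg_zero, Complex.exp_zero, mul_one] at this
    rw [← this, mul_assoc, ← Complex.exp_add]
    simp

/-- Write `g = P h`, with `P` carrying the zeros in `|z| ≤ R` and `h = g(0) exp F` on the open disc.
The Newton sums of `g` are those of `P` minus `k Fₖ`, so it suffices to bound the Taylor
coefficients of `F`; a bound for `Re F` comes from the growth of `g` on `|z| = 2R`. -/
theorem norm_powerSum_zeros_sub_le {g : ℂ → ℂ} (hg : Differentiable ℂ g) (h0 : g 0 ≠ 0)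
    {s : ℕ → ℂ} (hs : NewtonRel (fun k => PowerSeries.coeff k (taylorPS g)) s)
    {R B : ℝ} (hR : 0 < R) (hB : 0 < B)
    (hgB : ∀ z : ℂ, ‖z‖ = 2 * R → ‖g z‖ ≤ ‖g 0‖ * Real.exp B) {S : Finset ℂ}
    (hS : ∀ z, z ∈ S ↔ g z = 0 ∧ ‖z‖ ≤ R) (k : ℕ) :
    ‖∑ ρ ∈ S, analyticOrderNatAt g ρ * ρ⁻¹ ^ (k + 1) - s (k + 1)‖ ≤
      (k + 1) * (2 * B / (R / 2) ^ (k + 1)) := by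
  have hS0 : ∀ ρ ∈ S, ρ ≠ 0 := by
    rintro ρ hρ rfl
    exact h0 ((hS 0).mp hρ).1
  obtain ⟨h, hd, hne, hgh⟩ := exists_entire_div_prod hg h0 S hS0
  have hh0 : h 0 = g 0 := by rw [hgh 0]; simp
  set P : ℂ → ℂ := ∏ ρ ∈ S, fun z => (1 - ρ⁻¹ * z) ^ analyticOrderNatAt g ρ with hP
  have hPz : ∀ z, P z = ∏ ρ ∈ S, (1 - ρ⁻¹ * z) ^ analyticOrderNatAt g ρ := fun z => by
    simp [hP]
  have hPd : Differentiable ℂ P := fun z => DifferentiableAt.finsetProd fun i _ => by fun_prop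
  have hgP : g = P * h := by
    ext z
    rw [Pi.mul_apply, hPz, hgh z]
  have hne' : ∀ z ∈ Metric.ball (0 : ℂ) R, h z ≠ 0 := by
    intro z hz h1
    have hz' : z ∈ S := (hS z).mpr ⟨by rw [hgh, h1, mul_zero], (by simpa using hz : ‖z‖ < R).le⟩
    exact hne z hz' h1
  -- On `|w| = 2R` each factor has `|1 - w/ρ| ≥ 2 - 1`, so `|h| ≤ |g|` there; the maximum principle
  -- carries the bound inwards.
  have hbd : ∀ z ∈ Metric.ball (0 : ℂ) R, ‖h z‖ ≤ ‖g 0‖ * Real.exp B := by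
    intro z hz
    refine Complex.norm_le_of_forall_mem_frontier_norm_le (U := Metric.ball (0 : ℂ) (2 * R))
      Metric.isBounded_ball hd.diffContOnCl (fun w hw => ?_)
      (subset_closure (Metric.ball_subset_ball (by linarith) hz))
    rw [frontier_ball _ (by positivity)] at hw
    have hw' : ‖w‖ = 2 * R := by simpa using hw
    refine le_trans ?_ (hgB w hw')
    rw [hgP, Pi.mul_apply, norm_mul]
    refine le_mul_of_one_le_left (norm_nonneg _) ?_
    rw [hPz, norm_prod]
    refine Finset.one_le_prod fun ρ hρ => ?_
    rw [norm_pow]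
    refine one_le_pow₀ ?_
    have h1 : ‖ρ⁻¹ * w‖ = 2 * R / ‖ρ‖ := by rw [norm_mul, norm_inv, hw']; ring
    have h2 : 2 ≤ 2 * R / ‖ρ‖ := by
      rw [le_div_iff₀ (norm_pos_iff.mpr (hS0 ρ hρ))]
      have := ((hS ρ).mp hρ).2
      linarith
    have h3 := norm_sub_norm_le (ρ⁻¹ * w) 1
    rw [norm_sub_rev, norm_one, h1] at h3
    linarith
  obtain ⟨F, hFd, hF0, hF', hFe⟩ := exists_log_of_ne_zero hR hd.differentiableOn hne'
  have hball0 : Metric.ball (0 : ℂ) R ∈ 𝓝 (0 : ℂ) := Metric.ball_mem_nhds _ hR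
  have hFa : AnalyticAt ℂ F 0 := hFd.analyticAt hball0
  have hN := (newtonRel_prod_pow S (analyticOrderNatAt g)).mul
    (newtonRel_taylorPS_of_deriv (hd.analyticAt 0) hFa (eventually_of_mem hball0 hF'))
  rw [← hP, ← taylorPS_mul (hPd.analyticAt 0) (hd.analyticAt 0), ← hgP] at hN
  have hsk := hN.unique hs (by simpa [coeff_taylorPS] using h0) k
  -- The difference is exactly `(k + 1)` times the Taylor coefficient of `F` of index `k + 1`.
  rw [← hsk, sub_add_cancel_left, neg_neg, norm_mul, coeff_taylorPS, norm_div]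
  have hre : Set.MapsTo F (Metric.ball 0 R) {z | z.re ≤ B} := by
    intro z hz
    have h1 := hbd z hz
    rw [hFe z hz, hh0, norm_mul, Complex.norm_exp] at h1
    exact Real.exp_le_exp.mp (le_of_mul_le_mul_left h1 (norm_pos_iff.mpr h0))
  have hFb : ∀ z ∈ Metric.sphere (0 : ℂ) (R / 2), ‖F z‖ ≤ 2 * B := by
    intro z hz
    have hz' : ‖z‖ = R / 2 := by simpa using hz
    -- At radius `r = R/2` the Borel-Carathéodory bound `2Br / (R - r)` equals `2B`.
    have := Complex.borelCaratheodory_zero hB hFd hre hR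
      (by rw [mem_ball_zero_iff, hz']; linarith) hF0 (z := z)
    rw [hz'] at this
    refine this.trans (le_of_eq ?_)
    field_simp
    ring
  have hcl : DiffContOnCl ℂ F (Metric.ball 0 (R / 2)) := by
    refine DifferentiableOn.diffContOnCl (hFd.mono ?_)
    rw [closure_ball _ (by positivity)]
    exact Metric.closedBall_subset_ball (by linarith)
  have hC := Complex.norm_iteratedDeriv_le_of_forall_mem_sphere_norm_le (k + 1)
    (by positivity : 0 < R / 2) hcl hFb
  have hfac : (0 : ℝ) < (k + 1).factorial := by exact_mod_cast (k + 1).factorial_pos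
  have h5 : ‖((k + 1 : ℕ) : ℂ)‖ = k + 1 := by
    rw [Complex.norm_natCast]; push_cast; ring
  have h6 : ‖((k + 1).factorial : ℂ)‖ = (k + 1).factorial := Complex.norm_natCast _
  rw [h5, h6]
  refine mul_le_mul_of_nonneg_left ?_ (by positivity)
  rw [div_le_iff₀ hfac]
  refine hC.trans (le_of_eq ?_)
  ring

/-- The power sums over the zeros in growing discs converge to the Newton sums of the Taylor
coefficients, for entire functions of growth less than order `d` and exponents `k ≥ d`. -/
theorem tendsto_sum_zeros {g : ℂ → ℂ} (hg : Differentiable ℂ g) (h0 : g 0 ≠ 0)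
    {s : ℕ → ℂ} (hs : NewtonRel (fun k => PowerSeries.coeff k (taylorPS g)) s) {d k : ℕ}
    (hk : 1 ≤ k) (hdk : d ≤ k)
    (hgrow : ∀ ε : ℝ, 0 < ε → ∃ C : ℝ, ∀ z, ‖g z‖ ≤ C * Real.exp (ε * ‖z‖ ^ d)) :
    Tendsto (fun R : ℕ => ∑ ρ ∈ (finite_zeros hg h0 R).toFinset,
      analyticOrderNatAt g ρ * ρ⁻¹ ^ k) atTop (𝓝 (s k)) := by
  obtain ⟨k, rfl⟩ := Nat.exists_eq_add_of_le' hk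
  rw [Metric.tendsto_atTop]
  intro δ hδ
  -- For large `R` one has `B < 2 · 2^(k+1) ε R^(k+1)`, so the error `(k+1) · 2B / (R/2)^(k+1)` is
  -- below `2Aε`; hence `ε = δ / (2A)`.
  set A : ℝ := (k + 1) * 2 * 4 ^ (k + 1) with hA
  have hApos : 0 < A := by positivity
  set ε : ℝ := δ / (2 * A) with hε
  have hεpos : 0 < ε := by positivity
  obtain ⟨C, hC⟩ := hgrow ε hεpos
  have hg0 : 0 < ‖g 0‖ := norm_pos_iff.mpr h0
  -- Enlarging `C` to at least `‖g 0‖` makes the logarithm `L` nonnegative, and `‖g 0‖ exp L` is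
  -- then `C'`.
  set C' : ℝ := max C ‖g 0‖ with hC'
  have hC'pos : 0 < C' := lt_of_lt_of_le hg0 (le_max_right _ _)
  set L : ℝ := Real.log (C' / ‖g 0‖) with hL
  have hL0 : 0 ≤ L := Real.log_nonneg (by rw [one_le_div hg0]; exact le_max_right _ _)
  have hlim : Tendsto (fun R : ℕ => (L + 1) / (R : ℝ) ^ (k + 1)) atTop (𝓝 0) :=
    tendsto_const_nhds.div_atTop
      ((tendsto_pow_atTop (Nat.succ_ne_zero k)).comp tendsto_natCast_atTop_atTop)
  have hlim2 := hlim.eventually_lt_const (show 0 < δ / (2 * A) by positivity)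
  obtain ⟨N, hN⟩ := eventually_atTop.mp hlim2
  refine ⟨max N 1, fun R hR => ?_⟩
  have hR1 : (1 : ℝ) ≤ R := by exact_mod_cast (le_max_right N 1).trans hR
  have hRN := hN R ((le_max_left N 1).trans hR)
  have hR0 : (0 : ℝ) < R := by linarith
  set B : ℝ := L + 1 + ε * (2 * R) ^ d with hB
  have hB0 : 0 < B := by positivity
  rw [dist_eq_norm]
  have key := norm_powerSum_zeros_sub_le hg h0 hs hR0 hB0 (fun z hz => ?_)
    (S := (finite_zeros hg h0 R).toFinset) (fun z => by simp) k
  · refine key.trans_lt ?_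
    have h1 : (2 * (R : ℝ)) ^ d ≤ 2 ^ (k + 1) * (R : ℝ) ^ (k + 1) := by
      rw [← mul_pow]
      exact pow_le_pow_right₀ (by linarith) hdk
    have hRp : (0 : ℝ) < (R : ℝ) ^ (k + 1) := by positivity
    have h2 : L + 1 < ε * (R : ℝ) ^ (k + 1) := by
      rwa [div_lt_iff₀ hRp] at hRN
    have h3 : B < 2 * 2 ^ (k + 1) * (ε * (R : ℝ) ^ (k + 1)) := by
      have h4 : ε * (2 * (R : ℝ)) ^ d ≤ ε * (2 ^ (k + 1) * (R : ℝ) ^ (k + 1)) :=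
        mul_le_mul_of_nonneg_left h1 hεpos.le
      have h5 : (1 : ℝ) ≤ 2 ^ (k + 1) := one_le_pow₀ (by norm_num)
      have h6 : 0 < ε * (R : ℝ) ^ (k + 1) := by positivity
      nlinarith
    have h7 : (k + 1) * (2 * B / ((R : ℝ) / 2) ^ (k + 1)) =
        (k + 1) * 2 * 2 ^ (k + 1) / (R : ℝ) ^ (k + 1) * B := by
      rw [div_pow]
      field_simp
    rw [h7]
    calc (k + 1) * 2 * 2 ^ (k + 1) / (R : ℝ) ^ (k + 1) * B
        < (k + 1) * 2 * 2 ^ (k + 1) / (R : ℝ) ^ (k + 1) *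
          (2 * 2 ^ (k + 1) * (ε * (R : ℝ) ^ (k + 1))) :=
        mul_lt_mul_of_pos_left h3 (by positivity)
      _ = 2 * A * ε := by
        have : (4 : ℝ) ^ (k + 1) = 2 ^ (k + 1) * 2 ^ (k + 1) := by rw [← mul_pow]; norm_num
        rw [hA, this]
        field_simp
      _ = δ := by rw [hε]; field_simp
  · refine (hC z).trans ?_
    rw [hz, hB, Real.exp_add, ← mul_assoc]
    refine mul_le_mul_of_nonneg_right ?_ (Real.exp_nonneg _)
    refine (le_max_left C ‖g 0‖).trans ?_
    rw [Real.exp_add, hL, Real.exp_log (by positivity), ← mul_assoc, mul_div_cancel₀ _ hg0.ne']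
    exact le_mul_of_one_le_right hC'pos.le (Real.one_le_exp zero_le_one)

/-- Sums over an exhausting sequence of finite sets are bounded because they converge. Off the
finite set `E` the norm is controlled by the real part, so the sums of norms are bounded too. -/
theorem summable_of_tendsto_of_norm_le_re {ι : Type*} {f : ι → ℂ} {T : ℕ → Finset ι}
    (hT : Tendsto T atTop atTop) {a : ℂ} (ha : Tendsto (fun R => ∑ i ∈ T R, f i) atTop (𝓝 a))
    {E : Finset ι} (hE : ∀ i ∉ E, ‖f i‖ ≤ 2 * (f i).re) : Summable f := by
  classical
  obtain ⟨B, hB⟩ := ha.norm.bddAbove_range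
  have hB' : ∀ R, ‖∑ i ∈ T R, f i‖ ≤ B := fun R => hB ⟨R, rfl⟩
  refine Summable.of_norm (summable_of_sum_le (c := ∑ i ∈ E, ‖f i‖ + 2 * (B + ∑ i ∈ E, ‖f i‖))
    (fun i => norm_nonneg _) fun A => ?_)
  obtain ⟨R, hR⟩ := (tendsto_atTop.mp hT (A ∪ E)).exists
  have hAR : A ∪ E ⊆ T R := hR
  calc ∑ i ∈ A, ‖f i‖ ≤ ∑ i ∈ T R, ‖f i‖ :=
        Finset.sum_le_sum_of_subset_of_nonneg (Finset.union_subset_left hAR)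
          fun _ _ _ => norm_nonneg _
    _ = ∑ i ∈ T R \ E, ‖f i‖ + ∑ i ∈ E, ‖f i‖ :=
        (Finset.sum_sdiff (Finset.union_subset_right hAR)).symm
    _ ≤ ∑ i ∈ T R \ E, 2 * (f i).re + ∑ i ∈ E, ‖f i‖ := by
        gcongr with i hi
        exact hE i (Finset.mem_sdiff.mp hi).2
    _ ≤ ∑ i ∈ E, ‖f i‖ + 2 * (B + ∑ i ∈ E, ‖f i‖) := by
        have h1 : ∑ i ∈ T R \ E, (f i).re + ∑ i ∈ E, (f i).re = ∑ i ∈ T R, (f i).re :=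
          Finset.sum_sdiff (Finset.union_subset_right hAR)
        have h2 : ∑ i ∈ T R, (f i).re ≤ B := by
          rw [← Complex.re_sum]
          exact (Complex.re_le_norm _).trans (hB' R)
        have h3 : -∑ i ∈ E, (f i).re ≤ ∑ i ∈ E, ‖f i‖ := by
          rw [← Finset.sum_neg_distrib]
          exact Finset.sum_le_sum fun i _ =>
            (neg_le_abs _).trans (Complex.abs_re_le_norm _)
        rw [← Finset.mul_sum]
        linarith

/-- Power sums over all zeros, indexed by a type `ι` enumerating the zeros. -/
theorem hasSum_zeros {g : ℂ → ℂ} (hg : Differentiable ℂ g) (h0 : g 0 ≠ 0)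
    {s : ℕ → ℂ} (hs : NewtonRel (fun k => PowerSeries.coeff k (taylorPS g)) s) {d k : ℕ}
    (hk : 1 ≤ k) (hdk : d ≤ k)
    (hgrow : ∀ ε : ℝ, 0 < ε → ∃ C : ℝ, ∀ z, ‖g z‖ ≤ C * Real.exp (ε * ‖z‖ ^ d))
    {ι : Type*} {e : ι → ℂ} (he : Function.Injective e) (hr : ∀ z, g z = 0 ↔ ∃ i, e i = z)
    {R₀ : ℝ} (hre : ∀ i, R₀ < ‖e i‖ → ‖(e i)⁻¹ ^ k‖ ≤ 2 * ((e i)⁻¹ ^ k).re) :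
    HasSum (fun i => (analyticOrderNatAt g (e i) : ℂ) * (e i)⁻¹ ^ k) (s k) := by
  classical
  set T : ℕ → Finset ι := fun R => (finite_zeros hg h0 R).toFinset.preimage e he.injOn with hT
  have hTt : Tendsto T atTop atTop := by
    refine tendsto_atTop_finset_of_monotone (fun R R' hRR i => ?_) fun i => ?_
    · simp only [hT, Finset.mem_preimage, Set.Finite.mem_toFinset, Set.mem_ofPred_eq]
      exact fun h => ⟨h.1, h.2.trans (by exact_mod_cast hRR)⟩
    · obtain ⟨R, hR⟩ := exists_nat_ge ‖e i‖
      exact ⟨R, by simpa [hT] using ⟨(hr _).mpr ⟨i, rfl⟩, hR⟩⟩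
  have hlim : Tendsto (fun R => ∑ i ∈ T R, (analyticOrderNatAt g (e i) : ℂ) * (e i)⁻¹ ^ k) atTop
      (𝓝 (s k)) := by
    refine (tendsto_sum_zeros hg h0 hs hk hdk hgrow).congr fun R => ?_
    rw [hT, Finset.sum_preimage e _ he.injOn
      (fun ρ => (analyticOrderNatAt g ρ : ℂ) * ρ⁻¹ ^ k)]
    intro x hx hx'
    exact absurd ((hr x).mp (by simpa using (Set.Finite.mem_toFinset _ |>.mp hx).1)) hx'
  -- Convergence over growing discs depends on the ordering; the sector condition `hre` upgrades it
  -- to absolute convergence. Multiplicities are nonnegative and preserve the sector.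
  have hsum : Summable fun i => (analyticOrderNatAt g (e i) : ℂ) * (e i)⁻¹ ^ k := by
    refine summable_of_tendsto_of_norm_le_re hTt hlim
      (E := (finite_zeros hg h0 R₀).toFinset.preimage e he.injOn) fun i hi => ?_
    have hi' : R₀ < ‖e i‖ := by
      by_contra hcon
      exact hi (by simpa using ⟨(hr _).mpr ⟨i, rfl⟩, not_lt.mp hcon⟩)
    rw [norm_mul, Complex.norm_natCast, ← Complex.ofReal_natCast, Complex.re_ofReal_mul]
    have := mul_le_mul_of_nonneg_left (hre i hi') (Nat.cast_nonneg (analyticOrderNatAt g (e i)))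
    linarith
  have := tendsto_nhds_unique (hsum.hasSum.comp hTt) hlim
  rw [← this]
  exact hsum.hasSum

/-! ### Positivity propagated backwards along a recurrence. -/

theorem forall_of_eventually_of_step {P : ℕ → Prop} (h : ∀ᶠ n in atTop, P n)
    (hstep : ∀ n, P (n + 1) → P (n + 2) → P n) (n : ℕ) : P n := by
  obtain ⟨N, hN⟩ := eventually_atTop.mp h
  have key : ∀ m n, N ≤ n + m → P n ∧ P (n + 1) := by
    intro m
    induction m with
    | zero => exact fun n hn => ⟨hN n (by omega), hN _ (by omega)⟩
    | succ m ih =>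
      intro n hn
      have h1 := ih (n + 1) (by omega)
      exact ⟨hstep n h1.1 h1.2, h1.1⟩
  exact (key N n (by omega)).1

/-- Boundedness of `v` with `κ → 0` and `p → 1` makes `v` positive far out; the recurrence with `p ≥
0` and `κ > 0` then carries positivity down to every index. -/
theorem pos_of_backward_recurrence {v p κ : ℕ → ℝ} (hv : ∀ n, v n = p n + κ n * v (n + 2))
    (hp : ∀ n, 0 ≤ p n) (hp1 : Tendsto p atTop (𝓝 1)) (hκ : ∀ n, 0 < κ n)
    (hκ0 : Tendsto κ atTop (𝓝 0)) {B : ℝ} (hB : ∀ n, |v n| ≤ B) (n : ℕ) : 0 < v n := by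
  refine forall_of_eventually_of_step (P := fun n => 0 < v n) ?_ (fun n _ h2 => ?_) n
  · have h1 : Tendsto (fun n => p n - κ n * B) atTop (𝓝 1) := by
      simpa using hp1.sub (hκ0.mul_const B)
    filter_upwards [h1.eventually_const_lt one_pos] with n hn
    rw [hv n]
    have := mul_le_mul_of_nonneg_left (neg_le_of_abs_le (hB (n + 2))) (hκ n).le
    linarith
  · rw [hv n]
    have := mul_pos (hκ n) h2
    linarith [hp n]

/-! ### Zeros of entire functions with a positive three-term recurrence -/

/-- Arrays of Taylor coefficients of entire functions `Uₙ(z) = ∑ᵢ a n i * zⁱ` with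
`Uₙ(z) = Uₙ₊₁(z) - cₙ z Uₙ₊₂(z)` and `Uₙ → 1`, dominated by a rapidly decreasing sequence `M`. -/
structure RecurrenceArray (a : ℕ → ℕ → ℝ) (c M : ℕ → ℝ) : Prop where
  zero : ∀ n, a n 0 = 1
  recurrence : ∀ n i, a n (i + 1) = a (n + 1) (i + 1) - c n * a (n + 2) i
  pos : ∀ n, 0 < c n
  tendsto_zero : Tendsto c atTop (𝓝 0)
  le_bound : ∀ n i, |a n i| ≤ M i
  bound : ∀ ε : ℝ, 0 < ε → ∃ C, ∀ i : ℕ, M i * i.factorial ≤ C * ε ^ i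
  coeff_tendsto : ∀ i, Tendsto (fun n => a n (i + 1)) atTop (𝓝 0)

namespace RecurrenceArray

variable {a : ℕ → ℕ → ℝ} {c M : ℕ → ℝ} (h : RecurrenceArray a c M)
include h

theorem bound_nonneg (i : ℕ) : 0 ≤ M i := (abs_nonneg _).trans (h.le_bound 0 i)

theorem exists_bound_le {ε : ℝ} (hε : 0 < ε) :
    ∃ C, 0 ≤ C ∧ ∀ (r : ℝ) (i : ℕ), 0 ≤ r → M i * r ^ i ≤ C * ((ε * r) ^ i / i.factorial) := by
  obtain ⟨C, hC⟩ := h.bound ε hε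
  refine ⟨C, ?_, fun r i hr => ?_⟩
  · have := hC 0
    simp only [Nat.factorial_zero, Nat.cast_one, mul_one, pow_zero] at this
    exact (h.bound_nonneg 0).trans this
  · have hf : (0 : ℝ) < i.factorial := by exact_mod_cast i.factorial_pos
    rw [← mul_div_assoc, le_div_iff₀ hf, mul_pow]
    nlinarith [mul_le_mul_of_nonneg_right (hC i) (pow_nonneg hr i)]

theorem summable_bound {r : ℝ} (hr : 0 ≤ r) : Summable fun i => M i * r ^ i := by
  obtain ⟨C, _, hC⟩ := h.exists_bound_le one_pos
  exact Summable.of_nonneg_of_le (fun i => mul_nonneg (h.bound_nonneg i) (pow_nonneg hr i))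
    (fun i => hC r i hr) ((Real.summable_pow_div_factorial (1 * r)).mul_left C)

theorem norm_term_le (n i : ℕ) (z : ℂ) : ‖(a n i : ℂ) * z ^ i‖ ≤ M i * ‖z‖ ^ i := by
  rw [norm_mul, norm_pow, Complex.norm_real]
  exact mul_le_mul_of_nonneg_right (h.le_bound n i) (by positivity)

theorem summable (n : ℕ) (z : ℂ) : Summable fun i => (a n i : ℂ) * z ^ i :=
  Summable.of_norm_bounded (h.summable_bound (norm_nonneg z)) fun i => h.norm_term_le n i z

omit h in
/-- The `n`-th entire function of the array. -/
noncomputable def fn (a : ℕ → ℕ → ℝ) (n : ℕ) (z : ℂ) : ℂ := ∑' i, (a n i : ℂ) * z ^ i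

theorem hasSum_fn (n : ℕ) (z : ℂ) : HasSum (fun i => (a n i : ℂ) * z ^ i) (fn a n z) :=
  (h.summable n z).hasSum

theorem differentiable_fn (n : ℕ) : Differentiable ℂ (fn a n) :=
  differentiable_of_hasSum (h.hasSum_fn n)

theorem norm_fn_le (n : ℕ) (z : ℂ) : ‖fn a n z‖ ≤ ∑' i, M i * ‖z‖ ^ i :=
  tsum_of_norm_bounded (h.summable_bound (norm_nonneg z)).hasSum fun i => h.norm_term_le n i z

/-- Since `M i · i! = O(εⁱ)`, the dominating series is bounded by that of `exp(ε|z|)`. This is the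
growth hypothesis with `d = 1`, so every exponent `k ≥ 1` is allowed. -/
theorem norm_fn_le_exp {ε : ℝ} (hε : 0 < ε) :
    ∃ C, ∀ z, ‖fn a 0 z‖ ≤ C * Real.exp (ε * ‖z‖ ^ 1) := by
  obtain ⟨C, _, hC⟩ := h.exists_bound_le hε
  refine ⟨C, fun z => (h.norm_fn_le 0 z).trans ?_⟩
  rw [pow_one, Real.exp_eq_exp_ℝ, NormedSpace.exp_eq_tsum_div, ← tsum_mul_left]
  exact (h.summable_bound (norm_nonneg z)).tsum_le_tsum (fun i => hC _ i (norm_nonneg z))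
    ((Real.summable_pow_div_factorial _).mul_left C)

theorem fn_zero (n : ℕ) : fn a n 0 = 1 := by
  rw [fn, tsum_eq_single 0 fun i hi => by simp [hi]]
  simp [h.zero]

theorem fn_recurrence (n : ℕ) (z : ℂ) :
    fn a n z = fn a (n + 1) z - c n * z * fn a (n + 2) z := by
  have h1 := (hasSum_nat_add_iff' 1).mpr (h.hasSum_fn (n + 1) z)
  have h2 := (h.hasSum_fn (n + 2) z).mul_left (c n * z)
  have h3 := h1.sub h2
  have h4 := (hasSum_nat_add_iff' 1).mpr (h.hasSum_fn n z)
  have h5 : (fun i => (a (n + 1) (i + 1) : ℂ) * z ^ (i + 1) -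
      c n * z * ((a (n + 2) i : ℂ) * z ^ i)) = fun i => (a n (i + 1) : ℂ) * z ^ (i + 1) := by
    ext i
    rw [h.recurrence n i]
    push_cast
    ring
  rw [h5] at h3
  have := h3.unique h4
  simp only [Finset.range_one, Finset.sum_singleton, h.zero, pow_zero, mul_one,
    Complex.ofReal_one] at this
  linear_combination -this

theorem tendsto_fn (z : ℂ) : Tendsto (fun n => fn a n z) atTop (𝓝 1) := by
  have : Tendsto (fun n => fn a n z) atTop (𝓝 (∑' i, if i = 0 then (1 : ℂ) else 0)) := by
    refine tendsto_tsum_of_dominated_convergence (h.summable_bound (norm_nonneg z))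
      (fun i => ?_) (Eventually.of_forall fun n i => h.norm_term_le n i z)
    rcases i with _ | i
    · simp [h.zero]
    · have := ((Complex.continuous_ofReal.tendsto 0).comp (h.coeff_tendsto i)).mul_const
        (z ^ (i + 1))
      simpa using this
  simpa using this

/-- Cauchy's estimate on a unit circle, with the majorant `M` giving a bound independent of `n`. -/
theorem deriv_fn_bounded (z : ℂ) : ∃ B, ∀ n, ‖deriv (fn a n) z‖ ≤ B := by
  refine ⟨∑' i, M i * (‖z‖ + 1) ^ i, fun n => ?_⟩
  have := Complex.norm_deriv_le_of_forall_mem_sphere_norm_le (c := z) (R := 1)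
    (C := ∑' i, M i * (‖z‖ + 1) ^ i) one_pos (h.differentiable_fn n).diffContOnCl fun w hw => ?_
  · simpa using this
  · refine (h.norm_fn_le n w).trans ?_
    have hw1 : ‖w‖ ≤ ‖z‖ + 1 := by
      have h1 : ‖w - z‖ = 1 := by simpa [dist_eq_norm] using hw
      linarith [norm_sub_norm_le w z]
    exact (h.summable_bound (norm_nonneg w)).tsum_le_tsum (fun i =>
      mul_le_mul_of_nonneg_left (pow_le_pow_left₀ (norm_nonneg _) hw1 i) (h.bound_nonneg i))
      (h.summable_bound (by positivity))

theorem tendsto_kappa (y : ℝ) : Tendsto (fun n => c n * c (n + 1) * y) atTop (𝓝 0) := by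
  simpa using (h.tendsto_zero.mul (h.tendsto_zero.comp (tendsto_add_atTop_nat 1))).mul_const y

/-- The quantities `v` and `w` satisfy `wₙ = cₙ vₙ₊₁` and `vₙ = |Uₙ₊₁|² + cₙ |z|² wₙ₊₁`. Eliminating
`w` gives a backward recurrence forcing `v > 0`, hence `w 0 > 0`, whereas `U 0 = 0` would give `w 0
= 0`. -/
theorem fn_ne_zero_of_im_ne_zero {z : ℂ} (hz : z.im ≠ 0) : fn a 0 z ≠ 0 := by
  set U := fun n => fn a n z with hU
  have hrec : ∀ n, U n = U (n + 1) - c n * z * U (n + 2) := fun n => h.fn_recurrence n z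
  set v : ℕ → ℝ := fun n => (z * U (n + 1) * starRingEnd ℂ (U n)).im / z.im with hv
  set w : ℕ → ℝ := fun n => (U (n + 1) * starRingEnd ℂ (U n)).im / z.im with hw
  have hwv : ∀ n, w n = c n * v (n + 1) := by
    intro n
    simp only [hw, hv]
    rw [hrec n]
    simp only [Complex.mul_im, Complex.mul_re, Complex.conj_re, Complex.conj_im, Complex.sub_re,
      Complex.sub_im, Complex.ofReal_re, Complex.ofReal_im]
    field_simp
    ring
  have hvw : ∀ n, v n = Complex.normSq (U (n + 1)) + c n * Complex.normSq z * w (n + 1) := by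
    intro n
    simp only [hw, hv]
    rw [hrec n]
    simp only [Complex.mul_im, Complex.mul_re, Complex.conj_re, Complex.conj_im, Complex.sub_re,
      Complex.sub_im, Complex.ofReal_re, Complex.ofReal_im, Complex.normSq_apply]
    field_simp
    ring
  have hUt : Tendsto U atTop (𝓝 1) := h.tendsto_fn z
  have hzn : 0 < Complex.normSq z := Complex.normSq_pos.mpr fun h0 => hz (by simp [h0])
  obtain ⟨B, hB⟩ : ∃ B, ∀ n, |v n| ≤ B := by
    have h1 : Tendsto v atTop (𝓝 ((z * 1 * starRingEnd ℂ 1).im / z.im)) :=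
      ((Complex.continuous_im.tendsto _).comp (((hUt.comp (tendsto_add_atTop_nat 1)).const_mul
        z).mul ((Complex.continuous_conj.tendsto _).comp hUt))).div_const _
    obtain ⟨B, hB⟩ := h1.abs.bddAbove_range
    exact ⟨B, fun n => hB ⟨n, rfl⟩⟩
  have hpos := pos_of_backward_recurrence (v := v) (p := fun n => Complex.normSq (U (n + 1)))
    (κ := fun n => c n * c (n + 1) * Complex.normSq z)
    (fun n => by rw [hvw n, hwv (n + 1)]; ring) (fun n => Complex.normSq_nonneg _)
    (by
      simpa using! (Complex.continuous_normSq.tendsto 1).comp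
        (hUt.comp (tendsto_add_atTop_nat 1)))
    (fun n => mul_pos (mul_pos (h.pos n) (h.pos _)) hzn) (h.tendsto_kappa _) hB
  intro h0
  have h1 : w 0 = 0 := by
    have : U 0 = 0 := h0
    simp [hw, this]
  rw [hwv 0] at h1
  exact (mul_pos (h.pos 0) (hpos 1)).ne' h1

theorem fn_ofReal_im (n : ℕ) (x : ℝ) : (fn a n x).im = 0 := by
  have := Complex.hasSum_im (h.hasSum_fn n x)
  have h2 : (fun i => ((a n i : ℂ) * (x : ℂ) ^ i).im) = fun _ => 0 := by
    ext i
    rw [← Complex.ofReal_pow, ← Complex.ofReal_mul, Complex.ofReal_im]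
  rw [h2] at this
  exact this.unique hasSum_zero

/-- For `x ≤ 0` the recurrence has nonnegative coefficients, and `Uₙ(x) → 1` starts the descent. -/
theorem fn_re_pos_of_nonpos {x : ℝ} (hx : x ≤ 0) : 0 < (fn a 0 x).re := by
  refine forall_of_eventually_of_step (P := fun n => 0 < (fn a n x).re) ?_ (fun n h1 h2 => ?_) 0
  · exact (((Complex.continuous_re.tendsto _).comp (h.tendsto_fn x)).eventually_const_lt
      (by simp))
  · rw [h.fn_recurrence n x, ← Complex.ofReal_mul, Complex.sub_re, Complex.re_ofReal_mul]
    have := mul_nonneg (mul_nonneg (h.pos n).le (neg_nonneg.mpr hx)) h2.le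
    linarith

/-- The confluent form of the preceding nonreal argument: the cross product of `U` with its
conjugate is replaced by the Wronskian `W`. A double zero would give `W 0 = 0`, while positivity of
`V` gives `W 0 ≠ 0`. -/
theorem deriv_fn_ne_zero {x : ℝ} (h0 : fn a 0 x = 0) : deriv (fn a 0) x ≠ 0 := by
  intro hd
  have hx : x ≠ 0 := by
    rintro rfl
    rw [Complex.ofReal_zero, h.fn_zero] at h0
    exact one_ne_zero h0
  set U := fun n => fn a n x with hU
  set U' := fun n => deriv (fn a n) x with hU'
  have hrec : ∀ n, U n = U (n + 1) - c n * x * U (n + 2) := fun n => h.fn_recurrence n x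
  have hrec' : ∀ n, U' n = U' (n + 1) - c n * (U (n + 2) + x * U' (n + 2)) := by
    intro n
    have h1 : fn a n = fun z => fn a (n + 1) z - c n * z * fn a (n + 2) z :=
      funext (h.fn_recurrence n)
    have h2 := ((h.differentiable_fn (n + 1) x).hasDerivAt).sub
      (((hasDerivAt_id (x : ℂ)).const_mul (c n : ℂ)).mul
        (h.differentiable_fn (n + 2) x).hasDerivAt)
    have h3 : U' n = _ := (congrArg (fun f => deriv f (x : ℂ)) h1).trans h2.deriv
    rw [h3]
    simp only [hU, hU', id_eq]
    ring
  set W : ℕ → ℂ := fun n => U' (n + 1) * U n - U (n + 1) * U' n with hW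
  -- `V` is the `x`-derivative of `x Uₙ₊₁` times `Uₙ`, minus `x Uₙ₊₁ U'ₙ`; with it the two-step
  -- recurrence closes.
  set V : ℕ → ℂ := fun n => U (n + 1) * U n + x * W n with hV
  have hWV : ∀ n, W n = c n * V (n + 1) := by
    intro n
    simp only [hW, hV]
    rw [hrec n, hrec' n]
    ring
  have hVW : ∀ n, V n = U (n + 1) ^ 2 + c n * x ^ 2 * W (n + 1) := by
    intro n
    simp only [hV]
    simp only [hW]
    rw [hrec n, hrec' n]
    ring
  have hUt : Tendsto U atTop (𝓝 1) := h.tendsto_fn x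
  have hUt1 : Tendsto (fun n => U (n + 1)) atTop (𝓝 1) := hUt.comp (tendsto_add_atTop_nat 1)
  obtain ⟨B, hB⟩ : ∃ B, ∀ n, |(V n).re| ≤ B := by
    obtain ⟨B₁, hB₁⟩ := hUt.norm.bddAbove_range
    have hB₁' : ∀ n, ‖U n‖ ≤ B₁ := fun n => hB₁ ⟨n, rfl⟩
    obtain ⟨B₂, hB₂⟩ := h.deriv_fn_bounded x
    have h10 : 0 ≤ B₁ := (norm_nonneg _).trans (hB₁' 0)
    have h20 : 0 ≤ B₂ := (norm_nonneg _).trans (hB₂ 0)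
    refine ⟨B₁ * B₁ + |x| * (B₂ * B₁ + B₁ * B₂), fun n => (Complex.abs_re_le_norm _).trans ?_⟩
    refine (norm_add_le _ _).trans (add_le_add ?_ ?_)
    · rw [norm_mul]
      exact mul_le_mul (hB₁' _) (hB₁' _) (norm_nonneg _) h10
    · rw [norm_mul, Complex.norm_real, Real.norm_eq_abs]
      refine mul_le_mul_of_nonneg_left ((norm_sub_le _ _).trans (add_le_add ?_ ?_)) (abs_nonneg _)
      · rw [norm_mul]
        exact mul_le_mul (hB₂ _) (hB₁' _) (norm_nonneg _) h20
      · rw [norm_mul]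
        exact mul_le_mul (hB₁' _) (hB₂ _) (norm_nonneg _) h10
  have hpos := pos_of_backward_recurrence (v := fun n => (V n).re)
    (p := fun n => (U (n + 1)).re ^ 2)
    (κ := fun n => c n * c (n + 1) * x ^ 2)
    (fun n => by
      rw [hVW n, hWV (n + 1)]
      have h1 : (c n : ℂ) * x ^ 2 * (c (n + 1) * V (n + 1 + 1)) =
        ((c n * c (n + 1) * x ^ 2 : ℝ) : ℂ) * V (n + 2) := by push_cast; ring
      rw [h1, Complex.add_re, Complex.re_ofReal_mul, sq, Complex.mul_re,
        show (U (n + 1)).im = 0 from h.fn_ofReal_im _ _]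
      ring) (fun n => sq_nonneg _)
    (by simpa using (((Complex.continuous_re.tendsto 1).comp hUt1).pow 2))
    (fun n => mul_pos (mul_pos (h.pos n) (h.pos _)) (by positivity)) (h.tendsto_kappa _) hB
  have h1 : W 0 = 0 := by
    have hU0 : U 0 = 0 := h0
    have hU'0 : U' 0 = 0 := hd
    simp [hW, hU0, hU'0]
  rw [hWV 0] at h1
  have h2 := (mul_eq_zero.mp h1).resolve_left (by exact_mod_cast (h.pos 0).ne')
  have := hpos 1
  simp only [zero_add] at h2
  rw [h2] at this
  simp at this

theorem analyticOrderNatAt_fn {x : ℝ} (h0 : fn a 0 x = 0) :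
    analyticOrderNatAt (fn a 0) x = 1 := by
  have := ((h.differentiable_fn 0).analyticAt x).analyticOrderAt_sub_eq_one_of_deriv_ne_zero
    (h.deriv_fn_ne_zero h0)
  simp only [h0, sub_zero] at this
  rw [analyticOrderNatAt, this]
  rfl

omit h in
theorem fn_ofReal (x : ℝ) : fn a 0 x = ((∑' i, a 0 i * x ^ i : ℝ) : ℂ) := by
  rw [fn, Complex.ofReal_tsum]
  exact tsum_congr fun i => by push_cast; rfl

theorem fn_eq_zero_iff (z : ℂ) :
    fn a 0 z = 0 ↔ ∃ x : ℝ, 0 < x ∧ ∑' i, a 0 i * x ^ i = 0 ∧ z = x := by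
  constructor
  · intro hz
    have him : z.im = 0 := by
      by_contra him
      exact h.fn_ne_zero_of_im_ne_zero him hz
    obtain ⟨x, rfl⟩ : ∃ x : ℝ, z = x := ⟨z.re, Complex.ext rfl (by simpa using him)⟩
    refine ⟨x, ?_, ?_, rfl⟩
    · by_contra hx
      have := h.fn_re_pos_of_nonpos (not_lt.mp hx)
      rw [hz] at this
      simp at this
    · rw [fn_ofReal] at hz
      exact_mod_cast hz
  · rintro ⟨x, _, hx, rfl⟩
    rw [fn_ofReal, hx, Complex.ofReal_zero]

/-- All zeros are positive, so the sector condition is automatic, and they are simple, so the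
multiplicities are `1`. -/
theorem hasSum_zeros {s : ℕ → ℝ} (hs : NewtonRel (a 0) s) {k : ℕ} (hk : 1 ≤ k) {ι : Type*}
    {e : ι → ℝ} (he : Function.Injective e)
    (hr : ∀ x, (0 < x ∧ ∑' i, a 0 i * x ^ i = 0) ↔ ∃ i, e i = x) :
    HasSum (fun i => 1 / e i ^ k) (s k) := by
  have hs' : NewtonRel (fun k => PowerSeries.coeff k (taylorPS (fn a 0)))
      (fun k => (s k : ℂ)) := by
    have h1 := hs.map Complex.ofRealHom
    have h2 : (fun k => PowerSeries.coeff k (taylorPS (fn a 0))) =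
        fun k => Complex.ofRealHom (a 0 k) :=
      funext fun k => coeff_taylorPS_of_hasSum one_pos (fun z _ => h.hasSum_fn 0 z) k
    rw [h2]
    exact h1
  have hz : ∀ i, 0 < e i ∧ ∑' j, a 0 j * e i ^ j = 0 := fun i => (hr _).mpr ⟨i, rfl⟩
  have hpow : ∀ i, ((e i : ℂ))⁻¹ ^ k = ((1 / e i ^ k : ℝ) : ℂ) := fun i => by
    push_cast
    rw [inv_pow, one_div]
  have := _root_.hasSum_zeros (h.differentiable_fn 0) (by rw [h.fn_zero]; exact one_ne_zero) hs' hk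
    hk (fun ε hε => h.norm_fn_le_exp hε) (e := fun i => (e i : ℂ))
    (Complex.ofReal_injective.comp he) (fun z => by
      rw [h.fn_eq_zero_iff]
      constructor
      · rintro ⟨x, hx, hx0, rfl⟩
        obtain ⟨i, rfl⟩ := (hr x).mp ⟨hx, hx0⟩
        exact ⟨i, rfl⟩
      · rintro ⟨i, rfl⟩
        exact ⟨e i, (hz i).1, (hz i).2, rfl⟩) (R₀ := 0) (fun i _ => by
      have h1 : 0 ≤ 1 / e i ^ k := by
        have := (hz i).1
        positivity
      rw [hpow, Complex.norm_real, Complex.ofReal_re, Real.norm_eq_abs, abs_of_nonneg h1]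
      linarith)
  rw [← Complex.hasSum_ofReal]
  refine this.congr_fun fun i => ?_
  rw [h.analyticOrderNatAt_fn (by rw [fn_ofReal, (hz i).2, Complex.ofReal_zero]), hpow]
  simp

end RecurrenceArray

/-! ### Rational Newton sums of real parameters -/

/-- The polynomials are chosen before the point, which gives one rational function for all real
parameters. Rationality is proved over `ℂ` and transported back by uniqueness of Newton sums. -/
theorem IsRationalOn.exists_newtonSum {σ : Type} {D : Set (σ → ℂ)} {c : (σ → ℂ) → ℕ → ℂ}
    (hc : ∀ k, IsRationalOn D fun x => c x k) (h0 : ∀ x ∈ D, c x 0 ≠ 0) (k : ℕ) :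
    ∃ P Q : MvPolynomial σ ℚ, ∀ x : σ → ℝ, (fun i => (x i : ℂ)) ∈ D →
      MvPolynomial.aeval x Q ≠ 0 ∧ ∀ c' s : ℕ → ℝ, (∀ i, c (fun i => (x i : ℂ)) i = c' i) →
        NewtonRel c' s → s (k + 1) = MvPolynomial.aeval x P / MvPolynomial.aeval x Q := by
  classical
  choose! s hs using fun x (hx : x ∈ D) => NewtonRel.exists_of_ne_zero (h0 x hx)
  obtain ⟨P, Q, hPQ⟩ := IsRationalOn.of_newtonRel hc h0 hs k
  have hcast : ∀ (x : σ → ℝ) (R : MvPolynomial σ ℚ),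
      MvPolynomial.aeval (fun i => (x i : ℂ)) R = ((MvPolynomial.aeval x R : ℝ) : ℂ) := by
    intro x R
    have : MvPolynomial.aeval (fun i => (x i : ℂ)) =
        (Complex.ofRealAm.restrictScalars ℚ).comp (MvPolynomial.aeval (R := ℚ) x) := by
      ext i
      simp
    rw [this]
    rfl
  refine ⟨P, Q, fun x hx => ?_⟩
  obtain ⟨h1, h2⟩ := hPQ _ hx
  rw [hcast] at h1
  refine ⟨by exact_mod_cast h1, fun c' t hc' ht => ?_⟩
  have ht' : NewtonRel (c fun i => (x i : ℂ)) (fun k => (t k : ℂ)) := by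
    have := ht.map Complex.ofRealHom
    rw [show (fun k => Complex.ofRealHom (c' k)) = c fun i => (x i : ℂ) from
      funext fun i => (hc' i).symm] at this
    exact this
  have h3 := ht'.unique (hs _ hx) (h0 _ hx) k
  simp only [h2, hcast] at h3
  exact_mod_cast h3

theorem exists_polynomial_aeval_eq (P : MvPolynomial Unit ℚ) :
    ∃ p : Polynomial ℚ, ∀ x : ℝ, Polynomial.aeval x p = MvPolynomial.aeval (fun _ => x) P := by
  refine ⟨MvPolynomial.aeval (fun _ => Polynomial.X) P, fun x => ?_⟩
  have : (Polynomial.aeval x).comp (MvPolynomial.aeval (R := ℚ) fun _ => Polynomial.X) =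
      MvPolynomial.aeval (fun _ : Unit => x) := by
    ext i
    simp
  rw [← this]
  rfl

/-- The ratio test makes `∑ bᵢ / εⁱ` converge for every `ε > 0`, so its terms are bounded. -/
theorem exists_le_mul_pow_of_ratio {b : ℕ → ℝ} (hb : ∀ i, 0 < b i)
    (hr : Tendsto (fun i => b (i + 1) / b i) atTop (𝓝 0)) {ε : ℝ} (hε : 0 < ε) :
    ∃ C, ∀ i, b i ≤ C * ε ^ i := by
  have hs : Summable fun i => b i / ε ^ i := by
    refine summable_of_ratio_test_tendsto_lt_one (l := 0) zero_lt_one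
      (Eventually.of_forall fun i => (div_pos (hb i) (pow_pos hε i)).ne') ?_
    have : (fun i => ‖b (i + 1) / ε ^ (i + 1)‖ / ‖b i / ε ^ i‖) =
        fun i => b (i + 1) / b i * ε⁻¹ := by
      ext i
      have := hb i
      have := hb (i + 1)
      rw [Real.norm_of_nonneg (by positivity), Real.norm_of_nonneg (by positivity)]
      field_simp
      ring
    rw [this]
    simpa using hr.mul_const ε⁻¹
  obtain ⟨C, hC⟩ := hs.tendsto_atTop_zero.bddAbove_range
  exact ⟨C, fun i => (div_le_iff₀ (pow_pos hε i)).mp (hC ⟨i, rfl⟩)⟩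

/-! ### Bessel functions -/

/-- The coefficients of `Γ(ν + 1) (x / 2) ^ (-ν) J_ν(x)` as a power series in `x ^ 2`. -/
noncomputable def besselCoeff {K : Type*} [Field K] (ν : K) (i : ℕ) : K :=
  (-1) ^ i / (4 ^ i * (∏ j ∈ Finset.range i, (ν + 1 + j)) * i.factorial)

theorem prod_bessel_pos {ν : ℝ} (hν : -1 < ν) (i : ℕ) :
    0 < ∏ j ∈ Finset.range i, (ν + 1 + j) :=
  Finset.prod_pos fun j _ => by
    have : (0 : ℝ) ≤ j := Nat.cast_nonneg j
    linarith

/-- Coefficient form of `J_ν + J_{ν+2} = (2(ν+1)/x) J_{ν+1}` after normalization to constant term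
`1`, in the variable `x²`. -/
theorem besselCoeff_recurrence {ν : ℝ} (hν : -1 < ν) (i : ℕ) :
    besselCoeff ν (i + 1) = besselCoeff (ν + 1) (i + 1) -
      1 / (4 * (ν + 1) * (ν + 2)) * besselCoeff (ν + 2) i := by
  have h1 : ∏ j ∈ Finset.range (i + 1), (ν + 1 + j) =
      (∏ j ∈ Finset.range i, (ν + 1 + 1 + j)) * (ν + 1) := by
    rw [Finset.prod_range_succ']
    congr 1
    · exact Finset.prod_congr rfl fun j _ => by push_cast; ring
    · simp
  have h2 : (∏ j ∈ Finset.range i, (ν + 2 + 1 + j)) * (ν + 2) =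
      (∏ j ∈ Finset.range i, (ν + 1 + 1 + j)) * (ν + 1 + 1 + i) := by
    rw [← Finset.prod_range_succ, Finset.prod_range_succ']
    congr 1
    · exact Finset.prod_congr rfl fun j _ => by push_cast; ring
    · simp; ring
  have hX := prod_bessel_pos (ν := ν + 1) (by linarith) i
  have hY := prod_bessel_pos (ν := ν + 2) (by linarith) i
  rw [besselCoeff, besselCoeff, besselCoeff, h1, Finset.prod_range_succ]
  set X := ∏ j ∈ Finset.range i, (ν + 1 + 1 + (j : ℝ))
  set Y := ∏ j ∈ Finset.range i, (ν + 2 + 1 + (j : ℝ))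
  have hi : (0 : ℝ) ≤ i := Nat.cast_nonneg i
  have hY' : Y = X * (ν + 1 + 1 + i) / (ν + 2) := by
    rw [eq_div_iff (by linarith), h2]
  have hf : (i.factorial : ℝ) ≠ 0 := Nat.cast_ne_zero.mpr i.factorial_ne_zero
  have e1 : ν + 1 ≠ 0 := by linarith
  have e2 : ν + 2 ≠ 0 := by linarith
  have e3 : ν + 1 + 1 + i ≠ 0 := by linarith
  have e4 : (i : ℝ) + 1 ≠ 0 := by linarith
  rw [hY', Nat.factorial_succ]
  push_cast
  field_simp
  ring

/-- The chain raises the order `ν` by one at each step. Denominators increase with the order, so the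
coefficients at `ν` dominate all the others. -/
theorem recurrenceArray_bessel {ν : ℝ} (hν : -1 < ν) :
    RecurrenceArray (fun n i => besselCoeff (ν + n) i)
      (fun n => 1 / (4 * (ν + n + 1) * (ν + n + 2))) (fun i => |besselCoeff ν i|) where
  zero n := by simp [besselCoeff]
  recurrence n i := by
    have := besselCoeff_recurrence (ν := ν + n)
      (by have : (0 : ℝ) ≤ n := Nat.cast_nonneg n; linarith) i
    push_cast
    rw [← add_assoc, ← add_assoc]
    exact this
  pos n := by
    have : (0 : ℝ) ≤ n := Nat.cast_nonneg n
    have h1 : 0 < ν + n + 1 := by linarith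
    have h2 : 0 < ν + n + 2 := by linarith
    positivity
  tendsto_zero := by
    have h1 : Tendsto (fun n : ℕ => ν + n + 1) atTop atTop :=
      tendsto_atTop_add_const_right _ _
        (tendsto_atTop_add_const_left _ _ tendsto_natCast_atTop_atTop)
    have h2 : Tendsto (fun n : ℕ => ν + n + 2) atTop atTop :=
      tendsto_atTop_add_const_right _ _
        (tendsto_atTop_add_const_left _ _ tendsto_natCast_atTop_atTop)
    exact tendsto_const_nhds.div_atTop ((h1.const_mul_atTop (by norm_num)).atTop_mul_atTop₀ h2)
  le_bound n i := by
    have hn : (0 : ℝ) ≤ n := Nat.cast_nonneg n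
    have h1 := prod_bessel_pos hν i
    have h2 := prod_bessel_pos (ν := ν + n) (by linarith) i
    rw [besselCoeff, besselCoeff, abs_div, abs_div, abs_of_pos (a := _ * _) (by positivity),
      abs_of_pos (a := 4 ^ i * _ * _) (by positivity)]
    gcongr with j hj
    · intro j _
      have : (0 : ℝ) ≤ j := Nat.cast_nonneg j
      linarith
    · linarith
  bound ε hε := by
    refine exists_le_mul_pow_of_ratio (b := fun i => |besselCoeff ν i| * i.factorial)
      (fun i => ?_) ?_ hε
    · have h1 := prod_bessel_pos hν i
      refine mul_pos (abs_pos.mpr ?_) (by exact_mod_cast i.factorial_pos)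
      exact div_ne_zero (pow_ne_zero _ (by norm_num)) (by positivity)
    · have h0 : (fun i : ℕ => |besselCoeff ν (i + 1)| * (i + 1).factorial /
          (|besselCoeff ν i| * i.factorial)) = fun i : ℕ => 1 / (4 * (ν + 1 + i)) := by
        ext i
        have h1 := prod_bessel_pos hν i
        have h2 := prod_bessel_pos hν (i + 1)
        have hi : 0 < ν + 1 + i := by
          have : (0 : ℝ) ≤ i := Nat.cast_nonneg i
          linarith
        rw [besselCoeff, besselCoeff, abs_div, abs_div, abs_of_pos (a := _ * _) (by positivity),
          abs_of_pos (a := 4 ^ i * _ * _) (by positivity), Finset.prod_range_succ]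
        simp only [abs_pow, abs_neg, abs_one, one_pow]
        have hf : (i.factorial : ℝ) ≠ 0 := Nat.cast_ne_zero.mpr i.factorial_ne_zero
        have hf : ((i + 1).factorial : ℝ) ≠ 0 := Nat.cast_ne_zero.mpr (i + 1).factorial_ne_zero
        field_simp
        ring
      rw [h0]
      exact tendsto_const_nhds.div_atTop ((tendsto_atTop_add_const_left _ _
        tendsto_natCast_atTop_atTop).const_mul_atTop (by norm_num))
  coeff_tendsto i := by
    have h1 : Tendsto (fun n : ℕ => 1 / (ν + 1 + (n : ℝ))) atTop (𝓝 0) :=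
      tendsto_const_nhds.div_atTop (tendsto_atTop_add_const_left _ _ tendsto_natCast_atTop_atTop)
    refine squeeze_zero_norm (fun n => ?_) h1
    have hn : (0 : ℝ) ≤ n := Nat.cast_nonneg n
    have h2 := prod_bessel_pos (ν := ν + n) (by linarith) (i + 1)
    rw [besselCoeff, norm_div, norm_pow, norm_neg, norm_one, one_pow,
      Real.norm_of_nonneg (by positivity)]
    refine one_div_le_one_div_of_le (by linarith) ?_
    rw [Finset.prod_range_succ']
    have h3 : (1 : ℝ) ≤ ∏ j ∈ Finset.range i, (ν + n + 1 + ((j + 1 : ℕ) : ℝ)) := by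
      refine Finset.one_le_prod fun j _ => ?_
      have : (0 : ℝ) ≤ j := Nat.cast_nonneg j
      push_cast
      linarith
    have h4 : (1 : ℝ) ≤ 4 ^ (i + 1) := one_le_pow₀ (by norm_num)
    have h5 : (1 : ℝ) ≤ (i + 1).factorial := by exact_mod_cast (i + 1).factorial_pos
    have h6 : 0 < ν + 1 + n := by linarith
    calc ν + 1 + (n : ℝ) = 1 * (1 * (ν + 1 + n)) * 1 := by ring
      _ ≤ 4 ^ (i + 1) * ((∏ j ∈ Finset.range i, (ν + n + 1 + ((j + 1 : ℕ) : ℝ))) * (ν + 1 + n)) *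
          (i + 1).factorial := by gcongr
      _ = _ := by rw [Nat.cast_zero, add_zero]; ring

theorem besselJ_eq {ν x : ℝ} (hν : -1 < ν) (hx : 0 < x) :
    besselJ ν x = (x / 2) ^ ν / Real.Gamma (ν + 1) * ∑' i, besselCoeff ν i * (x ^ 2) ^ i := by
  rw [besselJ, ← tsum_mul_left]
  refine tsum_congr fun n => ?_
  have hG : Real.Gamma (n + ν + 1) =
      (∏ j ∈ Finset.range n, (ν + 1 + j)) * Real.Gamma (ν + 1) := by
    induction n with
    | zero => simp
    | succ n ih =>
      have : ((n + 1 : ℕ) : ℝ) + ν + 1 = (n + ν + 1) + 1 := by push_cast; ring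
      have hn : (0 : ℝ) ≤ n := Nat.cast_nonneg n
      rw [this, Real.Gamma_add_one (by linarith), ih, Finset.prod_range_succ]
      ring
  have h2 : (x / 2) ^ (ν + 2 * n) = (x / 2) ^ ν * ((x / 2) ^ 2) ^ n := by
    rw [Real.rpow_add (by positivity), ← pow_mul, ← Real.rpow_natCast]
    push_cast
    rfl
  rw [hG, h2, besselCoeff, div_pow x 2 2, div_pow]
  norm_num
  ring

theorem exists_rational_bessel {n : ℕ} (hn : 1 ≤ n) :
    ∃ P Q : Polynomial ℚ, ∀ ν : ℝ, -1 < ν → Polynomial.aeval ν Q ≠ 0 ∧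
      HasSum (fun x : {x : ℝ // 0 < x ∧ besselJ ν x = 0} => 1 / (x : ℝ) ^ (2 * n))
        (Polynomial.aeval ν P / Polynomial.aeval ν Q) := by
  obtain ⟨k, rfl⟩ := Nat.exists_eq_add_of_le' hn
  -- `D` is the set where no coefficient has a vanishing denominator; it contains every real `ν >
  -- -1`.
  set D : Set (Unit → ℂ) := {x | ∀ j : ℕ, x () + 1 + j ≠ 0} with hD
  obtain ⟨P, Q, hPQ⟩ := IsRationalOn.exists_newtonSum (D := D)
    (c := fun x i => besselCoeff (x ()) i) (fun i => by
      refine ((IsRationalOn.const D ((-1) ^ i)).div (((IsRationalOn.const D (4 ^ i)).mul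
        (IsRationalOn.prod (Finset.range i) (F := fun j x => x () + 1 + j) fun j _ =>
          ((IsRationalOn.coord D ()).add (IsRationalOn.const D 1)).add
            (IsRationalOn.natCast D j) |>.congr fun x _ => by simp)).mul
        (IsRationalOn.natCast D i.factorial)) fun x hx => ?_).congr fun x _ => ?_
      · refine mul_ne_zero (mul_ne_zero ?_ (Finset.prod_ne_zero_iff.mpr fun j _ => hx j))
          (Nat.cast_ne_zero.mpr i.factorial_ne_zero)
        push_cast
        exact pow_ne_zero _ (by norm_num)
      · rw [besselCoeff]
        push_cast
        rfl) (fun x _ => by simp [besselCoeff]) k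
  obtain ⟨p, hp⟩ := exists_polynomial_aeval_eq P
  obtain ⟨q, hq⟩ := exists_polynomial_aeval_eq Q
  refine ⟨p, q, fun ν hν => ?_⟩
  obtain ⟨h1, h2⟩ := hPQ (fun _ => ν) (fun j h => by
    have h3 : ((ν + 1 + j : ℝ) : ℂ) = 0 := by push_cast; exact h
    rw [Complex.ofReal_eq_zero] at h3
    have : (0 : ℝ) ≤ j := Nat.cast_nonneg j
    linarith)
  rw [hp, hq]
  refine ⟨h1, ?_⟩
  obtain ⟨s, hs⟩ := NewtonRel.exists_of_ne_zero (c := besselCoeff ν) (by simp [besselCoeff])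
  rw [← h2 (besselCoeff ν) s (fun i => by simp [besselCoeff]) hs]
  -- The zeros are counted in the variable `x²`, whose `n`-th powers are the `2n`-th powers of the
  -- positive zeros.
  have := (recurrenceArray_bessel hν).hasSum_zeros (s := s) (by simpa using hs) hn
    (ι := {x : ℝ // 0 < x ∧ besselJ ν x = 0}) (e := fun x => (x : ℝ) ^ 2)
    (fun x y hxy => Subtype.ext ((pow_left_inj₀ x.2.1.le y.2.1.le two_ne_zero).mp hxy))
    (fun w => by
      have hz : ∀ x : ℝ, 0 < x →
          (besselJ ν x = 0 ↔ ∑' i, besselCoeff ν i * (x ^ 2) ^ i = 0) := by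
        intro x hx
        rw [besselJ_eq hν hx, mul_eq_zero, or_iff_right]
        have := Real.Gamma_pos_of_pos (s := ν + 1) (by linarith)
        positivity
      simp only [Nat.cast_zero, add_zero]
      constructor
      · rintro ⟨hw, h0⟩
        refine ⟨⟨√w, Real.sqrt_pos.mpr hw, ?_⟩, Real.sq_sqrt hw.le⟩
        rw [hz _ (Real.sqrt_pos.mpr hw), Real.sq_sqrt hw.le]
        exact h0
      · rintro ⟨⟨x, hx, h0⟩, rfl⟩
        exact ⟨by positivity, (hz x hx).mp h0⟩)
  simpa only [← pow_mul] using this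

/-! ### `q`-Bessel functions and Ramanujan's function -/

theorem qPoch_succ {K : Type} [Field K] (a q : K) (n : ℕ) :
    qPoch a q (n + 1) = qPoch a q n * (1 - a * q ^ n) :=
  Finset.prod_range_succ _ _

theorem qPoch_succ' {K : Type} [Field K] (a q : K) (n : ℕ) :
    qPoch a q (n + 1) = (1 - a) * qPoch (a * q) q n := by
  rw [qPoch, Finset.prod_range_succ', pow_zero, mul_one, mul_comm]
  congr 1
  exact Finset.prod_congr rfl fun k _ => by rw [pow_succ]; ring

theorem one_sub_mul_pow_pos {a q : ℝ} (ha : a < 1) (ha0 : 0 < a) (hq : 0 < q) (hq1 : q < 1)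
    (n : ℕ) : 0 < 1 - a * q ^ n := by
  have : q ^ n ≤ 1 := pow_le_one₀ hq.le hq1.le
  nlinarith

theorem qPoch_pos {a q : ℝ} (ha : a < 1) (ha0 : 0 < a) (hq : 0 < q) (hq1 : q < 1) (n : ℕ) :
    0 < qPoch a q n :=
  Finset.prod_pos fun k _ => one_sub_mul_pow_pos ha ha0 hq hq1 k

theorem ofReal_qPoch (a q : ℝ) (n : ℕ) : ((qPoch a q n : ℝ) : ℂ) = qPoch (a : ℂ) q n := by
  simp [qPoch]

theorem tendsto_one_sub_mul_pow {a q : ℝ} (hq : 0 < q) (hq1 : q < 1) :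
    Tendsto (fun n : ℕ => 1 - a * q ^ n) atTop (𝓝 1) := by
  simpa using ((tendsto_pow_atTop_nhds_zero_of_lt_one hq.le hq1).const_mul a).const_sub 1

/-- The coefficients of a multiple of the `q`-Bessel function as a power series in `x ^ 2`;
`p` stands for `q ^ ν`. -/
noncomputable def qBesselCoeff {K : Type} [Field K] (q p : K) (i : ℕ) : K :=
  (-1) ^ i * q ^ i ^ 2 * p ^ i / (4 ^ i * (qPoch q q i * qPoch (p * q) q i))

/-- The q-analogue of the order-raising relation: `ν ↦ ν + 1` becomes `p ↦ p q`. -/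
theorem qBesselCoeff_recurrence {q p : ℝ} (hq : 0 < q) (hq1 : q < 1) (hp : 0 < p)
    (hpq : p * q < 1) (i : ℕ) :
    qBesselCoeff q p (i + 1) = qBesselCoeff q (p * q) (i + 1) -
      p * q / (4 * (1 - p * q) * (1 - p * q ^ 2)) * qBesselCoeff q (p * q ^ 2) i := by
  have hpq0 : 0 < p * q := by positivity
  have h1 : 0 < 1 - p * q := by linarith
  have h2 : 0 < 1 - p * q ^ 2 := by nlinarith
  have h3 : 0 < 1 - p * q * q * q ^ i := by
    have := one_sub_mul_pow_pos hpq hpq0 hq hq1 (i + 1)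
    rw [pow_succ] at this
    linarith
  have h4 : 0 < 1 - q * q ^ i := one_sub_mul_pow_pos hq1 hq hq hq1 i
  have hX : 0 < qPoch (p * q * q) q i := qPoch_pos (by nlinarith) (by positivity) hq hq1 i
  have hY : qPoch (p * q ^ 2 * q) q i =
      qPoch (p * q * q) q i * (1 - p * q * q * q ^ i) / (1 - p * q ^ 2) := by
    rw [eq_div_iff h2.ne', ← qPoch_succ, qPoch_succ', mul_comm]
    ring_nf
  have hQ := qPoch_pos hq1 hq hq hq1 i
  rw [qBesselCoeff, qBesselCoeff, qBesselCoeff, qPoch_succ q, qPoch_succ' (p * q), hY,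
    qPoch_succ (p * q * q)]
  have e : q ^ (i + 1) ^ 2 = q ^ i ^ 2 * (q ^ i) ^ 2 * q := by ring
  have e3 : 1 - p * q ^ 2 * q ^ i ≠ 0 := by
    rw [sq, ← mul_assoc]
    exact h3.ne'
  have e4 : (p * q) ^ (i + 1) = p ^ i * p * (q ^ i * q) := by ring
  have e5 : (p * q ^ 2) ^ i = p ^ i * (q ^ i) ^ 2 := by ring
  have e6 := h4.ne'
  have e7 := h1.ne'
  have e8 := h2.ne'
  rw [e, e4, e5, show p * q * q = p * q ^ 2 by ring] at *
  -- After clearing the shifted factorials, what is left is a rational identity in `p`, `q` and `E =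
  -- qⁱ`.
  generalize q ^ i = E at *
  generalize qPoch (p * q ^ 2) q i = X at *
  generalize t1 : 1 - q * E = u1 at *
  generalize t2 : 1 - p * q = u2 at *
  generalize t3 : 1 - p * q ^ 2 * E = u3 at *
  generalize t4 : 1 - p * q ^ 2 = u4 at *
  field_simp
  subst t1 t2 t3 t4
  ring

theorem qBesselCoeff_zero {K : Type} [Field K] (q p : K) : qBesselCoeff q p 0 = 1 := by
  simp [qBesselCoeff, qPoch]

theorem abs_qBesselCoeff {q p : ℝ} (hq : 0 < q) (hq1 : q < 1) (hp : 0 < p)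
    (hpq : p * q < 1) (i : ℕ) :
    |qBesselCoeff q p i| = q ^ i ^ 2 * p ^ i / (4 ^ i * (qPoch q q i * qPoch (p * q) q i)) := by
  have h1 := qPoch_pos hq1 hq hq hq1 i
  have h2 := qPoch_pos hpq (by positivity) hq hq1 i
  rw [qBesselCoeff, abs_div, abs_of_pos (a := 4 ^ i * _) (by positivity), abs_mul, abs_mul,
    abs_of_pos (a := q ^ i ^ 2) (by positivity), abs_of_pos (a := p ^ i) (by positivity)]
  simp

theorem tendsto_mul_pow_odd {q : ℝ} (hq : 0 < q) (hq1 : q < 1) :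
    Tendsto (fun i : ℕ => ((i : ℝ) + 1) * q ^ (2 * i + 1)) atTop (𝓝 0) := by
  have h1 := tendsto_self_mul_const_pow_of_lt_one hq.le hq1
  have h2 := h1.comp (tendsto_add_atTop_nat 1)
  refine squeeze_zero (fun i => by positivity) (fun i => ?_) h2
  simp only [Function.comp, Nat.cast_add, Nat.cast_one]
  exact mul_le_mul_of_nonneg_left (pow_le_pow_of_le_one hq.le hq1.le (by omega)) (by positivity)

/-- The index `n` stands for the order `ν + n`. Gaussian factors `q^(i²)` beat the factorial in the
growth condition. -/
theorem recurrenceArray_qBessel {q p : ℝ} (hq : 0 < q) (hq1 : q < 1) (hp : 0 < p)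
    (hpq : p * q < 1) :
    RecurrenceArray (fun n i => qBesselCoeff q (p * q ^ n) i)
      (fun n => p * q ^ n * q / (4 * (1 - p * q ^ n * q) * (1 - p * q ^ n * q ^ 2)))
      (fun i => |qBesselCoeff q p i|) := by
  have hpn : ∀ n : ℕ, p * q ^ n * q ≤ p * q := fun n => by
    have : q ^ n ≤ 1 := pow_le_one₀ hq.le hq1.le
    have h0 : 0 < p * q := by positivity
    nlinarith
  have hpn1 : ∀ n : ℕ, p * q ^ n * q < 1 := fun n => (hpn n).trans_lt hpq
  have hpn2 : ∀ n : ℕ, p * q ^ n * q ^ 2 < 1 := fun n => by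
    have h0 : 0 < p * q ^ n * q := by positivity
    nlinarith [hpn1 n]
  -- Replacing `p` by `p qⁿ` produces the factor `q^(ni)` and only enlarges the denominators. This
  -- gives both the domination and the decay in `n`.
  have hle : ∀ n i : ℕ, |qBesselCoeff q (p * q ^ n) i| ≤ |qBesselCoeff q p i| * (q ^ n) ^ i := by
    intro n i
    rw [abs_qBesselCoeff hq hq1 (by positivity) (hpn1 n), abs_qBesselCoeff hq hq1 hp hpq]
    have h1 := qPoch_pos hq1 hq hq hq1 i
    have h2 := qPoch_pos hpq (by positivity) hq hq1 i
    have h3 := qPoch_pos (hpn1 n) (by positivity) hq hq1 i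
    have h4 : qPoch (p * q) q i ≤ qPoch (p * q ^ n * q) q i := by
      refine Finset.prod_le_prod (fun k _ =>
        (one_sub_mul_pow_pos hpq (by positivity) hq hq1 k).le) fun k _ => ?_
      have := mul_le_mul_of_nonneg_right (hpn n) (pow_nonneg hq.le k)
      linarith
    rw [div_mul_eq_mul_div, mul_pow, mul_assoc (q ^ i ^ 2)]
    gcongr
  refine ⟨fun n => qBesselCoeff_zero _ _, fun n i => ?_, fun n => ?_, ?_, fun n i => ?_,
    fun ε hε => ?_, fun i => ?_⟩
  · have := qBesselCoeff_recurrence hq hq1 (p := p * q ^ n) (by positivity) (hpn1 n) i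
    rw [this]
    ring_nf
  · have h1 : 0 < 1 - p * q ^ n * q := by linarith [hpn1 n]
    have h2 : 0 < 1 - p * q ^ n * q ^ 2 := by linarith [hpn2 n]
    positivity
  · have h0 := tendsto_pow_atTop_nhds_zero_of_lt_one hq.le hq1
    have h1 : Tendsto (fun n : ℕ => p * q ^ n * q) atTop (𝓝 0) := by
      simpa using (h0.const_mul p).mul_const q
    have h2 : Tendsto (fun n : ℕ => p * q ^ n * q ^ 2) atTop (𝓝 0) := by
      simpa using (h0.const_mul p).mul_const (q ^ 2)
    have h3 := h1.div (((h1.const_sub 1).const_mul 4).mul (h2.const_sub 1)) (by norm_num)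
    simpa using! h3
  · refine (hle n i).trans (mul_le_of_le_one_right (abs_nonneg _) ?_)
    exact pow_le_one₀ (by positivity) (pow_le_one₀ hq.le hq1.le)
  · refine exists_le_mul_pow_of_ratio (b := fun i => |qBesselCoeff q p i| * i.factorial)
      (fun i => ?_) ?_ hε
    · have h1 := qPoch_pos hq1 hq hq hq1 i
      have h2 := qPoch_pos hpq (by positivity) hq hq1 i
      have h3 : (0 : ℝ) < i.factorial := by exact_mod_cast i.factorial_pos
      rw [abs_qBesselCoeff hq hq1 hp hpq]
      positivity
    · have h0 : (fun i : ℕ => |qBesselCoeff q p (i + 1)| * (i + 1).factorial /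
          (|qBesselCoeff q p i| * i.factorial)) = fun i : ℕ =>
          (((i : ℝ) + 1) * q ^ (2 * i + 1)) * (p / 4) / ((1 - q * q ^ i) * (1 - p * q * q ^ i)) := by
        ext i
        have h1 := qPoch_pos hq1 hq hq hq1 i
        have h2 := qPoch_pos hpq (by positivity) hq hq1 i
        have h3 : (0 : ℝ) < i.factorial := by exact_mod_cast i.factorial_pos
        have h4 := one_sub_mul_pow_pos hq1 hq hq hq1 i
        have h5 := one_sub_mul_pow_pos hpq (by positivity) hq hq1 i
        rw [abs_qBesselCoeff hq hq1 hp hpq, abs_qBesselCoeff hq hq1 hp hpq, qPoch_succ, qPoch_succ,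
          Nat.factorial_succ]
        have e : q ^ (i + 1) ^ 2 = q ^ i ^ 2 * (q ^ i) ^ 2 * q := by ring
        have e2 : q ^ (2 * i + 1) = (q ^ i) ^ 2 * q := by ring
        rw [e, e2]
        push_cast
        have h4' := h4.ne'
        have h5' := h5.ne'
        generalize q ^ i = E at *
        generalize 1 - q * E = u1 at *
        generalize 1 - p * q * E = u2 at *
        generalize qPoch (p * q) q i = X at *
        field_simp
        ring
      rw [h0]
      have := ((tendsto_mul_pow_odd hq hq1).mul_const (p / 4)).div
        ((tendsto_one_sub_mul_pow (a := q) hq hq1).mul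
          (tendsto_one_sub_mul_pow (a := p * q) hq hq1)) (by norm_num)
      simpa using! this
  · have h0 := (tendsto_pow_atTop_nhds_zero_of_lt_one hq.le hq1).const_mul
      (|qBesselCoeff q p (i + 1)|)
    rw [mul_zero] at h0
    refine squeeze_zero_norm (fun n => (hle n (i + 1)).trans ?_) h0
    refine mul_le_mul_of_nonneg_left ?_ (abs_nonneg _)
    exact pow_le_of_le_one (by positivity) (pow_le_one₀ hq.le hq1.le) (Nat.succ_ne_zero i)

theorem qPochInf_ne_zero {a q : ℝ} (ha : a < 1) (ha0 : 0 < a) (hq : 0 < q) (hq1 : q < 1) :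
    qPochInf a q ≠ 0 := by
  have := tprod_one_add_ne_zero_of_summable (f := fun k : ℕ => -(a * q ^ k))
    (fun k => by
      have := one_sub_mul_pow_pos ha ha0 hq hq1 k
      rw [← sub_eq_add_neg]
      exact this.ne')
    (by
      have := ((summable_geometric_of_lt_one hq.le hq1).mul_left a).norm
      simpa using this)
  simpa only [← sub_eq_add_neg, qPochInf] using this

theorem qBesselJ_eq {ν q x : ℝ} (hq : 0 < q) (hx : 0 < x) :
    qBesselJ ν q x = qPochInf (q ^ (ν + 1)) q / qPochInf q q * (x / 2) ^ ν *
      ∑' i, qBesselCoeff q (q ^ ν) i * (x ^ 2) ^ i := by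
  rw [qBesselJ, mul_assoc _ ((x / 2) ^ ν), ← tsum_mul_left (a := (x / 2) ^ ν)]
  refine congrArg _ (tsum_congr fun n => ?_)
  have h1 : q ^ (ν + 1) = q ^ ν * q := by rw [Real.rpow_add hq, Real.rpow_one]
  have h2 : (x / 2) ^ (ν + 2 * n) = (x / 2) ^ ν * ((x / 2) ^ 2) ^ n := by
    rw [Real.rpow_add (by positivity), ← pow_mul, ← Real.rpow_natCast]
    push_cast
    rfl
  have h3 : (-q ^ ((n : ℝ) + ν)) ^ n = (-1) ^ n * q ^ n ^ 2 * (q ^ ν) ^ n := by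
    rw [neg_pow, Real.rpow_add hq, Real.rpow_natCast, mul_pow, ← pow_mul, sq]
    ring
  rw [h1, h2, h3, qBesselCoeff, div_pow x 2 2, div_pow]
  norm_num
  ring

theorem exists_rational_qBessel {n : ℕ} (hn : 1 ≤ n) :
    ∃ P Q : MvPolynomial (Fin 2) ℚ, ∀ ν q : ℝ, -1 < ν → 0 < q → q < 1 →
      MvPolynomial.aeval ![q, q ^ ν] Q ≠ 0 ∧
      HasSum (fun x : {x : ℝ // 0 < x ∧ qBesselJ ν q x = 0} => 1 / (x : ℝ) ^ (2 * n))
        (MvPolynomial.aeval ![q, q ^ ν] P / MvPolynomial.aeval ![q, q ^ ν] Q) := by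
  obtain ⟨k, rfl⟩ := Nat.exists_eq_add_of_le' hn
  set D : Set (Fin 2 → ℂ) :=
    {x | ∀ j : ℕ, qPoch (x 0) (x 0) j ≠ 0 ∧ qPoch (x 1 * x 0) (x 0) j ≠ 0} with hD
  obtain ⟨P, Q, hPQ⟩ := IsRationalOn.exists_newtonSum (D := D)
    (c := fun x i => qBesselCoeff (x 0) (x 1) i) (fun i => by
      have h0 := IsRationalOn.coord D 0
      have h1 := IsRationalOn.coord D 1
      refine ((((IsRationalOn.const D ((-1) ^ i)).mul (h0.pow (i ^ 2))).mul (h1.pow i)).div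
        ((IsRationalOn.const D (4 ^ i)).mul ((h0.qPoch h0 i).mul ((h1.mul h0).qPoch h0 i)))
        fun x hx => ?_).congr fun x _ => ?_
      · refine mul_ne_zero ?_ (mul_ne_zero (hx i).1 (hx i).2)
        push_cast
        exact pow_ne_zero _ (by norm_num)
      · rw [qBesselCoeff]
        push_cast
        rfl) (fun x _ => by rw [qBesselCoeff_zero]; exact one_ne_zero) k
  refine ⟨P, Q, fun ν q hν hq hq1 => ?_⟩
  have hp : 0 < q ^ ν := Real.rpow_pos_of_pos hq ν
  have hpq' : q ^ (ν + 1) = q ^ ν * q := by rw [Real.rpow_add hq, Real.rpow_one]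
  have hpq : q ^ ν * q < 1 := by
    rw [← hpq']
    exact Real.rpow_lt_one hq.le hq1 (by linarith)
  obtain ⟨h1, h2⟩ := hPQ ![q, q ^ ν] (fun j => by
    simp only [Matrix.cons_val_zero, Matrix.cons_val_one, ← Complex.ofReal_mul, ← ofReal_qPoch,
      Complex.ofReal_ne_zero]
    exact ⟨(qPoch_pos hq1 hq hq hq1 j).ne', (qPoch_pos hpq (by positivity) hq hq1 j).ne'⟩)
  refine ⟨h1, ?_⟩
  obtain ⟨s, hs⟩ := NewtonRel.exists_of_ne_zero (c := qBesselCoeff q (q ^ ν))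
    (by rw [qBesselCoeff_zero]; exact one_ne_zero)
  rw [← h2 (qBesselCoeff q (q ^ ν)) s (fun i => by simp [qBesselCoeff, ofReal_qPoch]) hs]
  have := (recurrenceArray_qBessel hq hq1 hp hpq).hasSum_zeros (s := s) (by simpa using hs) hn
    (ι := {x : ℝ // 0 < x ∧ qBesselJ ν q x = 0}) (e := fun x => (x : ℝ) ^ 2)
    (fun x y hxy => Subtype.ext ((pow_left_inj₀ x.2.1.le y.2.1.le two_ne_zero).mp hxy))
    (fun w => by
      have hz : ∀ x : ℝ, 0 < x →
          (qBesselJ ν q x = 0 ↔ ∑' i, qBesselCoeff q (q ^ ν) i * (x ^ 2) ^ i = 0) := by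
        intro x hx
        rw [qBesselJ_eq hq hx, mul_eq_zero, or_iff_right]
        refine mul_ne_zero (div_ne_zero ?_ (qPochInf_ne_zero hq1 hq hq hq1)) (by positivity)
        rw [hpq']
        exact qPochInf_ne_zero hpq (by positivity) hq hq1
      simp only [pow_zero, mul_one]
      constructor
      · rintro ⟨hw, h0⟩
        refine ⟨⟨√w, Real.sqrt_pos.mpr hw, ?_⟩, Real.sq_sqrt hw.le⟩
        rw [hz _ (Real.sqrt_pos.mpr hw), Real.sq_sqrt hw.le]
        exact h0
      · rintro ⟨⟨x, hx, h0⟩, rfl⟩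
        exact ⟨by positivity, (hz x hx).mp h0⟩)
  simpa only [← pow_mul] using this

/-- The Taylor coefficients of Ramanujan's function. -/
noncomputable def ramanujanCoeff {K : Type} [Field K] (q : K) (i : ℕ) : K :=
  (-1) ^ i * q ^ i ^ 2 / qPoch q q i

theorem abs_ramanujanCoeff {q : ℝ} (hq : 0 < q) (hq1 : q < 1) (i : ℕ) :
    |ramanujanCoeff q i| = q ^ i ^ 2 / qPoch q q i := by
  have h1 := qPoch_pos hq1 hq hq hq1 i
  rw [ramanujanCoeff, abs_div, abs_of_pos h1, abs_mul,
    abs_of_pos (a := q ^ i ^ 2) (by positivity)]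
  simp

/-- Here `Uₙ(x) = A_q(qⁿ x)`, and the recurrence is `A_q(x) = A_q(qx) - qx A_q(q²x)` evaluated at
`qⁿ x`. -/
theorem recurrenceArray_ramanujan {q : ℝ} (hq : 0 < q) (hq1 : q < 1) :
    RecurrenceArray (fun n i => ramanujanCoeff q i * (q ^ n) ^ i) (fun n => q ^ (n + 1))
      (fun i => |ramanujanCoeff q i|) := by
  have hle : ∀ n i : ℕ, |ramanujanCoeff q i * (q ^ n) ^ i| = |ramanujanCoeff q i| * (q ^ n) ^ i :=
    fun n i => by rw [abs_mul, abs_of_pos (a := (q ^ n) ^ i) (by positivity)]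
  refine ⟨fun n => by simp [ramanujanCoeff, qPoch], fun n i => ?_, fun n => by positivity, ?_,
    fun n i => ?_, fun ε hε => ?_, fun i => ?_⟩
  · have h1 := qPoch_pos hq1 hq hq hq1 i
    have h4 := one_sub_mul_pow_pos hq1 hq hq hq1 i
    rw [ramanujanCoeff, ramanujanCoeff, qPoch_succ]
    have e : (i + 1) ^ 2 = i ^ 2 + 2 * i + 1 := by ring
    rw [e]
    field_simp
    ring
  · exact (tendsto_pow_atTop_nhds_zero_of_lt_one hq.le hq1).comp (tendsto_add_atTop_nat 1)
  · rw [hle]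
    refine mul_le_of_le_one_right (abs_nonneg _) ?_
    exact pow_le_one₀ (by positivity) (pow_le_one₀ hq.le hq1.le)
  · refine exists_le_mul_pow_of_ratio (b := fun i => |ramanujanCoeff q i| * i.factorial)
      (fun i => ?_) ?_ hε
    · have h1 := qPoch_pos hq1 hq hq hq1 i
      have h3 : (0 : ℝ) < i.factorial := by exact_mod_cast i.factorial_pos
      rw [abs_ramanujanCoeff hq hq1]
      positivity
    · have h0 : (fun i : ℕ => |ramanujanCoeff q (i + 1)| * (i + 1).factorial /
          (|ramanujanCoeff q i| * i.factorial)) = fun i : ℕ =>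
          (((i : ℝ) + 1) * q ^ (2 * i + 1)) / (1 - q * q ^ i) := by
        ext i
        have h1 := qPoch_pos hq1 hq hq hq1 i
        have h3 : (0 : ℝ) < i.factorial := by exact_mod_cast i.factorial_pos
        have h4 := one_sub_mul_pow_pos hq1 hq hq hq1 i
        rw [abs_ramanujanCoeff hq hq1, abs_ramanujanCoeff hq hq1, qPoch_succ, Nat.factorial_succ]
        have e : q ^ (i + 1) ^ 2 = q ^ i ^ 2 * (q ^ i) ^ 2 * q := by ring
        have e2 : q ^ (2 * i + 1) = (q ^ i) ^ 2 * q := by ring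
        rw [e, e2]
        push_cast
        have h4' := h4.ne'
        generalize q ^ i = E at *
        field_simp
      rw [h0]
      simpa using! (tendsto_mul_pow_odd hq hq1).div
        (tendsto_one_sub_mul_pow (a := q) hq hq1) (by norm_num)
  · have h0 := (tendsto_pow_atTop_nhds_zero_of_lt_one hq.le hq1).const_mul
      (|ramanujanCoeff q (i + 1)|)
    rw [mul_zero] at h0
    refine squeeze_zero_norm (fun n => (hle n (i + 1)).le.trans ?_) h0
    refine mul_le_mul_of_nonneg_left ?_ (abs_nonneg _)
    exact pow_le_of_le_one (by positivity) (pow_le_one₀ hq.le hq1.le) (Nat.succ_ne_zero i)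

theorem ramanujanA_eq (q x : ℝ) : ramanujanA q x = ∑' i, ramanujanCoeff q i * x ^ i :=
  tsum_congr fun i => by
    rw [ramanujanCoeff, neg_pow]
    ring

theorem exists_rational_ramanujan {n : ℕ} (hn : 1 ≤ n) :
    ∃ P Q : Polynomial ℚ, ∀ q : ℝ, 0 < q → q < 1 → Polynomial.aeval q Q ≠ 0 ∧
      HasSum (fun x : {x : ℝ // 0 < x ∧ ramanujanA q x = 0} => 1 / (x : ℝ) ^ n)
        (Polynomial.aeval q P / Polynomial.aeval q Q) := by
  obtain ⟨k, rfl⟩ := Nat.exists_eq_add_of_le' hn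
  set D : Set (Unit → ℂ) := {x | ∀ j : ℕ, qPoch (x ()) (x ()) j ≠ 0} with hD
  obtain ⟨P, Q, hPQ⟩ := IsRationalOn.exists_newtonSum (D := D)
    (c := fun x i => ramanujanCoeff (x ()) i) (fun i => by
      have h0 := IsRationalOn.coord D ()
      refine (((IsRationalOn.const D ((-1) ^ i)).mul (h0.pow (i ^ 2))).div (h0.qPoch h0 i)
        fun x hx => hx i).congr fun x _ => ?_
      rw [ramanujanCoeff]
      push_cast
      rfl) (fun x _ => by simp [ramanujanCoeff, qPoch]) k
  obtain ⟨P', hP'⟩ := exists_polynomial_aeval_eq P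
  obtain ⟨Q', hQ'⟩ := exists_polynomial_aeval_eq Q
  refine ⟨P', Q', fun q hq hq1 => ?_⟩
  obtain ⟨h1, h2⟩ := hPQ (fun _ => q) (fun j => by
    simp only [← ofReal_qPoch, Complex.ofReal_ne_zero]
    exact (qPoch_pos hq1 hq hq hq1 j).ne')
  rw [hP', hQ']
  refine ⟨h1, ?_⟩
  obtain ⟨s, hs⟩ := NewtonRel.exists_of_ne_zero (c := ramanujanCoeff q)
    (by simp [ramanujanCoeff, qPoch])
  rw [← h2 (ramanujanCoeff q) s (fun i => by simp [ramanujanCoeff, ofReal_qPoch]) hs]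
  refine (recurrenceArray_ramanujan hq hq1).hasSum_zeros (s := s) (by simpa using hs) hn
    (ι := {x : ℝ // 0 < x ∧ ramanujanA q x = 0}) (e := fun x => (x : ℝ))
    Subtype.val_injective fun w => ?_
  simp only [pow_zero, one_pow, mul_one, ← ramanujanA_eq]
  exact ⟨fun h => ⟨⟨w, h⟩, rfl⟩, by rintro ⟨x, rfl⟩; exact x.2⟩

/-! ### Laplace transforms of measures with Gaussian tails -/

/-- All Gaussian moments `∫ exp (K x²) dμ` are finite. -/
def HasGaussianTails (μ : Measure ℝ) : Prop :=
  ∀ K : ℝ, Integrable (fun x => Real.exp (K * x ^ 2)) μ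

/-- The Laplace transform `∫ exp (z x) dμ(x)`. -/
noncomputable def laplaceTr (μ : Measure ℝ) (z : ℂ) : ℂ := ∫ x, Complex.exp (z * x) ∂μ

namespace HasGaussianTails

variable {μ : Measure ℝ} (h : HasGaussianTails μ)
include h

theorem integrable_exp_abs (t : ℝ) : Integrable (fun x => Real.exp (t * |x|)) μ := by
  refine ((h 1).const_mul (Real.exp (t ^ 2 / 4))).mono' (by fun_prop)
    (Eventually.of_forall fun x => ?_)
  rw [Real.norm_of_nonneg (Real.exp_nonneg _), ← Real.exp_add]
  refine Real.exp_le_exp.mpr ?_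
  -- Completing the square: `t|x| ≤ t²/4 + x²`.
  nlinarith [sq_nonneg (|x| - t / 2), sq_abs x]

theorem integrableExpSet_eq : ProbabilityTheory.integrableExpSet id μ = Set.univ := by
  ext t
  simp only [ProbabilityTheory.integrableExpSet, id_eq, Set.mem_univ, iff_true, Set.mem_ofPred_eq]
  refine (h.integrable_exp_abs |t|).mono' (by fun_prop) (Eventually.of_forall fun x => ?_)
  rw [Real.norm_of_nonneg (Real.exp_nonneg _), ← abs_mul]
  exact Real.exp_le_exp.mpr (le_abs_self _)

theorem mem_interior (t : ℝ) : t ∈ interior (ProbabilityTheory.integrableExpSet id μ) := by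
  rw [h.integrableExpSet_eq, interior_univ]
  trivial

theorem hasDerivAt_laplaceTr (z : ℂ) :
    HasDerivAt (laplaceTr μ) (∫ x, (x : ℂ) * Complex.exp (z * x) ∂μ) z :=
  ProbabilityTheory.hasDerivAt_complexMGF (X := id) (h.mem_interior z.re)

theorem differentiable_laplaceTr : Differentiable ℂ (laplaceTr μ) := fun z =>
  (h.hasDerivAt_laplaceTr z).differentiableAt

theorem iteratedDeriv_laplaceTr (k : ℕ) (z : ℂ) :
    iteratedDeriv k (laplaceTr μ) z = ∫ x, (x : ℂ) ^ k * Complex.exp (z * x) ∂μ :=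
  ProbabilityTheory.iteratedDeriv_complexMGF (X := id) (h.mem_interior z.re) k

theorem coeff_taylorPS_laplaceTr (k : ℕ) :
    PowerSeries.coeff k (taylorPS (laplaceTr μ)) = ((∫ x, x ^ k ∂μ : ℝ) : ℂ) / k.factorial := by
  rw [coeff_taylorPS, h.iteratedDeriv_laplaceTr]
  simp only [zero_mul, Complex.exp_zero, mul_one]
  rw [← integral_complex_ofReal]
  simp only [Complex.ofReal_pow]

/-- By `|z||x| ≤ ε|z|² + x²/(4ε)`, the Gaussian moments absorb the second term. This is the growth
hypothesis with `d = 2`, enough for all exponents `2n`. -/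
theorem norm_laplaceTr_le_exp {ε : ℝ} (hε : 0 < ε) :
    ∃ C, ∀ z, ‖laplaceTr μ z‖ ≤ C * Real.exp (ε * ‖z‖ ^ 2) := by
  refine ⟨∫ x, Real.exp (1 / (4 * ε) * x ^ 2) ∂μ, fun z => ?_⟩
  rw [mul_comm, ← integral_const_mul]
  refine norm_integral_le_of_norm_le ((h _).const_mul _) (Eventually.of_forall fun x => ?_)
  rw [Complex.norm_exp, ← Real.exp_add, Complex.re_mul_ofReal]
  refine Real.exp_le_exp.mpr ?_
  have h1 : z.re * x ≤ ‖z‖ * |x| := (le_abs_self _).trans (by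
    rw [abs_mul]
    exact mul_le_mul_of_nonneg_right (Complex.abs_re_le_norm z) (abs_nonneg _))
  refine h1.trans ?_
  have h2 : ε * ‖z‖ ^ 2 + 1 / (4 * ε) * x ^ 2 - ‖z‖ * |x| = ε * (‖z‖ - |x| / (2 * ε)) ^ 2 := by
    rw [← sq_abs x]
    field_simp
    ring
  nlinarith [mul_nonneg hε.le (sq_nonneg (‖z‖ - |x| / (2 * ε)))]

theorem integrable_pow_mul_exp (k : ℕ) (z : ℂ) :
    Integrable (fun x : ℝ => (x : ℂ) ^ k * Complex.exp (z * x)) μ :=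
  ProbabilityTheory.integrable_pow_mul_cexp_of_re_mem_interior_integrableExpSet (X := id)
    (h.mem_interior z.re) k

theorem integrable_pow (k : ℕ) : Integrable (fun x : ℝ => x ^ k) μ := by
  have := (h.integrable_pow_mul_exp k 0).re
  refine this.congr (Eventually.of_forall fun x => ?_)
  simp [← Complex.ofReal_pow]

/-- Derivatives of the Laplace transform of a measure on the positive half-line tend to `0` in
directions with negative real part. -/
theorem tendsto_integral_pow_mul_exp (hpos : ∀ᵐ x ∂μ, 0 < x) (k : ℕ) (b : ℂ) {c : ℂ}
    (hc : c.re < 0) :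
    Tendsto (fun T : ℝ => ∫ x, (x : ℂ) ^ k * Complex.exp ((b + T * c) * x) ∂μ) atTop (𝓝 0) := by
  have : Tendsto (fun T : ℝ => ∫ x, (x : ℂ) ^ k * Complex.exp ((b + T * c) * x) ∂μ) atTop
      (𝓝 (∫ _, 0 ∂μ)) := by
    refine tendsto_integral_filter_of_dominated_convergence
      (fun x => ‖(x : ℂ) ^ k * Complex.exp (b * x)‖)
      (Eventually.of_forall fun T => by fun_prop) ?_ (h.integrable_pow_mul_exp k b).norm ?_
    · filter_upwards [eventually_ge_atTop 0] with T hT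
      filter_upwards [hpos] with x hx
      rw [norm_mul, norm_mul, Complex.norm_exp, Complex.norm_exp]
      refine mul_le_mul_of_nonneg_left (Real.exp_le_exp.mpr ?_) (norm_nonneg _)
      rw [Complex.re_mul_ofReal, Complex.re_mul_ofReal, Complex.add_re, Complex.re_ofReal_mul]
      nlinarith [mul_nonneg (mul_nonneg hT (neg_pos.mpr hc).le) hx.le]
    · filter_upwards [hpos] with x hx
      rw [tendsto_zero_iff_norm_tendsto_zero]
      have h1 : (fun T : ℝ => ‖(x : ℂ) ^ k * Complex.exp ((b + T * c) * x)‖) =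
          fun T : ℝ => ‖(x : ℂ) ^ k‖ * (Real.exp (b.re * x) * Real.exp (c.re * x * T)) := by
        ext T
        rw [norm_mul, Complex.norm_exp, ← Real.exp_add, Complex.re_mul_ofReal, Complex.add_re,
          Complex.re_ofReal_mul]
        ring_nf
      rw [h1]
      have h2 : Tendsto (fun T : ℝ => Real.exp (c.re * x * T)) atTop (𝓝 0) :=
        Real.tendsto_exp_atBot.comp
          (tendsto_id.const_mul_atTop_of_neg (mul_neg_of_neg_of_pos hc hx))
      simpa using (h2.const_mul (Real.exp (b.re * x))).const_mul ‖(x : ℂ) ^ k‖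
  simpa using this

end HasGaussianTails

/-- The measure on `s` with density `ρ`. -/
noncomputable def densityMeasure (ρ : ℝ → ℝ) (s : Set ℝ) : Measure ℝ :=
  (volume.restrict s).withDensity fun x => ENNReal.ofReal (ρ x)

theorem integrable_densityMeasure {ρ : ℝ → ℝ} {s : Set ℝ} (hρ : Measurable ρ) (h0 : ∀ x, 0 ≤ ρ x)
    {E : Type*} [NormedAddCommGroup E] [NormedSpace ℝ E] {f : ℝ → E} :
    Integrable f (densityMeasure ρ s) ↔ IntegrableOn (fun x => ρ x • f x) s := by
  rw [densityMeasure, integrable_withDensity_iff_integrable_smul' (by fun_prop)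
    (Eventually.of_forall fun x => ENNReal.ofReal_lt_top), IntegrableOn]
  simp only [ENNReal.toReal_ofReal (h0 _)]

theorem integral_densityMeasure {ρ : ℝ → ℝ} {s : Set ℝ} (hρ : Measurable ρ) (h0 : ∀ x, 0 ≤ ρ x)
    {E : Type*} [NormedAddCommGroup E] [NormedSpace ℝ E] (f : ℝ → E) :
    ∫ x, f x ∂(densityMeasure ρ s) = ∫ x in s, ρ x • f x := by
  rw [densityMeasure, integral_withDensity_eq_integral_toReal_smul (by fun_prop)
    (Eventually.of_forall fun x => ENNReal.ofReal_lt_top)]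
  simp only [ENNReal.toReal_ofReal (h0 _)]

/-! ### The Airy function -/

/-- The measure `exp (-x³) dx` on the positive half-line. -/
noncomputable def airyMeasure : Measure ℝ :=
  densityMeasure (fun x => Real.exp (-x ^ 3)) (Set.Ioi 0)

theorem airyMeasure_pos : ∀ᵐ x ∂airyMeasure, 0 < x :=
  (withDensity_absolutelyContinuous _ _).ae_le (ae_restrict_mem measurableSet_Ioi)

theorem airyMeasure_hasGaussianTails : HasGaussianTails airyMeasure := by
  intro K
  rw [airyMeasure, integrable_densityMeasure (by fun_prop) fun x => Real.exp_nonneg _]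
  -- For `x ≥ B` one has `x³ ≥ (|K| + 1) x² ≥ |K| x² + x`; for `x ≤ B` the constant factor suffices.
  set B : ℝ := |K| + 1 with hB
  have hB1 : 1 ≤ B := by rw [hB]; linarith [abs_nonneg K]
  have hint : IntegrableOn (fun x : ℝ => Real.exp (|K| * B ^ 2 + B) * Real.exp (-x)) (Set.Ioi 0) :=
    (integrableOn_exp_neg_Ioi 0).const_mul _
  refine hint.mono' (by fun_prop) ?_
  filter_upwards [ae_restrict_mem measurableSet_Ioi] with x hx
  have hx0 : (0 : ℝ) < x := hx
  rw [smul_eq_mul, ← Real.exp_add, ← Real.exp_add, Real.norm_of_nonneg (Real.exp_nonneg _)]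
  refine Real.exp_le_exp.mpr ?_
  have hK : K * x ^ 2 ≤ |K| * x ^ 2 := mul_le_mul_of_nonneg_right (le_abs_self K) (sq_nonneg x)
  rcases le_total x B with hxB | hxB
  · have h1 : |K| * x ^ 2 ≤ |K| * B ^ 2 := by gcongr
    have h3 : 0 ≤ x ^ 3 := by positivity
    linarith
  · have h1 : B * x ^ 2 ≤ x ^ 3 := by nlinarith [mul_le_mul_of_nonneg_right hxB (sq_nonneg x)]
    have h2 : x ≤ x ^ 2 := by nlinarith
    have h3 : 0 ≤ |K| * B ^ 2 := by positivity
    rw [hB] at h1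
    linarith

theorem integral_pow_airyMeasure (k : ℕ) :
    ∫ x, x ^ k ∂airyMeasure = Real.Gamma ((k + 1) / 3) / 3 := by
  rw [airyMeasure, integral_densityMeasure (by fun_prop) fun x => Real.exp_nonneg _]
  have := _root_.integral_rpow_mul_exp_neg_rpow (p := 3) (q := k) (by norm_num)
    (by have : (0 : ℝ) ≤ k := Nat.cast_nonneg k; linarith)
  rw [div_eq_inv_mul, ← one_div, ← this]
  refine setIntegral_congr_fun measurableSet_Ioi fun x _ => ?_
  simp only [smul_eq_mul]
  rw [mul_comm, Real.rpow_natCast, show (3 : ℝ) = ((3 : ℕ) : ℝ) by norm_num, Real.rpow_natCast]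

/-- A primitive third root of unity. -/
noncomputable def zeta3 : ℂ := ⟨-1 / 2, √3 / 2⟩

theorem zeta3_sq : zeta3 ^ 2 = ⟨-1 / 2, -(√3 / 2)⟩ := by
  have h3 : √3 * √3 = 3 := Real.mul_self_sqrt (by norm_num)
  apply Complex.ext
  · simp [zeta3, sq]; linarith
  · simp [zeta3, sq]; ring

theorem zeta3_cube : zeta3 ^ 3 = 1 := by
  have h3 : √3 * √3 = 3 := Real.mul_self_sqrt (by norm_num)
  rw [pow_succ, zeta3_sq]
  apply Complex.ext
  · simp [zeta3]; linarith
  · simp [zeta3]; ring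

theorem zeta3_sub_sq : zeta3 - zeta3 ^ 2 = √3 * I := by
  rw [zeta3_sq]
  apply Complex.ext
  · simp [zeta3]
  · simp [zeta3]

/-- The real Taylor coefficients of `airyA`. -/
noncomputable def airyCoeff (k : ℕ) : ℝ :=
  √3 / 6 * (if k % 3 = 0 then 1 else if k % 3 = 1 then -1 else 0) * (-1) ^ k *
    Real.Gamma ((k + 1) / 3) / k.factorial

/-- The entire extension of `airyA`. -/
noncomputable def airyEntire (z : ℂ) : ℂ :=
  (2 * I)⁻¹ * (zeta3 * laplaceTr airyMeasure (-zeta3 * z) -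
    zeta3 ^ 2 * laplaceTr airyMeasure (-zeta3 ^ 2 * z))

theorem differentiable_airyEntire : Differentiable ℂ airyEntire := by
  have h := airyMeasure_hasGaussianTails.differentiable_laplaceTr
  have h1 : Differentiable ℂ fun z => laplaceTr airyMeasure (-zeta3 * z) := h.comp (by fun_prop)
  have h2 : Differentiable ℂ fun z => laplaceTr airyMeasure (-zeta3 ^ 2 * z) :=
    h.comp (by fun_prop)
  unfold airyEntire
  fun_prop

/-- Up to `√3 i` this is the nontrivial character modulo `3` at `k + 1`. It explains the sign
pattern in `airyCoeff` and the absent residue class. -/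
theorem zeta3_pow_sub (k : ℕ) : zeta3 ^ (k + 1) - (zeta3 ^ 2) ^ (k + 1) =
    √3 * I * (if k % 3 = 0 then 1 else if k % 3 = 1 then -1 else 0) := by
  have hmod : ∀ j : ℕ, zeta3 ^ (3 * j) = 1 := fun j => by rw [pow_mul, zeta3_cube, one_pow]
  obtain ⟨m, r, hr, rfl⟩ : ∃ m r, r < 3 ∧ k = 3 * m + r :=
    ⟨k / 3, k % 3, Nat.mod_lt _ (by norm_num), (Nat.div_add_mod k 3).symm⟩
  rw [← pow_mul, Nat.mul_add_mod, Nat.mod_eq_of_lt hr, ← zeta3_sub_sq]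
  interval_cases r
  · rw [show 3 * m + 0 + 1 = 3 * m + 1 by ring, show 2 * (3 * m + 1) = 3 * (2 * m) + 2 by ring,
      pow_add, pow_add, hmod, hmod]
    simp
  · rw [show 3 * m + 1 + 1 = 3 * m + 2 by ring, show 2 * (3 * m + 2) = 3 * (2 * m + 1) + 1 by ring,
      pow_add, pow_add, hmod, hmod]
    simp
  · rw [show 3 * m + 2 + 1 = 3 * (m + 1) by ring, show 2 * (3 * (m + 1)) = 3 * (2 * m + 2) by ring,
      hmod, hmod]
    simp

theorem hasSum_airyEntire (z : ℂ) :
    HasSum (fun k => (airyCoeff k : ℂ) * z ^ k) (airyEntire z) := by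
  have h := hasSum_taylorPS airyMeasure_hasGaussianTails.differentiable_laplaceTr
  have h1 := ((h (-zeta3 * z)).mul_left zeta3).sub ((h (-zeta3 ^ 2 * z)).mul_left (zeta3 ^ 2))
  refine (h1.mul_left (2 * I)⁻¹).congr_fun fun k => ?_
  rw [airyMeasure_hasGaussianTails.coeff_taylorPS_laplaceTr, integral_pow_airyMeasure, airyCoeff]
  have h2 := zeta3_pow_sub k
  have h3 : (-zeta3 * z) ^ k = (-1) ^ k * zeta3 ^ k * z ^ k := by
    rw [neg_mul, neg_pow, mul_pow]; ring
  have h4 : (-zeta3 ^ 2 * z) ^ k = (-1) ^ k * (zeta3 ^ 2) ^ k * z ^ k := by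
    rw [neg_mul, neg_pow, mul_pow]; ring
  have h5 : ((√3 / 6 * (if k % 3 = 0 then 1 else if k % 3 = 1 then -1 else 0) * (-1) ^ k *
      Real.Gamma ((k + 1) / 3) / k.factorial : ℝ) : ℂ) = (2 * I)⁻¹ *
      (√3 * I * (if k % 3 = 0 then 1 else if k % 3 = 1 then -1 else 0)) * (-1) ^ k *
      ((Real.Gamma ((k + 1) / 3) / 3 : ℝ) : ℂ) / k.factorial := by
    have : (k.factorial : ℂ) ≠ 0 := Nat.cast_ne_zero.mpr k.factorial_ne_zero
    have hI := I_ne_zero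
    split_ifs <;> push_cast <;> field_simp <;> ring
  rw [h3, h4, h5, ← h2]
  ring

theorem airyEntire_coeff (k : ℕ) :
    PowerSeries.coeff k (taylorPS airyEntire) = airyCoeff k :=
  coeff_taylorPS_of_hasSum one_pos (fun z _ => hasSum_airyEntire z) k

theorem airyEntire_ofReal (x : ℝ) : airyEntire x = ((∑' k, airyCoeff k * x ^ k : ℝ) : ℂ) := by
  rw [← (hasSum_airyEntire x).tsum_eq, Complex.ofReal_tsum]
  exact tsum_congr fun k => by push_cast; rfl

theorem summable_airyCoeff (x : ℝ) : Summable fun k => airyCoeff k * x ^ k := by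
  have := (hasSum_airyEntire x).summable
  refine Complex.summable_ofReal.mp (this.congr fun k => ?_)
  push_cast
  rfl

theorem Gamma_natCast_add {a : ℝ} (ha : 0 < a) (m : ℕ) :
    Real.Gamma (m + a) = (ascPochhammer ℝ m).eval a * Real.Gamma a := by
  induction m with
  | zero => simp
  | succ m ih =>
    have hm : (0 : ℝ) ≤ m := Nat.cast_nonneg m
    rw [show ((m + 1 : ℕ) : ℝ) + a = (m + a) + 1 by push_cast; ring,
      Real.Gamma_add_one (by linarith), ih, ascPochhammer_succ_eval]
    ring

theorem Gamma_third_mul : Real.Gamma (1 / 3) * Real.Gamma (2 / 3) = 2 * π / √3 := by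
  have := Real.Gamma_mul_Gamma_one_sub (1 / 3)
  rw [show (1 : ℝ) - 1 / 3 = 2 / 3 by norm_num, show π * (1 / 3) = π / 3 by ring,
    Real.sin_pi_div_three] at this
  rw [this]
  field_simp

/-- Splitting the series by `k` modulo `3`, one class vanishes and the other two are the two
Maclaurin series of `Ai`; the constants agree by the reflection formula for `Γ(1/3) Γ(2/3)`. -/
theorem airyA_eq (x : ℝ) : airyA x = ∑' k, airyCoeff k * x ^ k := by
  have hΓ1 : 0 < Real.Gamma (1 / 3) := Real.Gamma_pos_of_pos (by norm_num)
  have hΓ2 : 0 < Real.Gamma (2 / 3) := Real.Gamma_pos_of_pos (by norm_num)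
  have hs3 : 0 < √3 := Real.sqrt_pos.mpr (by norm_num)
  have hG := Gamma_third_mul
  rw [eq_div_iff hs3.ne'] at hG
  set t : ℝ := (3 : ℝ) ^ (1 / 3 : ℝ) with ht
  have ht0 : 0 < t := by positivity
  have ht3 : t ^ 3 = 3 := by
    rw [ht, ← Real.rpow_natCast, ← Real.rpow_mul (by norm_num)]
    norm_num
  have e1 : (3 : ℝ) ^ (-1 / 3 : ℝ) = t⁻¹ := by
    rw [ht, ← Real.rpow_neg (by norm_num)]; norm_num
  have e2 : (3 : ℝ) ^ (-2 / 3 : ℝ) = t⁻¹ ^ 2 := by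
    rw [← e1, ← Real.rpow_natCast, ← Real.rpow_mul (by norm_num)]; norm_num
  rw [Nat.sumByResidueClasses (summable_airyCoeff x) 3, airyA, airyAi, e1, e2]
  have h3 : (Finset.univ : Finset (ZMod 3)) = {0, 1, 2} := rfl
  rw [h3, Finset.sum_insert (by decide), Finset.sum_insert (by decide), Finset.sum_singleton,
    show (0 : ZMod 3).val = 0 from rfl, show (1 : ZMod 3).val = 1 from rfl,
    show (2 : ZMod 3).val = 2 from rfl]
  have z2 : ∑' m, airyCoeff (2 + 3 * m) * x ^ (2 + 3 * m) = 0 := by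
    rw [← tsum_zero (α := ℝ) (β := ℕ)]
    refine tsum_congr fun m => ?_
    have : (2 + 3 * m) % 3 = 2 := by omega
    simp [airyCoeff, this]
  have hxm : ∀ m : ℕ, (-x / t) ^ (3 * m) = (-1) ^ m * x ^ (3 * m) / 3 ^ m := by
    intro m
    rw [div_pow, pow_mul t, ht3, pow_mul, neg_pow, pow_mul x]
    norm_num
    rw [← mul_pow]
    ring
  have z0 : ∀ m, airyCoeff (0 + 3 * m) * x ^ (0 + 3 * m) = π / t * (t⁻¹ ^ 2 / Real.Gamma (2 / 3)) *
      (3 ^ m * (ascPochhammer ℝ m).eval (1 / 3) * (-x / t) ^ (3 * m) / (3 * m).factorial) := by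
    intro m
    have h1 : (0 + 3 * m) % 3 = 0 := by omega
    have h2 : ((0 + 3 * m : ℕ) + 1 : ℝ) / 3 = m + 1 / 3 := by push_cast; ring
    have h4 : (-1 : ℝ) ^ (3 * m) = (-1) ^ m := by rw [pow_mul]; norm_num
    rw [airyCoeff, if_pos h1, h2, Gamma_natCast_add (by norm_num), hxm, zero_add, h4]
    have h5 : π / t * (t⁻¹ ^ 2 / Real.Gamma (2 / 3)) = √3 / 6 * Real.Gamma (1 / 3) := by
      have : t⁻¹ ^ 2 / t = 1 / 3 := by rw [← ht3]; field_simp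
      have h6 : π / t * (t⁻¹ ^ 2 / Real.Gamma (2 / 3)) =
        (t⁻¹ ^ 2 / t) * π / Real.Gamma (2 / 3) := by ring
      rw [h6, this, div_eq_iff hΓ2.ne']
      have h7 : √3 * √3 = 3 := Real.mul_self_sqrt (by norm_num)
      linear_combination -hG / 6
    rw [h5]
    field_simp
  have z1 : ∀ m, airyCoeff (1 + 3 * m) * x ^ (1 + 3 * m) =
      -(π / t * (t⁻¹ / Real.Gamma (1 / 3))) * (3 ^ m * (ascPochhammer ℝ m).eval (2 / 3) *
        (-x / t) ^ (3 * m + 1) / (3 * m + 1).factorial) := by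
    intro m
    have h1 : (1 + 3 * m) % 3 = 1 := by omega
    have h2 : ((1 + 3 * m : ℕ) + 1 : ℝ) / 3 = m + 2 / 3 := by push_cast; ring
    have h4 : (-1 : ℝ) ^ (3 * m) = (-1) ^ m := by rw [pow_mul]; norm_num
    rw [airyCoeff, if_neg (by omega), if_pos h1, h2, Gamma_natCast_add (by norm_num), pow_succ,
      hxm, add_comm 1 (3 * m), pow_succ (-1 : ℝ), h4, pow_succ x]
    have h5 : π / t * (t⁻¹ / Real.Gamma (1 / 3)) = t * (√3 / 6 * Real.Gamma (2 / 3)) := by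
      have : t⁻¹ / t = t / 3 := by rw [← ht3]; field_simp
      have h6 : π / t * (t⁻¹ / Real.Gamma (1 / 3)) =
        (t⁻¹ / t) * π / Real.Gamma (1 / 3) := by ring
      rw [h6, this, div_eq_iff hΓ1.ne']
      linear_combination -hG / 6 * t
    rw [h5]
    field_simp
  rw [z2, tsum_congr z0, tsum_congr z1, tsum_mul_left, tsum_mul_left]
  ring

/-! ### Zeros of the Airy function -/

/-- The differential equation `g'' = -(z/3) g` on coefficients; it comes from `Γ(s + 1) = s Γ(s)`.
-/
theorem airyCoeff_add_three (k : ℕ) :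
    airyCoeff (k + 3) * ((k + 3) * (k + 2)) = -airyCoeff k / 3 := by
  have hk : ((k : ℝ) + 1) / 3 ≠ 0 := by positivity
  have h1 : ((k + 3 : ℕ) + 1 : ℝ) / 3 = (k + 1) / 3 + 1 := by push_cast; ring
  rw [airyCoeff, airyCoeff, Nat.add_mod_right, h1, Real.Gamma_add_one hk, Nat.factorial_succ,
    Nat.factorial_succ, Nat.factorial_succ]
  have hf : (k.factorial : ℝ) ≠ 0 := Nat.cast_ne_zero.mpr k.factorial_ne_zero
  have h2 : (k : ℝ) + 1 ≠ 0 := by positivity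
  have h3 : (k : ℝ) + 2 ≠ 0 := by positivity
  have h4 : (k : ℝ) + 3 ≠ 0 := by positivity
  have e1 : ((k + 1 + 1 : ℕ) : ℝ) = k + 2 := by push_cast; ring
  have e2 : ((k + 2 + 1 : ℕ) : ℝ) = k + 3 := by push_cast; ring
  rw [Nat.cast_mul, Nat.cast_mul, Nat.cast_mul, e1, e2, Nat.cast_add_one]
  generalize (if k % 3 = 0 then (1 : ℝ) else if k % 3 = 1 then -1 else 0) = w
  field_simp
  ring

theorem deriv_deriv_eq_of_coeff {g : ℂ → ℂ} (hg : Differentiable ℂ g) {a : ℕ → ℂ}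
    (ha : ∀ k, PowerSeries.coeff k (taylorPS g) = a k) (h2 : a 2 = 0)
    (h3 : ∀ k : ℕ, a (k + 3) * ((k + 3) * (k + 2)) = -a k / 3) (z : ℂ) :
    deriv (deriv g) z = -(z / 3) * g z := by
  have hc : ∀ k : ℕ, PowerSeries.coeff k (taylorPS (deriv (deriv g))) =
      a (k + 2) * ((k + 2) * (k + 1)) := fun k => by
    rw [taylorPS_deriv, taylorPS_deriv, PowerSeries.coeff_derivative,
      PowerSeries.coeff_derivative, ha]
    push_cast
    ring
  have h1 := hasSum_taylorPS hg.deriv.deriv z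
  have h4 : HasSum (fun k => PowerSeries.coeff (k + 1) (taylorPS (deriv (deriv g))) *
      z ^ (k + 1)) (-(z / 3) * g z) := by
    refine ((hasSum_taylorPS hg z).mul_left (-(z / 3))).congr_fun fun k => ?_
    rw [hc, ha]
    have := h3 k
    push_cast at this ⊢
    linear_combination this * z ^ (k + 1)
  have h5 := h1.unique (HasSum.zero_add (f := fun k =>
    PowerSeries.coeff k (taylorPS (deriv (deriv g))) * z ^ k) h4)
  rw [h5, hc, h2]
  simp

theorem deriv_deriv_airyEntire (z : ℂ) :
    deriv (deriv airyEntire) z = -(z / 3) * airyEntire z := by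
  refine deriv_deriv_eq_of_coeff differentiable_airyEntire airyEntire_coeff (by simp [airyCoeff])
    (fun k => ?_) z
  have := congrArg (fun x : ℝ => (x : ℂ)) (airyCoeff_add_three k)
  push_cast at this ⊢
  exact this

/-- Moving left by `T` adds `Tζ` and `Tζ²` to the two Laplace arguments, and both cube roots of
unity have negative real part. -/
theorem tendsto_airyEntire (a : ℂ) :
    Tendsto (fun T : ℝ => airyEntire (a - T)) atTop (𝓝 0) := by
  have h := fun c (hc : Complex.re c < 0) => airyMeasure_hasGaussianTails.tendsto_integral_pow_mul_exp
    airyMeasure_pos 0 (-c * a) hc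
  have h1 := (h zeta3 (by norm_num [zeta3])).const_mul zeta3
  have h2 := (h (zeta3 ^ 2) (by rw [zeta3_sq]; norm_num)).const_mul (zeta3 ^ 2)
  have h3 := (h1.sub h2).const_mul (2 * I)⁻¹
  simp only [pow_zero, one_mul, mul_zero, sub_zero] at h3
  refine h3.congr fun T => ?_
  simp only [airyEntire, laplaceTr]
  ring_nf

theorem deriv_airyEntire (z : ℂ) : deriv airyEntire z =
    (2 * I)⁻¹ * (-zeta3 ^ 2 * ∫ x, (x : ℂ) * Complex.exp (-zeta3 * z * x) ∂airyMeasure +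
      zeta3 ^ 4 * ∫ x, (x : ℂ) * Complex.exp (-zeta3 ^ 2 * z * x) ∂airyMeasure) := by
  have h := fun c : ℂ => (airyMeasure_hasGaussianTails.hasDerivAt_laplaceTr (c * z)).comp z
    ((hasDerivAt_id z).const_mul c)
  have h1 := (((h (-zeta3)).const_mul zeta3).sub ((h (-zeta3 ^ 2)).const_mul (zeta3 ^ 2))).const_mul
    (2 * I)⁻¹
  have h2 := h1.deriv
  simp only [mul_one] at h2
  refine Eq.trans ?_ (h2.trans ?_)
  · rfl
  · ring

theorem tendsto_deriv_airyEntire (a : ℂ) :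
    Tendsto (fun T : ℝ => deriv airyEntire (a - T)) atTop (𝓝 0) := by
  have h := fun c (hc : Complex.re c < 0) => airyMeasure_hasGaussianTails.tendsto_integral_pow_mul_exp
    airyMeasure_pos 1 (-c * a) hc
  have h1 := (h zeta3 (by norm_num [zeta3])).const_mul (-zeta3 ^ 2)
  have h2 := (h (zeta3 ^ 2) (by rw [zeta3_sq]; norm_num)).const_mul (zeta3 ^ 4)
  have h3 := (h1.add h2).const_mul (2 * I)⁻¹
  simp only [pow_one, mul_zero, add_zero] at h3
  refine h3.congr fun T => ?_
  rw [deriv_airyEntire]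
  have e : ∀ c x : ℂ, (-c * a + T * c) * x = -c * (a - T) * x := fun c x => by ring
  simp only [e]

/-- A function with nonnegative derivative on the positive half-line which vanishes at `0` and at
infinity is constant there. -/
theorem deriv_eq_zero_of_tendsto_zero {f f' : ℝ → ℝ} (hf : ∀ t, HasDerivAt f (f' t) t)
    (hf' : ∀ t, 0 < t → 0 ≤ f' t) (h0 : f 0 = 0) (hlim : Tendsto f atTop (𝓝 0)) {t : ℝ}
    (ht : 0 < t) : f' t = 0 := by
  have hmono : MonotoneOn f (Set.Ici 0) :=
    monotoneOn_of_deriv_nonneg (convex_Ici 0) (fun x _ => (hf x).continuousAt.continuousWithinAt)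
      (fun x _ => (hf x).differentiableAt.differentiableWithinAt) fun x hx => by
        rw [interior_Ici] at hx
        rw [(hf x).deriv]
        exact hf' x hx
  have hz : ∀ x, 0 ≤ x → f x = 0 := fun x hx => by
    refine le_antisymm (ge_of_tendsto hlim ?_) ?_
    · filter_upwards [eventually_ge_atTop x] with y hy
      exact hmono hx (hx.trans hy) hy
    · rw [← h0]
      exact hmono (Set.mem_Ici.mpr le_rfl) hx hx
  have : f =ᶠ[𝓝 t] fun _ => 0 := by
    filter_upwards [lt_mem_nhds ht] with x hx
    exact hz x hx.le
  exact (hf t).unique ((hasDerivAt_const t (0 : ℝ)).congr_of_eventuallyEq this)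

theorem airyCoeff_zero_pos : 0 < airyCoeff 0 := by
  have : 0 < Real.Gamma (1 / 3) := Real.Gamma_pos_of_pos (by norm_num)
  simp [airyCoeff] at this ⊢
  positivity

theorem airyEntire_zero_ne : airyEntire 0 ≠ 0 := by
  have h := hasSum_airyEntire 0
  have h1 := hasSum_single (f := fun k => (airyCoeff k : ℂ) * 0 ^ k) 0 fun k hk => by
    simp [zero_pow hk]
  rw [h.unique h1]
  simpa using airyCoeff_zero_pos.ne'

/-- Zeros are finite in number in a disc, so they cannot fill a segment. This makes the energy
inequalities strict somewhere. -/
theorem exists_airyEntire_ne_zero (a : ℂ) : ∃ t : ℝ, 0 < t ∧ airyEntire (a - t) ≠ 0 := by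
  by_contra! hcon
  refine Set.infinite_of_injOn_mapsTo (f := fun t : ℝ => a - t) (s := Set.Ioo 0 1)
    (fun x _ y _ hxy => by simpa using hxy) (fun t ht => ?_) (Set.Ioo_infinite one_pos)
    (finite_zeros differentiable_airyEntire airyEntire_zero_ne (‖a‖ + 1))
  refine ⟨hcon t ht.1, (norm_sub_le _ _).trans ?_⟩
  rw [Complex.norm_real, Real.norm_of_nonneg ht.1.le]
  linarith [ht.2]

/-- The differentiated product vanishes at `t = 0` when `a` is a zero, and at infinity always. A
real or imaginary part of its derivative with constant sign must therefore vanish identically for `t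
> 0`. -/
theorem hasDerivAt_airy_energy (a : ℂ) (t : ℝ) :
    HasDerivAt (fun t : ℝ => -deriv airyEntire (a - t) * (starRingEnd ℂ) (airyEntire (a - t)))
      ((t - a) / 3 * (‖airyEntire (a - t)‖ ^ 2 : ℝ) + (‖deriv airyEntire (a - t)‖ ^ 2 : ℝ)) t := by
  have hl : HasDerivAt (fun t : ℝ => a - (t : ℂ)) (-1) t := by
    simpa using (Complex.ofRealCLM.hasDerivAt (x := t)).const_sub a
  have h1 : HasDerivAt (fun t : ℝ => deriv airyEntire (a - t))
      (deriv (deriv airyEntire) (a - t) * (-1)) t :=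
    HasDerivAt.comp (h₂ := deriv airyEntire) t
      (differentiable_airyEntire.deriv (a - t)).hasDerivAt hl
  have h2 : HasDerivAt (fun t : ℝ => airyEntire (a - t)) (deriv airyEntire (a - t) * (-1)) t :=
    HasDerivAt.comp (h₂ := airyEntire) t (differentiable_airyEntire (a - t)).hasDerivAt hl
  refine (h1.neg.mul h2.star).congr_deriv ?_
  rw [deriv_deriv_airyEntire]
  push_cast
  rw [← Complex.mul_conj', ← Complex.mul_conj']
  simp only [Complex.star_def, map_mul, map_neg, map_one, Pi.neg_apply]
  ring

theorem tendsto_airy_energy (a : ℂ) :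
    Tendsto (fun t : ℝ => -deriv airyEntire (a - t) * (starRingEnd ℂ) (airyEntire (a - t)))
      atTop (𝓝 0) := by
  have h := (tendsto_deriv_airyEntire a).neg.mul
    ((Complex.continuous_conj.tendsto _).comp (tendsto_airyEntire a))
  simpa using h

theorem airyEntire_zero_im {a : ℂ} (ha : airyEntire a = 0) : a.im = 0 := by
  obtain ⟨t, ht, hne⟩ := exists_airyEntire_ne_zero a
  have hpos : 0 < ‖airyEntire (a - t)‖ ^ 2 := by positivity
  have him : ∀ t : ℝ, ((t - a) / 3 * (‖airyEntire (a - t)‖ ^ 2 : ℝ) +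
      (‖deriv airyEntire (a - t)‖ ^ 2 : ℝ)).im = -(a.im / 3) * ‖airyEntire (a - t)‖ ^ 2 := by
    intro t
    rw [Complex.add_im, Complex.ofReal_im, Complex.im_mul_ofReal]
    simp
    ring
  -- The imaginary part of the energy derivative is `-(Im a / 3)|g|²`; the sign `σ = ±1` makes it
  -- nonnegative in either half-plane.
  have h1 : ∀ σ : ℝ, (∀ t : ℝ, 0 ≤ σ * (-(a.im / 3))) → σ ≠ 0 → a.im = 0 := by
    intro σ hσ hσ0
    have := deriv_eq_zero_of_tendsto_zero
      (f := fun t : ℝ =>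
        σ * (-deriv airyEntire (a - t) * (starRingEnd ℂ) (airyEntire (a - t))).im)
      (f' := fun t => σ * (-(a.im / 3) * ‖airyEntire (a - t)‖ ^ 2))
      (fun t => by
        rw [← him]
        exact ((Complex.imCLM.hasFDerivAt.comp_hasDerivAt t
          (hasDerivAt_airy_energy a t))).const_mul σ)
      (fun t _ => by
        rw [← mul_assoc]
        exact mul_nonneg (hσ t) (sq_nonneg _))
      (by simp [ha])
      (by simpa using (((Complex.continuous_im.tendsto _).comp (tendsto_airy_energy a)).const_mul σ))
      ht
    have h2 := (mul_eq_zero.mp this).resolve_left hσ0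
    have h3 := (mul_eq_zero.mp h2).resolve_right hpos.ne'
    linarith
  rcases le_total a.im 0 with h | h
  · exact h1 1 (fun _ => by linarith) one_ne_zero
  · exact h1 (-1) (fun _ => by linarith) (by norm_num)

/-- For `x ≤ 0` both terms of the real energy derivative are nonnegative when `t > 0`, and the first
is positive somewhere. -/
theorem airyEntire_zero_pos {x : ℝ} (hx : airyEntire x = 0) : 0 < x := by
  by_contra hx0
  obtain ⟨t, ht, hne⟩ := exists_airyEntire_ne_zero x
  have hpos : 0 < ‖airyEntire (x - t)‖ ^ 2 := by positivity
  have hre : ∀ t : ℝ, ((t - x) / 3 * (‖airyEntire (x - t)‖ ^ 2 : ℝ) +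
      (‖deriv airyEntire (x - t)‖ ^ 2 : ℝ) : ℂ).re =
      (t - x) / 3 * ‖airyEntire (x - t)‖ ^ 2 + ‖deriv airyEntire (x - t)‖ ^ 2 := by
    intro t
    rw [Complex.add_re, Complex.ofReal_re, Complex.re_mul_ofReal]
    simp
  have := deriv_eq_zero_of_tendsto_zero
    (f := fun t : ℝ => (-deriv airyEntire (x - t) * (starRingEnd ℂ) (airyEntire (x - t))).re)
    (f' := fun t => (t - x) / 3 * ‖airyEntire (x - t)‖ ^ 2 + ‖deriv airyEntire (x - t)‖ ^ 2)
    (fun t => by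
      rw [← hre]
      exact Complex.reCLM.hasFDerivAt.comp_hasDerivAt t (hasDerivAt_airy_energy x t))
    (fun t ht => by
      have : 0 ≤ (t - x) / 3 := by linarith
      positivity)
    (by simp [hx])
    ((Complex.continuous_re.tendsto' 0 0 Complex.zero_re).comp (tendsto_airy_energy x))
    ht
  have h1 : 0 < (t - x) / 3 := by linarith
  have h2 := mul_pos h1 hpos
  have h3 := sq_nonneg ‖deriv airyEntire (x - t)‖
  linarith

/-- At a zero of order `m + 2`, `g''` would have order `m`, but `g'' = -(z/3) g` has order at least
`m + 2`. -/
theorem analyticOrderNatAt_airyEntire {a : ℂ} (ha : airyEntire a = 0) :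
    analyticOrderNatAt airyEntire a = 1 := by
  have hA := differentiable_airyEntire.analyticAt a
  have hA' := differentiable_airyEntire.deriv.analyticAt a
  obtain ⟨n, hn⟩ := ENat.ne_top_iff_exists.mp
    (analyticOrderAt_ne_top_of_entire differentiable_airyEntire airyEntire_zero_ne a)
  have hn0 : n ≠ 0 := by
    rintro rfl
    exact (analyticOrderAt_ne_zero.mpr ⟨hA, ha⟩) hn.symm
  rw [analyticOrderNatAt, ← hn, ENat.toNat_natCast]
  by_contra hn1
  obtain ⟨m, rfl⟩ : ∃ m, n = m + 2 := ⟨n - 2, by omega⟩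
  have h1 : analyticOrderAt (deriv airyEntire) a = ((m + 1 : ℕ) : ℕ∞) :=
    analyticOrderAt_deriv_of_pos hA (by rw [← hn]; push_cast; ring)
  have h2 : analyticOrderAt (deriv (deriv airyEntire)) a = (m : ℕ∞) :=
    analyticOrderAt_deriv_of_pos hA' (by rw [h1]; push_cast; ring)
  have h3 : deriv (deriv airyEntire) = (fun z => -(z / 3)) * airyEntire :=
    funext deriv_deriv_airyEntire
  rw [h3, analyticOrderAt_mul (by fun_prop) hA, ← hn] at h2
  have h4 : ((m + 2 : ℕ) : ℕ∞) ≤ (m : ℕ∞) := by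
    rw [← h2]
    exact le_add_self
  have := ENat.natCast_le_natCast.mp h4
  omega

theorem norm_airyEntire_le_exp {ε : ℝ} (hε : 0 < ε) :
    ∃ C, ∀ z, ‖airyEntire z‖ ≤ C * Real.exp (ε * ‖z‖ ^ 2) := by
  obtain ⟨C, hC⟩ := airyMeasure_hasGaussianTails.norm_laplaceTr_le_exp hε
  have hn : ‖zeta3‖ = 1 := by
    have : ‖zeta3‖ ^ 3 = 1 := by rw [← norm_pow, zeta3_cube, norm_one]
    exact (pow_eq_one_iff_of_nonneg (norm_nonneg _) (by norm_num)).mp this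
  refine ⟨‖(2 * I)⁻¹‖ * (C + C), fun z => ?_⟩
  have h1 := hC (-zeta3 * z)
  have h2 := hC (-zeta3 ^ 2 * z)
  rw [norm_mul, norm_neg, hn, one_mul] at h1
  rw [norm_mul, norm_neg, norm_pow, hn, one_pow, one_mul] at h2
  rw [airyEntire, norm_mul, mul_assoc]
  refine mul_le_mul_of_nonneg_left ((norm_sub_le _ _).trans ?_) (norm_nonneg _)
  rw [norm_mul, norm_mul, norm_pow, hn, one_pow, one_mul, one_mul, add_mul]
  exact add_le_add h1 h2

theorem ascPochhammer_eval_mem {K S : Type*} [Field K] [SetLike S K] [SubfieldClass S K] {F : S}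
    {a : K} (ha : a ∈ F) (n : ℕ) : (ascPochhammer K n).eval a ∈ F := by
  induction n with
  | zero => simp
  | succ n ih =>
    rw [ascPochhammer_succ_eval]
    exact mul_mem ih (add_mem ha (natCast_mem F n))

/-- Recurrence reduces each Gamma value to `Γ(1/3)` or `Γ(2/3)`, and reflection expresses the latter
through `√3`, `π` and `Γ(1/3)`. -/
theorem airyCoeff_mem (k : ℕ) :
    airyCoeff k ∈ IntermediateField.adjoin ℚ ({√3, π, Real.Gamma (1 / 3)} : Set ℝ) := by
  set F := IntermediateField.adjoin ℚ ({√3, π, Real.Gamma (1 / 3)} : Set ℝ)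
  have hsub := IntermediateField.subset_adjoin ℚ ({√3, π, Real.Gamma (1 / 3)} : Set ℝ)
  have h3 : √3 ∈ F := hsub (by simp)
  have hpi : π ∈ F := hsub (by simp)
  have hG : Real.Gamma (1 / 3) ∈ F := hsub (by simp)
  have hnat : ∀ n : ℕ, (n : ℝ) ∈ F := natCast_mem F
  have hof : ∀ n : ℕ, [n.AtLeastTwo] → (OfNat.ofNat n : ℝ) ∈ F := fun n _ => by
    rw [← Nat.cast_ofNat]; exact hnat _
  have hG2 : Real.Gamma (2 / 3) ∈ F := by
    have h0 : Real.Gamma (1 / 3) ≠ 0 := (Real.Gamma_pos_of_pos (by norm_num)).ne'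
    rw [show Real.Gamma (2 / 3) = 2 * π / √3 / Real.Gamma (1 / 3) by
      rw [← Gamma_third_mul]; field_simp]
    exact div_mem (div_mem (mul_mem (hof 2) hpi) h3) hG
  have hcase : (if k % 3 = 0 then (1 : ℝ) else if k % 3 = 1 then -1 else 0) *
      Real.Gamma ((k + 1) / 3) ∈ F := by
    have hk := Nat.div_add_mod k 3
    split_ifs with h h'
    · have : ((k : ℝ) + 1) / 3 = (k / 3 : ℕ) + 1 / 3 := by
        rw [h, add_zero] at hk
        nth_rw 1 [← hk]
        push_cast
        ring
      rw [one_mul, this, Gamma_natCast_add (by norm_num)]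
      exact mul_mem (ascPochhammer_eval_mem (div_mem (one_mem F) (hof 3)) _) hG
    · have : ((k : ℝ) + 1) / 3 = (k / 3 : ℕ) + 2 / 3 := by
        rw [h'] at hk
        nth_rw 1 [← hk]
        push_cast
        ring
      rw [this, Gamma_natCast_add (by norm_num), neg_one_mul]
      exact neg_mem (mul_mem (ascPochhammer_eval_mem (div_mem (hof 2) (hof 3)) _) hG2)
    · rw [zero_mul]
      exact zero_mem F
  have : airyCoeff k = √3 / 6 * (-1) ^ k * ((if k % 3 = 0 then (1 : ℝ) else
      if k % 3 = 1 then -1 else 0) * Real.Gamma ((k + 1) / 3)) / k.factorial := by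
    rw [airyCoeff]; ring
  rw [this]
  exact div_mem (mul_mem (mul_mem (div_mem h3 (hof 6)) (pow_mem (neg_mem (one_mem F)) k)) hcase)
    (hnat _)

theorem exists_airy {n : ℕ} (hn : 1 ≤ n) :
    ∃ S ∈ IntermediateField.adjoin ℚ {√3, π, Real.Gamma (1 / 3)},
      HasSum (fun x : {x : ℝ // 0 < x ∧ airyA x = 0} => 1 / (x : ℝ) ^ (2 * n)) S := by
  obtain ⟨s, hs⟩ := NewtonRel.exists_of_ne_zero (c := airyCoeff) airyCoeff_zero_pos.ne'
  obtain ⟨m, hm⟩ : ∃ m, 2 * n = m + 1 := ⟨2 * n - 1, by omega⟩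
  refine ⟨s (2 * n), by
    rw [hm]
    exact hs.mem_subfield airyCoeff_zero_pos.ne' m fun i _ => airyCoeff_mem i, ?_⟩
  have hs' : NewtonRel (fun k => PowerSeries.coeff k (taylorPS airyEntire))
      (fun k => (s k : ℂ)) := by
    have h1 := hs.map Complex.ofRealHom
    have h2 : (fun k => PowerSeries.coeff k (taylorPS airyEntire)) =
        fun k => Complex.ofRealHom (airyCoeff k) := funext airyEntire_coeff
    rw [h2]
    exact h1
  have hA : ∀ x : ℝ, airyEntire x = (airyA x : ℂ) := fun x => by rw [airyEntire_ofReal, airyA_eq]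
  have hpow : ∀ x : ℝ, (x : ℂ)⁻¹ ^ (2 * n) = ((1 / x ^ (2 * n) : ℝ) : ℂ) := fun x => by
    push_cast
    rw [inv_pow, one_div]
  have := hasSum_zeros differentiable_airyEntire airyEntire_zero_ne hs' (k := 2 * n) (d := 2)
    (by omega) (by omega) (fun ε hε => norm_airyEntire_le_exp hε)
    (e := fun x : {x : ℝ // 0 < x ∧ airyA x = 0} => ((x : ℝ) : ℂ))
    (Complex.ofReal_injective.comp Subtype.val_injective) (fun z => by
      constructor
      · intro hz
        obtain ⟨x, rfl⟩ : ∃ x : ℝ, z = x :=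
          ⟨z.re, Complex.ext rfl (by simpa using airyEntire_zero_im hz)⟩
        refine ⟨⟨x, airyEntire_zero_pos hz, ?_⟩, rfl⟩
        rw [hA] at hz
        exact_mod_cast hz
      · rintro ⟨x, rfl⟩
        rw [hA, x.2.2, Complex.ofReal_zero]) (R₀ := 0) (fun x _ => by
      have h1 : 0 ≤ 1 / (x : ℝ) ^ (2 * n) := by
        have := x.2.1
        positivity
      rw [hpow, Complex.norm_real, Complex.ofReal_re, Real.norm_eq_abs, abs_of_nonneg h1]
      linarith)
  rw [← Complex.hasSum_ofReal]
  refine this.congr_fun fun x => ?_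
  rw [analyticOrderNatAt_airyEntire (by rw [hA, x.2.2, Complex.ofReal_zero]), hpow]
  simp

/-! ### Even entire Fourier transforms with zeros in a strip -/

theorem norm_pow_sub_pow_le {a b : ℂ} {r : ℝ} (ha : ‖a‖ ≤ r) (hb : ‖b‖ ≤ r) (k : ℕ) :
    ‖a ^ (k + 1) - b ^ (k + 1)‖ ≤ (k + 1) * ‖a - b‖ * r ^ k := by
  have hr : 0 ≤ r := (norm_nonneg a).trans ha
  induction k with
  | zero => simp
  | succ k ih =>
    have h1 : a ^ (k + 1 + 1) - b ^ (k + 1 + 1) =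
        a * (a ^ (k + 1) - b ^ (k + 1)) + (a - b) * b ^ (k + 1) := by ring
    rw [h1]
    refine (norm_add_le _ _).trans ?_
    rw [norm_mul, norm_mul, norm_pow b]
    have h2 : ‖b‖ ^ (k + 1) ≤ r ^ (k + 1) := by gcongr
    calc ‖a‖ * ‖a ^ (k + 1) - b ^ (k + 1)‖ + ‖a - b‖ * ‖b‖ ^ (k + 1)
        ≤ r * ((k + 1) * ‖a - b‖ * r ^ k) + ‖a - b‖ * r ^ (k + 1) := by gcongr
      _ = _ := by push_cast; ring

/-- Large points of the strip `|Im ρ| ≤ 1/2` have even powers close to the positive real axis. -/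
theorem norm_inv_pow_le_two_mul_re {ρ : ℂ} (him : |ρ.im| ≤ 1 / 2) {n : ℕ} (hn : 1 ≤ n)
    (hρ : (4 * n : ℝ) < ‖ρ‖) : ‖ρ⁻¹ ^ (2 * n)‖ ≤ 2 * (ρ⁻¹ ^ (2 * n)).re := by
  obtain ⟨m, hm⟩ : ∃ m, 2 * n = m + 1 := ⟨2 * n - 1, by omega⟩
  have hn1 : (1 : ℝ) ≤ n := by exact_mod_cast hn
  have hρ0 : 0 < ‖ρ‖ := by linarith
  have h1 := norm_pow_sub_pow_le (a := ρ) (b := (ρ.re : ℂ)) le_rfl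
    (by rw [Complex.norm_real]; exact Complex.abs_re_le_norm ρ) m
  rw [← hm] at h1
  have h2 : ‖ρ - ρ.re‖ ≤ 1 / 2 := by
    have : ρ - ρ.re = ρ.im * I := by
      nth_rw 1 [← Complex.re_add_im ρ]
      ring
    rw [this, norm_mul, Complex.norm_I, mul_one, Complex.norm_real]
    exact him
  have hmn : (m : ℝ) + 1 = 2 * n := by exact_mod_cast hm.symm
  rw [hmn] at h1
  have h3 : ‖ρ ^ (2 * n) - (ρ.re : ℂ) ^ (2 * n)‖ ≤ ‖ρ‖ ^ (2 * n) / 4 := by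
    refine h1.trans ?_
    have h4 : ‖ρ‖ ^ (2 * n) = ‖ρ‖ ^ m * ‖ρ‖ := by rw [hm, pow_succ]
    rw [h4]
    -- Replacing `ρ` by its real part costs at most `2n · (1/2) · |ρ|^(2n-1)`, which is below
    -- `|ρ|^(2n) / 4` once `|ρ| > 4n`.
    have h5 : 2 * (n : ℝ) * ‖ρ - ρ.re‖ ≤ ‖ρ‖ / 4 := by nlinarith
    calc 2 * (n : ℝ) * ‖ρ - ρ.re‖ * ‖ρ‖ ^ m ≤ ‖ρ‖ / 4 * ‖ρ‖ ^ m := by gcongr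
      _ = _ := by ring
  have h6 : ((ρ.re : ℂ) ^ (2 * n)) = ((ρ.re ^ (2 * n) : ℝ) : ℂ) := by push_cast; rfl
  have h7 : 0 ≤ ρ.re ^ (2 * n) := (even_two_mul n).pow_nonneg _
  rw [h6] at h3
  have h8 : ‖ρ ^ (2 * n)‖ ≤ ρ.re ^ (2 * n) + ‖ρ‖ ^ (2 * n) / 4 := by
    have := norm_le_norm_add_norm_sub' (ρ ^ (2 * n)) ((ρ.re ^ (2 * n) : ℝ) : ℂ)
    rw [Complex.norm_real, Real.norm_of_nonneg h7] at this
    linarith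
  have h9 : ρ.re ^ (2 * n) - (ρ ^ (2 * n)).re ≤ ‖ρ‖ ^ (2 * n) / 4 := by
    have := (neg_le_abs _).trans (Complex.abs_re_le_norm (ρ ^ (2 * n) - ((ρ.re ^ (2 * n) : ℝ) : ℂ)))
    rw [Complex.sub_re, Complex.ofReal_re] at this
    linarith
  rw [norm_pow] at h8
  have h10 : ‖ρ‖ ^ (2 * n) ≤ 2 * (ρ ^ (2 * n)).re := by linarith
  have h11 : 0 < ‖ρ‖ ^ (2 * n) := by positivity
  rw [inv_pow, norm_inv, Complex.inv_re, Complex.normSq_eq_norm_sq, norm_pow, ← mul_div_assoc,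
    le_div_iff₀ (by positivity)]
  have : (‖ρ‖ ^ (2 * n))⁻¹ * (‖ρ‖ ^ (2 * n)) ^ 2 = ‖ρ‖ ^ (2 * n) := by field_simp
  rw [this]
  exact h10

theorem analyticOrderNatAt_neg {g : ℂ → ℂ} (hg : ∀ z, g (-z) = g z) (z : ℂ) :
    analyticOrderNatAt g (-z) = analyticOrderNatAt g z := by
  have h1 : analyticOrderAt (g ∘ fun w => -w) z = analyticOrderAt g (-z) := by
    refine analyticOrderAt_comp_of_deriv_ne_zero (by fun_prop) ?_
    rw [deriv_neg]
    exact neg_ne_zero.mpr one_ne_zero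
  have h2 : (g ∘ fun w => -w) = g := funext hg
  rw [h2] at h1
  rw [analyticOrderNatAt, analyticOrderNatAt, h1]

/-- For an even function, sums over the zeros are twice the sums over the zeros with positive real
part. -/
theorem HasSum.half_of_even {P : ℂ → Prop} (hP : ∀ z, P (-z) ↔ P z)
    (hre : ∀ z, P z → z.re ≠ 0) {f : ℂ → ℂ} (hf : ∀ z, f (-z) = f z) {S : ℂ}
    (h : HasSum (fun z : {z // P z} => f z) S) :
    HasSum (fun z : {z : ℂ // 0 < z.re ∧ P z} => f z) (S / 2) := by
  -- No zero is on the imaginary axis, so the zeros split into the right half and its negative.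
  let φ : {z : ℂ // 0 < z.re ∧ P z} ⊕ {z : ℂ // 0 < z.re ∧ P z} → {z // P z} :=
    Sum.elim (fun z => ⟨z, z.2.2⟩) (fun z => ⟨-z, (hP _).mpr z.2.2⟩)
  have hφ : Function.Bijective φ := by
    constructor
    · rintro (⟨z, hz, hz'⟩ | ⟨z, hz, hz'⟩) (⟨w, hw, hw'⟩ | ⟨w, hw, hw'⟩) hzw
      · simpa [φ] using hzw
      · have : z = -w := by simpa [φ] using hzw
        rw [this] at hz
        simp at hz
        linarith
      · have : -z = w := by simpa [φ] using hzw
        rw [← this] at hw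
        simp at hw
        linarith
      · simpa [φ] using hzw
    · rintro ⟨z, hz⟩
      rcases lt_or_gt_of_ne (hre z hz) with h0 | h0
      · exact ⟨Sum.inr ⟨-z, by simpa using h0, (hP z).mpr hz⟩, by simp [φ]⟩
      · exact ⟨Sum.inl ⟨z, h0, hz⟩, rfl⟩
  have h1 : HasSum ((fun z : {z // P z} => f z) ∘ φ) S :=
    (Equiv.ofBijective φ hφ).hasSum_iff.mpr h
  have h2 : Summable fun z : {z : ℂ // 0 < z.re ∧ P z} => f z :=
    h1.summable.comp_injective Sum.inl_injective
  have h3 := HasSum.sum (f := (fun z : {z // P z} => f z) ∘ φ) h2.hasSum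
    (h2.hasSum.congr_fun fun z => by simp [φ, hf])
  rw [h1.unique h3, add_self_div_two]
  exact h2.hasSum

/-- Power sums of the zeros of an even function `X(z) = c ∫ exp (-i z x) dμ(x)` with zeros in the
strip `|Im z| ≤ 1/2`. -/
theorem HasGaussianTails.exists_hasSum_zeros {μ : Measure ℝ} (h : HasGaussianTails μ)
    (hμ : ∫ x, x ^ 0 ∂μ ≠ 0) {X : ℂ → ℂ} {c : ℂ} (hc : c ≠ 0)
    (hX : ∀ z, X z = c * laplaceTr μ (-I * z)) (heven : ∀ z, X (-z) = X z)
    (hstrip : ∀ z, X z = 0 → |z.im| ≤ 1 / 2) {n : ℕ} (hn : 1 ≤ n) :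
    ∃ S ∈ IntermediateField.adjoin ℚ {w : ℂ | ∃ j : ℕ, 1 ≤ j ∧ j ≤ n ∧
        w = (((∫ x, x ^ (2 * j) ∂μ) / ∫ x, x ^ 0 ∂μ : ℝ) : ℂ)},
      HasSum (fun z : {z : ℂ // 0 < z.re ∧ X z = 0} =>
        (analyticOrderNatAt X z : ℂ) * (1 / (z : ℂ) ^ (2 * n))) S := by
  set F := IntermediateField.adjoin ℚ {w : ℂ | ∃ j : ℕ, 1 ≤ j ∧ j ≤ n ∧
        w = (((∫ x, x ^ (2 * j) ∂μ) / ∫ x, x ^ 0 ∂μ : ℝ) : ℂ)} with hF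
  have hX' : X = fun z => c * laplaceTr μ (-I * z) := funext hX
  have hdiff : Differentiable ℂ X := by
    have h1 : Differentiable ℂ fun z => laplaceTr μ (-I * z) :=
      h.differentiable_laplaceTr.comp (by fun_prop)
    rw [hX']
    fun_prop
  set m : ℕ → ℂ := fun k => ((∫ x, x ^ k ∂μ : ℝ) : ℂ) with hm
  have hm0 : m 0 ≠ 0 := Complex.ofReal_ne_zero.mpr hμ
  have hsum : ∀ z, HasSum (fun k => c * (-I) ^ k * m k / k.factorial * z ^ k) (X z) := fun z => by
    rw [hX]
    refine ((hasSum_taylorPS h.differentiable_laplaceTr (-I * z)).mul_left c).congr_fun fun k => ?_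
    rw [h.coeff_taylorPS_laplaceTr, mul_pow]
    ring
  have hcoeff := coeff_taylorPS_of_hasSum one_pos fun z _ => hsum z
  -- Evenness of `X` gives two expansions of the same function; comparing them kills the odd
  -- moments.
  have hodd : ∀ k, Odd k → m k = 0 := fun k hk => by
    have h1 := coeff_taylorPS_of_hasSum (f := X)
      (c := fun k => (-1) ^ k * (c * (-I) ^ k * m k / k.factorial)) one_pos (fun z _ => by
        rw [← heven]
        refine (hsum (-z)).congr_fun fun k => ?_
        rw [neg_pow z]
        ring) k
    rw [hcoeff, hk.neg_one_pow] at h1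
    have h2 : c * (-I) ^ k * m k / k.factorial = 0 := by linear_combination h1 / 2
    have h3 : (k.factorial : ℂ) ≠ 0 := Nat.cast_ne_zero.mpr k.factorial_ne_zero
    simpa [hc, h3] using h2
  have hne : NeZero μ := ⟨by rintro rfl; simp at hμ⟩
  have hX0 : X 0 ≠ 0 := by
    have h1 := hcoeff 0
    rw [coeff_taylorPS] at h1
    simp only [iteratedDeriv_zero, Nat.factorial_zero, Nat.cast_one, div_one, pow_zero,
      mul_one] at h1
    rw [h1]
    exact mul_ne_zero hc hm0
  -- On the imaginary axis `X` is `c` times the integral of a positive function.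
  have hre : ∀ z, X z = 0 → z.re ≠ 0 := fun z hz h0 => by
    have h1 : z = I * z.im := by
      apply Complex.ext <;> simp [h0]
    rw [hX, h1, show -I * (I * z.im) = z.im by linear_combination -(z.im : ℂ) * I_sq] at hz
    have h2 := (mul_eq_zero.mp hz).resolve_left hc
    have h3 : laplaceTr μ z.im = ((∫ x, Real.exp (z.im * x) ∂μ : ℝ) : ℂ) := by
      rw [laplaceTr, ← integral_complex_ofReal]
      simp only [Complex.ofReal_exp, Complex.ofReal_mul]
    rw [h3, Complex.ofReal_eq_zero] at h2
    refine (integral_exp_pos ?_).ne' h2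
    have h4 := (h.integrable_pow_mul_exp 0 z.im).norm
    refine h4.congr (Eventually.of_forall fun x => ?_)
    simp only [pow_zero, one_mul]
    rw [Complex.norm_exp, Complex.re_ofReal_mul, Complex.ofReal_re]
  have hcne : (fun k => PowerSeries.coeff k (taylorPS X)) 0 ≠ 0 := by
    simp only [hcoeff]
    simpa using ⟨hc, hm0⟩
  obtain ⟨s, hs⟩ := NewtonRel.exists_of_ne_zero
    (c := fun k => PowerSeries.coeff k (taylorPS X)) hcne
  -- Scaling to constant term `1` does not change the Newton sums; the coefficients become moment
  -- ratios up to rational factors, up to index `2n` only.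
  have hsF : s (2 * n) ∈ F := by
    obtain ⟨l, hl⟩ : ∃ l, 2 * n = l + 1 := ⟨2 * n - 1, by omega⟩
    have h1 := hs.smul (c * m 0)⁻¹
    have h2 : ∀ k, (c * m 0)⁻¹ * PowerSeries.coeff k (taylorPS X) =
        (-I) ^ k * (m k / m 0) / k.factorial := fun k => by
      rw [hcoeff]
      field_simp
    rw [hl]
    refine h1.mem_subfield ?_ l fun i hi => ?_
    · rw [h2]
      simp [hm0]
    · rw [h2]
      rcases Nat.even_or_odd i with hi2 | hi2
      · obtain ⟨j, rfl⟩ := even_iff_two_dvd.mp hi2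
        rw [pow_mul, neg_sq, I_sq]
        refine div_mem (mul_mem (pow_mem (neg_mem (one_mem F)) j) ?_) (natCast_mem F _)
        rcases Nat.eq_zero_or_pos j with rfl | hj
        · rw [mul_zero, div_self hm0]
          exact one_mem F
        · refine IntermediateField.subset_adjoin ℚ _ ⟨j, hj, by omega, ?_⟩
          rw [Complex.ofReal_div]
      · rw [hodd i hi2]
        simp only [zero_div, mul_zero]
        exact zero_mem F
  refine ⟨s (2 * n) / 2, div_mem hsF (by exact_mod_cast natCast_mem F 2), ?_⟩
  have hz := hasSum_zeros hdiff hX0 hs (k := 2 * n) (d := 2) (by omega) (by omega)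
    (fun ε hε => by
      obtain ⟨C, hC⟩ := h.norm_laplaceTr_le_exp hε
      refine ⟨‖c‖ * C, fun z => ?_⟩
      have := hC (-I * z)
      rw [norm_mul, norm_neg, Complex.norm_I, one_mul] at this
      rw [hX, norm_mul, mul_assoc]
      exact mul_le_mul_of_nonneg_left this (norm_nonneg _))
    (e := fun z : {z // X z = 0} => (z : ℂ)) Subtype.val_injective
    (fun z => ⟨fun hz => ⟨⟨z, hz⟩, rfl⟩, by rintro ⟨z, rfl⟩; exact z.2⟩) (R₀ := 4 * n)
    (fun z hz => norm_inv_pow_le_two_mul_re (hstrip z z.2) hn hz)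
  have := HasSum.half_of_even (P := fun z => X z = 0)
    (f := fun z => (analyticOrderNatAt X z : ℂ) * z⁻¹ ^ (2 * n)) (fun z => by rw [heven]) hre
    (fun z => by rw [analyticOrderNatAt_neg heven, inv_neg, (even_two_mul n).neg_pow]) hz
  refine this.congr_fun fun z => ?_
  rw [inv_pow, one_div]

/-! ### Densities with doubly exponential decay -/

theorem isBigO_exp_sq_mul (K b : ℝ) {a : ℝ} (ha : 0 < a) :
    (fun t : ℝ => Real.exp (K * t ^ 2) * Real.exp (b * t - a * Real.exp (2 * t))) =O[atTop]
      fun t => Real.exp (-t) := by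
  have h1 : (fun t : ℝ => K * t ^ 2 + (b + 1) * t ^ 1) =o[atTop] fun t => Real.exp (2 * t) :=
    ((isLittleO_pow_exp_pos_mul_atTop 2 two_pos).const_mul_left K).add
      ((isLittleO_pow_exp_pos_mul_atTop 1 two_pos).const_mul_left (b + 1))
  refine Asymptotics.IsBigO.of_bound 1 ?_
  filter_upwards [h1.bound ha] with t ht
  rw [Real.norm_of_nonneg (Real.exp_nonneg (2 * t))] at ht
  rw [← Real.exp_add, Real.norm_of_nonneg (Real.exp_nonneg _),
    Real.norm_of_nonneg (Real.exp_nonneg _), one_mul]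
  refine Real.exp_le_exp.mpr ?_
  have := (le_abs_self _).trans ht
  linarith

/-- Doubly exponential decay at both ends beats `exp(K t²)` for every `K`. -/
theorem hasGaussianTails_densityMeasure {ρ : ℝ → ℝ} (hρ : Continuous ρ) (h0 : ∀ t, 0 ≤ ρ t)
    {a b : ℝ} (ha : 0 < a)
    (hT : ρ =O[atTop] fun t => Real.exp (b * t - a * Real.exp (2 * t)))
    (hB : (fun t => ρ (-t)) =O[atTop] fun t => Real.exp (b * t - a * Real.exp (2 * t))) :
    HasGaussianTails (densityMeasure ρ Set.univ) := by
  intro K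
  rw [integrable_densityMeasure hρ.measurable h0, integrableOn_univ]
  have hT' : (fun t => ρ t • Real.exp (K * t ^ 2)) =O[atTop] fun t => Real.exp (-t) := by
    refine Asymptotics.IsBigO.trans ?_ (isBigO_exp_sq_mul K b ha)
    refine ((Asymptotics.isBigO_refl (fun t : ℝ => Real.exp (K * t ^ 2)) atTop).mul hT).congr_left
      fun t => by rw [smul_eq_mul, mul_comm]
  have hB' : (fun t => ρ t • Real.exp (K * t ^ 2)) =O[atBot] fun t => Real.exp t := by
    have h1 : (fun t => ρ (-t) • Real.exp (K * (-t) ^ 2)) =O[atTop] fun t => Real.exp (-t) := by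
      refine Asymptotics.IsBigO.trans ?_ (isBigO_exp_sq_mul K b ha)
      refine ((Asymptotics.isBigO_refl (fun t : ℝ => Real.exp (K * t ^ 2)) atTop).mul
        hB).congr_left fun t => by rw [smul_eq_mul, mul_comm, neg_sq]
    refine (h1.comp_tendsto tendsto_neg_atBot_atTop).congr (fun t => ?_) fun t => ?_ <;>
      simp
  have hc : Continuous fun t => ρ t • Real.exp (K * t ^ 2) := by fun_prop
  refine hc.locallyIntegrable.integrable_of_isBigO_atBot_atTop hB' ?_ hT' ?_
  · exact ⟨Set.Iic 0, Iic_mem_atBot 0, integrableOn_exp_Iic 0⟩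
  · exact ⟨Set.Ioi 0, Ioi_mem_atTop 0, integrableOn_exp_neg_Ioi 0⟩

/-- The substitution `u = exp(-2t)`, with `du = -2u dt`, turns Fourier integrals into Mellin
transforms and accounts for the factor `1/2`. -/
theorem integral_exp_mul_comp_exp (f : ℝ → ℂ) (w : ℂ) :
    ∫ t : ℝ, Complex.exp (-2 * w * t) * f (Real.exp (-2 * t)) = mellin f w / 2 := by
  have himg : (fun t : ℝ => Real.exp (-2 * t)) '' Set.univ = Set.Ioi 0 := by
    ext u
    constructor
    · rintro ⟨t, _, rfl⟩
      exact Real.exp_pos _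
    · intro hu
      refine ⟨Real.log u / -2, trivial, ?_⟩
      simp only
      rw [mul_div_cancel₀ _ (by norm_num), Real.exp_log hu]
  have hd : ∀ t ∈ (Set.univ : Set ℝ), HasDerivWithinAt (fun t : ℝ => Real.exp (-2 * t))
      (-2 * Real.exp (-2 * t)) Set.univ t := fun t _ => by
    have := ((hasDerivAt_id t).const_mul (-2)).exp
    refine (this.congr_deriv ?_).hasDerivWithinAt
    simp [mul_comm]
  have hinj : Set.InjOn (fun t : ℝ => Real.exp (-2 * t)) Set.univ := fun x _ y _ h => by
    have := Real.exp_injective h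
    linarith
  rw [mellin, ← himg, integral_image_eq_integral_abs_deriv_smul MeasurableSet.univ hd hinj,
    setIntegral_univ, ← integral_div]
  refine integral_congr_ae (Eventually.of_forall fun t => ?_)
  have h1 : |-2 * Real.exp (-2 * t)| = 2 * Real.exp (-2 * t) := by
    rw [abs_mul, abs_of_pos (Real.exp_pos _)]
    norm_num
  have h2 : ((Real.exp (-2 * t) : ℝ) : ℂ) ^ (w - 1) = Complex.exp (-2 * t * (w - 1)) := by
    rw [Complex.cpow_def_of_ne_zero (by exact_mod_cast (Real.exp_pos _).ne'),
      ← Complex.ofReal_log (Real.exp_pos _).le, Real.log_exp]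
    push_cast
    rfl
  simp only [h1, h2, Complex.real_smul, smul_eq_mul]
  push_cast
  have h3 : Complex.exp (-2 * w * t) = Complex.exp (-2 * t) * Complex.exp (-2 * t * (w - 1)) := by
    rw [← Complex.exp_add]
    ring_nf
  rw [h3]
  ring

/-- Zero total mass would make the measure, and with it the transform, vanish. -/
theorem HasGaussianTails.integral_pow_zero_ne_zero {μ : Measure ℝ} (h : HasGaussianTails μ)
    {z : ℂ} (hz : laplaceTr μ z ≠ 0) : ∫ x, x ^ 0 ∂μ ≠ 0 := by
  intro h0
  have h1 := (integral_eq_zero_iff_of_nonneg (fun x => by simp) (h.integrable_pow 0)).mp h0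
  have h2 : μ = 0 := by
    rw [← ae_eq_bot, ← Filter.eventually_false_iff_eq_bot]
    filter_upwards [h1] with x hx
    simp at hx
  apply hz
  rw [laplaceTr, h2, integral_zero_measure]

theorem eq_of_eqOn_im_lt {f g : ℂ → ℂ} (hf : Differentiable ℂ f) (hg : Differentiable ℂ g)
    {r : ℝ} (h : ∀ z : ℂ, z.im < r → f z = g z) : f = g := by
  refine AnalyticOnNhd.eq_of_eventuallyEq (z₀ := ((r - 1 : ℝ) : ℂ) * I)
    (fun z _ => hf.analyticAt z) (fun z _ => hg.analyticAt z) ?_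
  have : IsOpen {z : ℂ | z.im < r} := isOpen_lt Complex.continuous_im continuous_const
  filter_upwards [this.mem_nhds (by simp : ((r - 1 : ℝ) : ℂ) * I ∈ {z : ℂ | z.im < r})] with z hz
  exact h z hz

/-! ### Theta series -/

/-- The theta series `∑ N²ᵏ exp (-π N² u)` over positive integers `N`. -/
noncomputable def thetaTail (k : ℕ) (u : ℝ) : ℝ :=
  ∑' n : ℕ, ((n : ℝ) + 1) ^ (2 * k) * Real.exp (-π * ((n : ℝ) + 1) ^ 2 * u)

theorem summable_thetaTail (k : ℕ) {u : ℝ} (hu : 0 < u) :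
    Summable fun n : ℕ => ((n : ℝ) + 1) ^ (2 * k) * Real.exp (-π * ((n : ℝ) + 1) ^ 2 * u) := by
  have h1 := (summable_nat_add_iff 1).mpr
    (Real.summable_pow_mul_exp_neg_nat_mul (2 * k) (mul_pos Real.pi_pos hu))
  refine h1.of_nonneg_of_le (fun n => by positivity) fun n => ?_
  push_cast
  have hn : (0 : ℝ) ≤ n := Nat.cast_nonneg n
  refine mul_le_mul_of_nonneg_left (Real.exp_le_exp.mpr ?_) (by positivity)
  have h2 : ((n : ℝ) + 1) ≤ ((n : ℝ) + 1) ^ 2 := by nlinarith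
  have h3 := mul_le_mul_of_nonneg_left h2 (mul_pos Real.pi_pos hu).le
  linarith

theorem hasSum_thetaTail (k : ℕ) {u : ℝ} (hu : 0 < u) :
    HasSum (fun n : ℕ => ((n : ℝ) + 1) ^ (2 * k) * Real.exp (-π * ((n : ℝ) + 1) ^ 2 * u))
      (thetaTail k u) := (summable_thetaTail k hu).hasSum

theorem thetaTail_nonneg (k : ℕ) (u : ℝ) : 0 ≤ thetaTail k u :=
  tsum_nonneg fun n => by positivity

theorem hasDerivAt_thetaTail (k : ℕ) {u : ℝ} (hu : 0 < u) :
    HasDerivAt (thetaTail k) (-π * thetaTail (k + 1) u) u := by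
  have h2 : 0 < u / 2 := by linarith
  have hmem : u ∈ Set.Ioi (u / 2) := by
    rw [Set.mem_Ioi]
    linarith
  have := hasDerivAt_tsum_of_isPreconnected (𝕜 := ℝ) (t := Set.Ioi (u / 2)) (y₀ := u) (y := u)
    (g := fun (n : ℕ) u => ((n : ℝ) + 1) ^ (2 * k) * Real.exp (-π * ((n : ℝ) + 1) ^ 2 * u))
    (g' := fun (n : ℕ) u => -π * (((n : ℝ) + 1) ^ (2 * (k + 1)) *
      Real.exp (-π * ((n : ℝ) + 1) ^ 2 * u)))
    ((summable_thetaTail (k + 1) h2).mul_left π) isOpen_Ioi isPreconnected_Ioi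
    (fun n y _ => by
      have h := (((hasDerivAt_id y).const_mul (-π * ((n : ℝ) + 1) ^ 2)).exp).const_mul
        (((n : ℝ) + 1) ^ (2 * k))
      refine h.congr_deriv ?_
      simp only [id]
      ring)
    (fun n y hy => by
      rw [norm_mul, norm_neg, Real.norm_of_nonneg Real.pi_pos.le,
        Real.norm_of_nonneg (by positivity)]
      have hy' : u / 2 ≤ y := le_of_lt hy
      have h3 : -π * ((n : ℝ) + 1) ^ 2 * y ≤ -π * ((n : ℝ) + 1) ^ 2 * (u / 2) := by
        have := mul_le_mul_of_nonneg_left hy' (by positivity : 0 ≤ π * ((n : ℝ) + 1) ^ 2)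
        linarith
      gcongr)
    hmem (summable_thetaTail k hu) hmem
  rw [tsum_mul_left] at this
  exact this

/-- Compares exponents termwise through `((n+1)² - 1)(u - 1) ≥ 0`. -/
theorem thetaTail_le (k : ℕ) {u : ℝ} (hu : 1 ≤ u) :
    thetaTail k u ≤ Real.exp π * thetaTail k 1 * Real.exp (-π * u) := by
  rw [thetaTail, thetaTail, ← tsum_mul_left, ← tsum_mul_right]
  refine Summable.tsum_le_tsum (fun n => ?_) (summable_thetaTail k (by linarith))
    (((summable_thetaTail k one_pos).mul_left _).mul_right _)
  have h1 : Real.exp (-π * ((n : ℝ) + 1) ^ 2 * u) ≤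
      Real.exp π * Real.exp (-π * ((n : ℝ) + 1) ^ 2 * 1) * Real.exp (-π * u) := by
    rw [← Real.exp_add, ← Real.exp_add]
    refine Real.exp_le_exp.mpr ?_
    have hn : (0 : ℝ) ≤ n := Nat.cast_nonneg n
    have h2 : 0 ≤ (((n : ℝ) + 1) ^ 2 - 1) * (u - 1) :=
      mul_nonneg (by nlinarith) (by linarith)
    nlinarith [mul_nonneg Real.pi_pos.le h2]
  calc _ ≤ ((n : ℝ) + 1) ^ (2 * k) *
        (Real.exp π * Real.exp (-π * ((n : ℝ) + 1) ^ 2 * 1) * Real.exp (-π * u)) := by gcongr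
    _ = _ := by ring

theorem one_add_two_mul_thetaTail {u : ℝ} (hu : 0 < u) :
    1 + 2 * thetaTail 0 u = HurwitzZeta.cosKernel 0 u := by
  have h1 := HurwitzZeta.hasSum_nat_cosKernel₀ 0 hu
  have h2 := (hasSum_thetaTail 0 hu).mul_left 2
  have h3 := h1.unique (h2.congr_fun fun n => by simp)
  simp only [QuotientAddGroup.mk_zero] at h3
  linarith

/-- Jacobi's inversion formula for the theta function. -/
theorem thetaTail_inv {u : ℝ} (hu : 0 < u) :
    1 + 2 * thetaTail 0 u = 1 / u ^ (1 / 2 : ℝ) * (1 + 2 * thetaTail 0 (1 / u)) := by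
  rw [one_add_two_mul_thetaTail hu, one_add_two_mul_thetaTail (by positivity),
    ← HurwitzZeta.evenKernel_functional_equation, HurwitzZeta.evenKernel_eq_cosKernel_of_zero]

/-- The weight `N^(2k)` is cancelled by the shift of the Mellin variable by `k`, so the Dirichlet
series remains `ζ(s)`. -/
theorem mellin_thetaTail (k : ℕ) {s : ℂ} (hs : 1 < s.re) :
    mellin (fun u => (thetaTail k u : ℂ)) (s / 2 + k) = Gammaℝ (s + 2 * k) * riemannZeta s := by
  have hre : (s + 2 * k).re = s.re + 2 * k := by simp
  have hpow : ∀ n : ℕ, (((n : ℝ) + 1 : ℝ) : ℂ) ^ (s + 2 * k) =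
      (n + 1 : ℂ) ^ s * (n + 1) ^ (2 * k) := fun n => by
    push_cast
    rw [Complex.cpow_add _ _ (Nat.cast_add_one_ne_zero n)]
    congr 1
    rw [← Complex.cpow_natCast]
    push_cast
    rfl
  have habs : ∀ n : ℕ, |(n : ℝ) + 1| = n + 1 := fun n => abs_of_pos (by positivity)
  have h := hasSum_mellin_pi_mul_sq (ι := ℕ) (s := s + 2 * k)
    (a := fun n => ((n : ℂ) + 1) ^ (2 * k)) (r := fun n => (n : ℝ) + 1)
    (F := fun u => (thetaTail k u : ℂ)) (by rw [hre]; positivity) (fun t ht => by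
      have := Complex.hasSum_ofReal.mpr (hasSum_thetaTail k (u := t) ht)
      refine this.congr_fun fun n => ?_
      rw [if_neg (by positivity)]
      push_cast
      rfl) (by
      have h1 := (summable_nat_add_iff 1).mpr (Real.summable_one_div_nat_rpow.mpr hs)
      refine h1.congr fun n => ?_
      rw [habs, hre, Real.rpow_add (by positivity), norm_pow]
      have h2 : ‖(n : ℂ) + 1‖ = (n : ℝ) + 1 := by
        rw [← Nat.cast_add_one, Complex.norm_natCast, Nat.cast_add_one]
      have h3 : ((n : ℝ) + 1) ^ (2 * (k : ℝ)) = ((n : ℝ) + 1) ^ (2 * k) := by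
        rw [← Real.rpow_natCast]
        push_cast
        rfl
      rw [h2, h3]
      have : ((n : ℝ) + 1) ^ (2 * k) ≠ 0 := by positivity
      push_cast
      field_simp)
  rw [show (s + 2 * k) / 2 = s / 2 + k by ring] at h
  have h2 := h.tsum_eq
  rw [← h2, zeta_eq_tsum_one_div_nat_add_one_cpow hs, ← tsum_mul_left]
  refine tsum_congr fun n => ?_
  rw [habs, hpow]
  have : ((n : ℂ) + 1) ^ (2 * k) ≠ 0 := pow_ne_zero _ (Nat.cast_add_one_ne_zero n)
  field_simp

/-- At the real point `Re s`, a divergent integral would take the default value `0`, whereas the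
Mellin formula gives a nonzero number. Convergence depends only on the real part of the exponent. -/
theorem mellinConvergent_thetaTail (k : ℕ) {s : ℂ} (hs : 1 < s.re) :
    MellinConvergent (fun u => (thetaTail k u : ℂ)) (s / 2 + k) := by
  have hmeas : AEStronglyMeasurable (fun u => (thetaTail k u : ℂ))
      (volume.restrict (Set.Ioi 0)) := by
    refine ContinuousOn.aestronglyMeasurable (fun u hu => ?_) measurableSet_Ioi
    exact (Complex.continuous_ofReal.continuousAt.comp
      (hasDerivAt_thetaTail k hu).continuousAt).continuousWithinAt
  have h1 : MellinConvergent (fun u => (thetaTail k u : ℂ)) ((s.re : ℂ) / 2 + k) := by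
    by_contra hcon
    have h2 := mellin_thetaTail k (s := (s.re : ℂ)) (by simpa using hs)
    rw [mellin, integral_undef hcon] at h2
    refine mul_ne_zero (Gammaℝ_ne_zero_of_re_pos ?_) (riemannZeta_ne_zero_of_one_lt_re ?_) h2.symm
    · simp
      positivity
    · simpa using hs
  rw [MellinConvergent, mellin_convergent_iff_norm subset_rfl measurableSet_Ioi hmeas] at h1 ⊢
  have h3 : (s / 2 + k).re = ((s.re : ℂ) / 2 + k).re := by simp
  rw [h3]
  exact h1

/-! ### The Riemann Xi function -/

theorem xiPhi_eq (t : ℝ) : xiPhi t = Real.exp (-(t / 2)) *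
    (4 * π ^ 2 * Real.exp (-2 * t) ^ 2 * thetaTail 2 (Real.exp (-2 * t)) -
      6 * π * Real.exp (-2 * t) * thetaTail 1 (Real.exp (-2 * t))) := by
  set u := Real.exp (-2 * t) with hu
  have hu0 : 0 < u := Real.exp_pos _
  have h1 := ((hasSum_thetaTail 2 hu0).mul_left (4 * π ^ 2 * u ^ 2)).sub
    ((hasSum_thetaTail 1 hu0).mul_left (6 * π * u))
  rw [xiPhi, ← h1.tsum_eq, ← tsum_mul_left, ← tsum_mul_left]
  refine tsum_congr fun n => ?_
  have e1 : Real.exp (-(9 * t / 2)) = Real.exp (-(t / 2)) * u ^ 2 := by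
    rw [hu, ← Real.exp_nat_mul, ← Real.exp_add]
    congr 1
    push_cast
    ring
  have e2 : Real.exp (-(5 * t / 2)) = Real.exp (-(t / 2)) * u := by
    rw [hu, ← Real.exp_add]
    congr 1
    ring
  have e3 : Real.exp (-(2 * t)) = u := by rw [hu, neg_mul]
  have e4 : -(((n : ℝ) + 1) ^ 2 * π * u) = -π * ((n : ℝ) + 1) ^ 2 * u := by ring
  rw [e1, e2, e3, e4]
  ring

theorem continuous_xiPhi : Continuous xiPhi := by
  have hc : ∀ k, Continuous fun t : ℝ => thetaTail k (Real.exp (-2 * t)) := fun k =>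
    continuous_iff_continuousAt.mpr fun t =>
      ContinuousAt.comp (f := fun t : ℝ => Real.exp (-2 * t))
        (hasDerivAt_thetaTail k (Real.exp_pos _)).continuousAt (by fun_prop)
  have h1 := hc 1
  have h2 := hc 2
  rw [show xiPhi = _ from funext xiPhi_eq]
  fun_prop

/-- With `h(t) = exp(-t/2) θ(exp(-2t))`, one has `2φ = h'' - h/4`. Jacobi's formula says that `h` is
even, and this passes to `h''`. -/
theorem xiPhi_neg (t : ℝ) : xiPhi (-t) = xiPhi t := by
  set u : ℝ → ℝ := fun t => Real.exp (-2 * t) with hu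
  have hu0 : ∀ t, 0 < u t := fun t => Real.exp_pos _
  have hud : ∀ t, HasDerivAt u (-2 * u t) t := fun t => by
    have := ((hasDerivAt_id t).const_mul (-2)).exp
    refine this.congr_deriv ?_
    simp [hu, mul_comm]
  have hed : ∀ t : ℝ, HasDerivAt (fun t : ℝ => Real.exp (-(t / 2)))
      (-(1 / 2) * Real.exp (-(t / 2))) t := fun t => by
    have := ((hasDerivAt_id t).div_const 2).neg.exp
    refine this.congr_deriv ?_
    simp [mul_comm]
  have hθ : ∀ k t, HasDerivAt (fun t => thetaTail k (u t))
      (-π * thetaTail (k + 1) (u t) * (-2 * u t)) t := fun k t =>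
    HasDerivAt.comp t (hasDerivAt_thetaTail k (hu0 t)) (hud t)
  set h : ℝ → ℝ := fun t => Real.exp (-(t / 2)) * (1 + 2 * thetaTail 0 (u t)) with hh
  set h1 : ℝ → ℝ := fun t => Real.exp (-(t / 2)) *
    (-(1 / 2) - thetaTail 0 (u t) + 4 * π * (u t * thetaTail 1 (u t))) with hh1
  have d1 : ∀ t, HasDerivAt h (h1 t) t := fun t => by
    refine ((hed t).mul (((hθ 0 t).const_mul 2).const_add 1)).congr_deriv ?_
    simp only [hh1]
    ring
  have d2 : ∀ t, HasDerivAt h1 (2 * xiPhi t + h t / 4) t := fun t => by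
    refine ((hed t).mul (((hθ 0 t).const_sub (-(1 / 2))).add
      (((hud t).mul (hθ 1 t)).const_mul (4 * π)))).congr_deriv ?_
    rw [xiPhi_eq]
    simp only [hh, Pi.add_apply, Pi.mul_apply]
    change _ = 2 * (Real.exp (-(t / 2)) * (4 * π ^ 2 * u t ^ 2 * thetaTail 2 (u t) -
      6 * π * u t * thetaTail 1 (u t))) + _
    ring
  have hev : ∀ t, h (-t) = h t := fun t => by
    have h2 := thetaTail_inv (hu0 t)
    have e1 : 1 / u t = u (-t) := by
      simp only [hu]
      rw [one_div, ← Real.exp_neg]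
      congr 1
      ring
    have e2 : 1 / u t ^ (1 / 2 : ℝ) = Real.exp t := by
      simp only [hu]
      rw [← Real.exp_mul, one_div, ← Real.exp_neg]
      congr 1
      ring
    rw [e1, e2] at h2
    simp only [hh]
    rw [h2, ← mul_assoc, ← Real.exp_add]
    congr 2
    ring
  have hodd : ∀ t, h1 (-t) = -h1 t := fun t => by
    have h3 := HasDerivAt.comp t (d1 (-t)) (hasDerivAt_neg t)
    have h4 : h ∘ (fun x => -x) = h := funext hev
    rw [h4] at h3
    have := h3.unique (d1 t)
    linarith
  have h3 := HasDerivAt.comp t (d2 (-t)) (hasDerivAt_neg t)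
  have h4 : h1 ∘ (fun x => -x) = -h1 := funext hodd
  rw [h4] at h3
  have := h3.unique (d2 t).neg
  rw [hev] at this
  linarith

/-- For `t ≤ 0` every term is nonnegative because `2π > 3`; evenness handles `t > 0`. -/
theorem xiPhi_nonneg (t : ℝ) : 0 ≤ xiPhi t := by
  wlog ht : t ≤ 0 generalizing t
  · rw [← xiPhi_neg]
    exact this (-t) (by linarith)
  rw [xiPhi]
  refine mul_nonneg (by positivity) (tsum_nonneg fun n => mul_nonneg ?_ (Real.exp_nonneg _))
  have e1 : Real.exp (-(9 * t / 2)) = Real.exp (-(5 * t / 2)) * Real.exp (-2 * t) := by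
    rw [← Real.exp_add]
    congr 1
    ring
  have h1 : 1 ≤ Real.exp (-2 * t) := Real.one_le_exp (by linarith)
  have hn : (1 : ℝ) ≤ ((n : ℝ) + 1) ^ 2 := by
    have : (0 : ℝ) ≤ n := Nat.cast_nonneg n
    nlinarith
  have h2 : (1 : ℝ) ≤ ((n : ℝ) + 1) ^ 2 * Real.exp (-2 * t) := one_le_mul_of_one_le_of_one_le hn h1
  have h3 : 0 ≤ 2 * π * (((n : ℝ) + 1) ^ 2 * Real.exp (-2 * t)) - 3 := by
    nlinarith [Real.pi_gt_three]
  have h4 : 2 * π * ((n : ℝ) + 1) ^ 4 * Real.exp (-(9 * t / 2)) -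
      3 * ((n : ℝ) + 1) ^ 2 * Real.exp (-(5 * t / 2)) = ((n : ℝ) + 1) ^ 2 *
      Real.exp (-(5 * t / 2)) * (2 * π * (((n : ℝ) + 1) ^ 2 * Real.exp (-2 * t)) - 3) := by
    rw [e1]
    ring
  rw [h4]
  positivity

/-- The series at `-t` has theta argument `exp(2t) ≥ 1`, where its exponential decay is explicit;
evenness brings the bound back to `t`. -/
theorem isBigO_xiPhi :
    xiPhi =O[atTop] fun t => Real.exp (9 / 2 * t - π * Real.exp (2 * t)) := by
  refine Asymptotics.IsBigO.of_bound (4 * π ^ 2 * (Real.exp π * thetaTail 2 1)) ?_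
  filter_upwards [eventually_ge_atTop 0] with t ht
  rw [Real.norm_of_nonneg (xiPhi_nonneg t), Real.norm_of_nonneg (Real.exp_nonneg _), ← xiPhi_neg,
    xiPhi_eq]
  have e1 : Real.exp (-2 * -t) = Real.exp (2 * t) := by congr 1; ring
  have e2 : Real.exp (9 / 2 * t - π * Real.exp (2 * t)) =
      Real.exp (-(-t / 2)) * Real.exp (2 * t) ^ 2 * Real.exp (-π * Real.exp (2 * t)) := by
    rw [← Real.exp_nat_mul, ← Real.exp_add, ← Real.exp_add]
    congr 1
    push_cast
    ring
  rw [e1, e2]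
  have h1 := thetaTail_le 2 (Real.one_le_exp (by linarith : 0 ≤ 2 * t))
  have h2 := thetaTail_nonneg 1 (Real.exp (2 * t))
  calc _ ≤ Real.exp (-(-t / 2)) * (4 * π ^ 2 * Real.exp (2 * t) ^ 2 *
        thetaTail 2 (Real.exp (2 * t))) := by
        refine mul_le_mul_of_nonneg_left ?_ (Real.exp_nonneg _)
        have : 0 ≤ 6 * π * Real.exp (2 * t) * thetaTail 1 (Real.exp (2 * t)) := by positivity
        linarith
    _ ≤ Real.exp (-(-t / 2)) * (4 * π ^ 2 * Real.exp (2 * t) ^ 2 *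
        (Real.exp π * thetaTail 2 1 * Real.exp (-π * Real.exp (2 * t)))) := by gcongr
    _ = _ := by ring

theorem hasGaussianTails_xiPhi : HasGaussianTails (densityMeasure xiPhi Set.univ) :=
  hasGaussianTails_densityMeasure continuous_xiPhi xiPhi_nonneg Real.pi_pos isBigO_xiPhi
    (isBigO_xiPhi.congr_left fun t => (xiPhi_neg t).symm)

theorem riemannXi_eq_mul {s : ℂ} (hs : 1 < s.re) :
    (s * (s - 1) * completedRiemannZeta₀ s + 1) / 2 =
      s * (s - 1) / 2 * (Gammaℝ s * riemannZeta s) := by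
  have h0 : s ≠ 0 := by rintro rfl; simp at hs; linarith
  have h1 : 1 - s ≠ 0 := by
    intro h
    rw [← sub_eq_zero.mp h] at hs
    simp at hs
  rw [riemannZeta_def_of_ne_zero h0, mul_div_cancel₀ _
    (Gammaℝ_ne_zero_of_re_pos (by linarith)), completedRiemannZeta_eq]
  field_simp
  ring

theorem riemannXi_neg (z : ℂ) : riemannXi (-z) = riemannXi z := by
  have h := completedRiemannZeta₀_one_sub (1 / 2 + I * z)
  rw [show 1 - (1 / 2 + I * z) = 1 / 2 + I * -z by ring] at h
  rw [riemannXi, riemannXi, h]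
  ring

theorem re_half_add_I_mul (z : ℂ) : (1 / 2 + I * z).re = 1 / 2 - z.im := by
  have : (1 / 2 : ℂ) = ((1 / 2 : ℝ) : ℂ) := by push_cast; rfl
  rw [Complex.add_re, this, Complex.ofReal_re, Complex.I_mul_re]
  ring

/-- Both sides are entire, so agreement for `Im z < -1/2`, that is `Re s > 1`, suffices; there the
Mellin formulas for the theta series apply. -/
theorem riemannXi_eq_laplaceTr (z : ℂ) :
    riemannXi z = laplaceTr (densityMeasure xiPhi Set.univ) (-I * z) := by
  have hL : Differentiable ℂ fun z => laplaceTr (densityMeasure xiPhi Set.univ) (-I * z) :=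
    hasGaussianTails_xiPhi.differentiable_laplaceTr.comp (by fun_prop)
  have hX : Differentiable ℂ riemannXi := by
    have h1 : Differentiable ℂ fun z => completedRiemannZeta₀ (1 / 2 + I * z) :=
      differentiable_completedZeta₀.comp (by fun_prop)
    unfold riemannXi
    fun_prop
  refine congrFun (eq_of_eqOn_im_lt hX hL (r := -1 / 2) fun z hz => ?_) z
  set s := 1 / 2 + I * z with hs
  have hsre : 1 < s.re := by
    rw [hs, re_half_add_I_mul]
    linarith
  have hs0 : s ≠ 0 := by rintro h; rw [h] at hsre; simp at hsre; linarith
  have hs2 : s + 2 ≠ 0 := by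
    intro h
    have := congrArg Complex.re h
    simp at this
    linarith
  rw [riemannXi, ← hs, riemannXi_eq_mul hsre]
  have hm1 := mellin_thetaTail 1 hsre
  have hm2 := mellin_thetaTail 2 hsre
  have hc1 := mellinConvergent_thetaTail 1 hsre
  have hc2 := mellinConvergent_thetaTail 2 hsre
  have hG1 : Gammaℝ (s + 2 * (1 : ℕ)) = Gammaℝ s * s / 2 / π := by
    rw [Nat.cast_one, mul_one, Gammaℝ_add_two hs0]
  have hG2 : Gammaℝ (s + 2 * (2 : ℕ)) = Gammaℝ s * s / 2 / π * (s + 2) / 2 / π := by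
    rw [← Gammaℝ_add_two hs0, ← Gammaℝ_add_two hs2]
    congr 1
    push_cast
    ring
  rw [hG1, ← mellin_cpow_smul] at hm1
  rw [hG2, ← mellin_cpow_smul] at hm2
  rw [← MellinConvergent.cpow_smul] at hc1 hc2
  -- The Gamma shifts give `s(s + 2)` and `3s` for the two terms, whose difference is the factor
  -- `s(s - 1)`.
  have hmain : mellin (fun u : ℝ => (4 * π ^ 2 : ℂ) • ((u : ℂ) ^ ((2 : ℕ) : ℂ) •
      (thetaTail 2 u : ℂ)) - (6 * π : ℂ) • ((u : ℂ) ^ ((1 : ℕ) : ℂ) • (thetaTail 1 u : ℂ))) (s / 2) =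
      s * (s - 1) * (Gammaℝ s * riemannZeta s) := by
    have h1 := hasMellin_sub (hc2.const_smul (4 * π ^ 2 : ℂ)) (hc1.const_smul (6 * π : ℂ))
    rw [h1.2, mellin_const_smul, mellin_const_smul, hm1, hm2]
    have hpi : (π : ℂ) ≠ 0 := by exact_mod_cast Real.pi_ne_zero
    simp only [smul_eq_mul]
    field_simp
    ring
  have hint := integral_exp_mul_comp_exp (fun u : ℝ => (4 * π ^ 2 : ℂ) • ((u : ℂ) ^ ((2 : ℕ) : ℂ) •
      (thetaTail 2 u : ℂ)) - (6 * π : ℂ) • ((u : ℂ) ^ ((1 : ℕ) : ℂ) • (thetaTail 1 u : ℂ))) (s / 2)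
  rw [hmain] at hint
  rw [laplaceTr, integral_densityMeasure continuous_xiPhi.measurable xiPhi_nonneg,
    setIntegral_univ, div_mul_eq_mul_div, ← hint]
  refine integral_congr_ae (Eventually.of_forall fun t => ?_)
  simp only [xiPhi_eq, Complex.real_smul, smul_eq_mul, Complex.cpow_natCast]
  have he : Complex.exp (-2 * (s / 2) * t) = Real.exp (-(t / 2)) * Complex.exp (-I * z * t) := by
    rw [Complex.ofReal_exp, ← Complex.exp_add, hs]
    congr 1
    push_cast
    ring
  rw [he]
  push_cast
  ring

theorem abs_im_le_of_riemannXi_eq_zero {z : ℂ} (hz : riemannXi z = 0) : |z.im| ≤ 1 / 2 := by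
  have key : ∀ w : ℂ, riemannXi w = 0 → -(1 / 2) ≤ w.im := fun w hw => by
    by_contra! hlt
    have hsre : 1 < (1 / 2 + I * w).re := by
      rw [re_half_add_I_mul]
      linarith
    rw [riemannXi, riemannXi_eq_mul hsre] at hw
    have h1 : Gammaℝ (1 / 2 + I * w) ≠ 0 := Gammaℝ_ne_zero_of_re_pos (by linarith)
    have h2 := riemannZeta_ne_zero_of_one_lt_re hsre
    generalize 1 / 2 + I * w = s at *
    have h3 : s ≠ 0 := by rintro rfl; simp at hsre; linarith
    have h4 : s - 1 ≠ 0 := by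
      intro h
      rw [sub_eq_zero.mp h] at hsre
      simp at hsre
    exact mul_ne_zero (div_ne_zero (mul_ne_zero h3 h4) two_ne_zero) (mul_ne_zero h1 h2) hw
  rw [abs_le]
  have h1 := key (-z) (by rw [riemannXi_neg, hz])
  rw [Complex.neg_im] at h1
  exact ⟨key z hz, by linarith⟩

theorem exists_riemannXi {n : ℕ} (hn : 1 ≤ n) :
    ∃ S ∈ IntermediateField.adjoin ℚ
        {w : ℂ | ∃ j : ℕ, 1 ≤ j ∧ j ≤ n ∧ w = ((xiMoment (2 * j) / xiMoment 0 : ℝ) : ℂ)},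
      HasSum (fun z : {z : ℂ // 0 < z.re ∧ riemannXi z = 0} =>
        (analyticOrderNatAt riemannXi z : ℂ) * (1 / (z : ℂ) ^ (2 * n))) S := by
  have hmom : ∀ k, xiMoment k = ∫ x, x ^ k ∂(densityMeasure xiPhi Set.univ) := fun k => by
    rw [integral_densityMeasure continuous_xiPhi.measurable xiPhi_nonneg, setIntegral_univ,
      xiMoment]
    exact integral_congr_ae (Eventually.of_forall fun t => by simp [mul_comm])
  simp only [hmom]
  refine hasGaussianTails_xiPhi.exists_hasSum_zeros
    -- The witness corresponds to `Ξ` at `z = i`, outside the strip of zeros.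
    (hasGaussianTails_xiPhi.integral_pow_zero_ne_zero (z := -I * I) ?_) one_ne_zero
    (fun z => by rw [one_mul, riemannXi_eq_laplaceTr]) riemannXi_neg
    (fun z hz => abs_im_le_of_riemannXi_eq_zero hz) hn
  rw [← riemannXi_eq_laplaceTr]
  intro h
  have := abs_im_le_of_riemannXi_eq_zero h
  norm_num at this

/-! ### Theta kernels of real Dirichlet characters -/

theorem hasSum_int_of_residues {m : ℕ} [NeZero m] {F : ℤ → ℝ} {S : ZMod m → ℝ}
    (h : ∀ r : ZMod m, HasSum (fun k : ℤ => F (k * m + r.val)) (S r)) :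
    HasSum F (∑ r, S r) := by
  have hm : (m : ℤ) ≠ 0 := by exact_mod_cast NeZero.ne m
  have h1 : ∀ r : ZMod m, HasSum (fun n : ℤ => if (n : ZMod m) = r then F n else 0) (S r) := by
    intro r
    have hinj : Function.Injective fun k : ℤ => k * (m : ℤ) + r.val := fun x y hxy => by
      have : x * (m : ℤ) = y * m := by simpa using hxy
      exact mul_right_cancel₀ hm this
    refine (hinj.hasSum_iff fun n hn => ?_).mp ((h r).congr_fun fun k => ?_)
    · rw [if_neg]
      intro hr
      apply hn
      have h2 : ((r.val : ℤ) : ZMod m) = (n : ZMod m) := by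
        rw [hr, Int.cast_natCast, ZMod.natCast_zmod_val]
      obtain ⟨k, hk⟩ := (ZMod.intCast_eq_intCast_iff_dvd_sub _ _ _).mp h2
      exact ⟨k, by simp only; linarith [mul_comm (m : ℤ) k]⟩
    · simp
  refine (hasSum_sum fun r _ => h1 r).congr_fun fun n => ?_
  rw [Finset.sum_ite_eq]
  simp

theorem exists_isBigO_sum_exp {ι : Type*} (s : Finset ι) {f : ι → ℝ → ℝ}
    (h : ∀ i, ∃ p : ℝ, 0 < p ∧ f i =O[atTop] fun x => Real.exp (-p * x)) :
    ∃ p : ℝ, 0 < p ∧ (fun x => ∑ i ∈ s, f i x) =O[atTop] fun x => Real.exp (-p * x) := by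
  have hmono : ∀ {p q : ℝ}, p ≤ q → (fun x : ℝ => Real.exp (-q * x)) =O[atTop]
      fun x => Real.exp (-p * x) := fun {p q} hpq => by
    refine Asymptotics.IsBigO.of_bound 1 ?_
    filter_upwards [eventually_ge_atTop 0] with x hx
    rw [Real.norm_of_nonneg (Real.exp_nonneg _), Real.norm_of_nonneg (Real.exp_nonneg _), one_mul]
    refine Real.exp_le_exp.mpr ?_
    nlinarith
  classical
  induction s using Finset.induction_on with
  | empty => exact ⟨1, one_pos, by simpa using Asymptotics.isBigO_zero _ _⟩
  | insert i s hi ih =>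
    obtain ⟨p, hp, hpO⟩ := ih
    obtain ⟨q, hq, hqO⟩ := h i
    refine ⟨min p q, lt_min hp hq, ?_⟩
    simp only [Finset.sum_insert hi]
    exact (hqO.trans (hmono (min_le_right p q))).add (hpO.trans (hmono (min_le_left p q)))

theorem HasMellin.const_smul {f : ℝ → ℂ} {s a : ℂ} (h : HasMellin f s a) (c : ℂ) :
    HasMellin (fun x => c • f x) s (c * a) :=
  ⟨MellinConvergent.const_smul h.1 c, by rw [mellin_const_smul, h.2, smul_eq_mul]⟩

theorem mellin_finset_sum {ι : Type*} (S : Finset ι) {f : ι → ℝ → ℂ} {a : ι → ℂ} {s : ℂ}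
    (h : ∀ i, HasMellin (f i) s (a i)) :
    mellin (fun x => ∑ i ∈ S, f i x) s = ∑ i ∈ S, a i := by
  simp only [mellin, Finset.smul_sum]
  rw [integral_finsetSum S fun i _ => (h i).1]
  exact Finset.sum_congr rfl fun i _ => (h i).2

/-- The properties of a kernel `K` whose Mellin transform is the completed `L`-function of the real
character `χ`. -/
structure IsThetaKernel {m : ℕ} [NeZero m] (χ : DirichletCharacter ℂ m) (K : ℝ → ℝ) : Prop where
  continuousOn : ContinuousOn K (Set.Ioi 0)
  isBigO_top : ∃ p : ℝ, 0 < p ∧ K =O[atTop] fun x => Real.exp (-p * x)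
  isBigO_inv : ∃ p : ℝ, 0 < p ∧ (fun x => K (1 / x)) =O[atTop]
    fun x => x ^ (1 / 2 + charParity χ : ℝ) * Real.exp (-p * x)
  mellin_eq : ∀ s : ℂ, 1 < s.re → mellin (fun x => (K x : ℂ)) ((s + charParity χ) / 2) =
    2 * (m : ℂ) ^ s * χ.completedLFunction s
  phi_eq : ∀ t, dirichletPhi χ t = Real.exp (-((1 + 2 * charParity χ) / 2) * t) *
    (m : ℝ) ^ charParity χ * K (m * Real.exp (-2 * t))

/-- Writing an integer as `m (k + r/m)` splits the series into Hurwitz kernels weighted by `χ(r)`.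
-/
theorem dirichletPhi_eq_sum {m : ℕ} [NeZero m] (χ : DirichletCharacter ℂ m)
    {κ : ZMod m → ℝ → ℝ} (h : ∀ (r : ZMod m) (x : ℝ), 0 < x → HasSum (fun k : ℤ =>
      ((k : ℝ) + r.val / m) ^ charParity χ * Real.exp (-π * ((k : ℝ) + r.val / m) ^ 2 * x))
      (κ r x)) (t : ℝ) :
    dirichletPhi χ t = Real.exp (-((1 + 2 * charParity χ) / 2) * t) *
      (m : ℝ) ^ charParity χ * ∑ r, (χ r).re * κ r (m * Real.exp (-2 * t)) := by
  have hm : (0 : ℝ) < m := by exact_mod_cast Nat.pos_of_ne_zero (NeZero.ne m)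
  rw [dirichletPhi, Finset.mul_sum]
  refine HasSum.tsum_eq (hasSum_int_of_residues fun r => ?_)
  have h1 := (h r (m * Real.exp (-2 * t)) (by positivity)).mul_left
    (Real.exp (-((1 + 2 * charParity χ) / 2) * t) * (m : ℝ) ^ charParity χ * (χ r).re)
  rw [← mul_assoc]
  refine h1.congr_fun fun k => ?_
  have e1 : (((k * m + r.val : ℤ) : ZMod m)) = r := by
    push_cast
    rw [ZMod.natCast_self, mul_zero, zero_add, ZMod.natCast_zmod_val]
  have e2 : ((k * m + r.val : ℤ) : ℝ) = m * ((k : ℝ) + r.val / m) := by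
    push_cast
    field_simp
  have e3 : Real.exp (-2 * t) = (Real.exp (2 * t))⁻¹ := by
    rw [← Real.exp_neg]
    ring_nf
  have e4 : ∀ y : ℝ, Real.exp (-((m * y) ^ 2 * π / (m * Real.exp (2 * t))) -
      (1 + 2 * charParity χ) / 2 * t) = Real.exp (-((1 + 2 * charParity χ) / 2) * t) *
      Real.exp (-π * y ^ 2 * (m * Real.exp (-2 * t))) := fun y => by
    rw [← Real.exp_add, e3]
    congr 1
    have := (Real.exp_pos (2 * t)).ne'
    field_simp
    ring
  rw [e1, e2, e4, mul_pow]
  ring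

section Existence

theorem ofReal_re_of_real {m : ℕ} {χ : DirichletCharacter ℂ m}
    (hreal : ∀ u : ZMod m, (χ u).im = 0) (u : ZMod m) :
    (((χ u).re : ℝ) : ℂ) = χ u := Complex.ext rfl (by simp [hreal u])

variable {m : ℕ} [NeZero m] {χ : DirichletCharacter ℂ m}

theorem isThetaKernel_even (hm : m ≠ 1) (hχ1 : χ ≠ 1) (hreal : ∀ u : ZMod m, (χ u).im = 0)
    (hχ : χ.Even) : IsThetaKernel χ
      fun x => ∑ r, (χ r).re * HurwitzZeta.evenKernel (ZMod.toAddCircle r) x := by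
  have hpar : charParity χ = 0 := if_pos hχ
  have h0 : χ 0 = 0 := χ.map_zero' hm
  -- Orthogonality removes the constant terms of the cosine kernels at infinity.
  have hsum : ∑ r, (χ r).re = 0 := by
    rw [← Complex.re_sum, MulChar.sum_eq_zero_of_ne_one hχ1, Complex.zero_re]
  -- Only the kernel at `r = 0` has a constant term, and there `χ` vanishes.
  have hK : ∀ x, ∑ r, (χ r).re * HurwitzZeta.evenKernel (ZMod.toAddCircle r) x = ∑ r, (χ r).re *
      (HurwitzZeta.evenKernel (ZMod.toAddCircle r) x -
        if ZMod.toAddCircle r = 0 then 1 else 0) := fun x => by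
    refine Finset.sum_congr rfl fun r _ => ?_
    split_ifs with hr
    · rw [ZMod.toAddCircle_eq_zero.mp hr, h0]
      simp
    · rw [sub_zero]
  refine ⟨?_, ?_, ?_, ?_, ?_⟩
  · exact continuousOn_finsetSum _ fun r _ =>
      continuousOn_const.mul (HurwitzZeta.continuousOn_evenKernel _)
  · simp only [hK]
    refine exists_isBigO_sum_exp _ fun r => ?_
    obtain ⟨p, hp, h⟩ := HurwitzZeta.isBigO_atTop_evenKernel_sub (ZMod.toAddCircle r)
    exact ⟨p, hp, h.const_mul_left _⟩
  · obtain ⟨p, hp, h⟩ := exists_isBigO_sum_exp Finset.univ (f := fun (r : ZMod m) x => (χ r).re *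
      (HurwitzZeta.cosKernel (ZMod.toAddCircle r) x - 1)) fun r => by
        obtain ⟨p, hp, h⟩ := HurwitzZeta.isBigO_atTop_cosKernel_sub (ZMod.toAddCircle r)
        exact ⟨p, hp, h.const_mul_left _⟩
    refine ⟨p, hp, (((Asymptotics.isBigO_refl
      (fun x : ℝ => x ^ (1 / 2 + charParity χ : ℝ)) atTop).mul h)).congr' ?_ EventuallyEq.rfl⟩
    filter_upwards [eventually_gt_atTop 0] with x hx
    simp only [HurwitzZeta.evenKernel_functional_equation, mul_sub, Finset.sum_sub_distrib,
      mul_one, hsum, sub_zero, hpar, one_div_one_div, Nat.cast_zero, add_zero, Finset.mul_sum]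
    refine Finset.sum_congr rfl fun r _ => ?_
    rw [one_div x, Real.inv_rpow hx.le]
    field_simp
  · intro s hs
    have h1 : ∀ r : ZMod m, HasMellin (fun x => χ r •
        (((HurwitzZeta.evenKernel (ZMod.toAddCircle r) x : ℝ) : ℂ) -
          if ZMod.toAddCircle r = 0 then 1 else 0)) (s / 2)
        (χ r * (2 * HurwitzZeta.completedHurwitzZetaEven (ZMod.toAddCircle r) s)) := fun r => by
      have h2 := (HurwitzZeta.hurwitzEvenFEPair (ZMod.toAddCircle r)).hasMellin (s := s / 2) (by
        change (1 / 2 : ℝ) < _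
        simp
        linarith)
      have h3 := h2.const_smul (χ r)
      rw [HurwitzZeta.completedHurwitzZetaEven, mul_div_cancel₀ _ two_ne_zero]
      exact h3
    have h2 := mellin_finset_sum Finset.univ h1
    rw [hpar, Nat.cast_zero, add_zero, DirichletCharacter.completedLFunction,
      ZMod.completedLFunction_def_even hχ.to_fun]
    have hm0 : (m : ℂ) ≠ 0 := Nat.cast_ne_zero.mpr (NeZero.ne m)
    have h3 : (2 * (m : ℂ) ^ s * ((m : ℂ) ^ (-s) * ∑ r, χ r *
        HurwitzZeta.completedHurwitzZetaEven (ZMod.toAddCircle r) s)) =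
        ∑ r, χ r * (2 * HurwitzZeta.completedHurwitzZetaEven (ZMod.toAddCircle r) s) := by
      rw [← mul_assoc, mul_assoc 2, ← Complex.cpow_add _ _ hm0, add_neg_cancel, Complex.cpow_zero,
        mul_one, Finset.mul_sum]
      exact Finset.sum_congr rfl fun r _ => by ring
    rw [h3, ← h2]
    congr 1
    ext x
    rw [hK]
    push_cast
    refine Finset.sum_congr rfl fun r _ => ?_
    rw [ofReal_re_of_real hreal, smul_eq_mul]
    split_ifs <;> simp
  · refine dirichletPhi_eq_sum χ fun r x hx => ?_
    rw [ZMod.toAddCircle_apply]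
    refine (HurwitzZeta.hasSum_int_evenKernel _ hx).congr_fun fun k => ?_
    rw [hpar, pow_zero, one_mul]

/-- Odd and sine kernels decay with no constant terms, so the corrections of the even case are not
needed. -/
theorem isThetaKernel_odd (hreal : ∀ u : ZMod m, (χ u).im = 0) (hχ : χ.Odd) : IsThetaKernel χ
      fun x => ∑ r, (χ r).re * HurwitzZeta.oddKernel (ZMod.toAddCircle r) x := by
  have hpar : charParity χ = 1 := if_neg hχ.not_even
  refine ⟨?_, ?_, ?_, ?_, ?_⟩
  · exact continuousOn_finsetSum _ fun r _ =>
      continuousOn_const.mul (HurwitzZeta.continuousOn_oddKernel _)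
  · refine exists_isBigO_sum_exp _ fun r => ?_
    obtain ⟨p, hp, h⟩ := HurwitzZeta.isBigO_atTop_oddKernel (ZMod.toAddCircle r)
    exact ⟨p, hp, h.const_mul_left _⟩
  · obtain ⟨p, hp, h⟩ := exists_isBigO_sum_exp Finset.univ (f := fun (r : ZMod m) x => (χ r).re *
      HurwitzZeta.sinKernel (ZMod.toAddCircle r) x) fun r => by
        obtain ⟨p, hp, h⟩ := HurwitzZeta.isBigO_atTop_sinKernel (ZMod.toAddCircle r)
        exact ⟨p, hp, h.const_mul_left _⟩
    refine ⟨p, hp, (((Asymptotics.isBigO_refl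
      (fun x : ℝ => x ^ (1 / 2 + charParity χ : ℝ)) atTop).mul h)).congr' ?_ EventuallyEq.rfl⟩
    filter_upwards [eventually_gt_atTop 0] with x hx
    simp only [HurwitzZeta.oddKernel_functional_equation, hpar, one_div_one_div, Nat.cast_one,
      Finset.mul_sum]
    refine Finset.sum_congr rfl fun r _ => ?_
    rw [one_div x, Real.inv_rpow hx.le, show (1 / 2 + 1 : ℝ) = 3 / 2 by norm_num]
    field_simp
  · intro s hs
    have h1 : ∀ r : ZMod m, HasMellin (fun x => χ r •
        ((HurwitzZeta.oddKernel (ZMod.toAddCircle r) x : ℝ) : ℂ)) ((s + 1) / 2)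
        (χ r * (2 * HurwitzZeta.completedHurwitzZetaOdd (ZMod.toAddCircle r) s)) := fun r => by
      have h2 := (HurwitzZeta.isStrong_hurwitzOddFEPair (ZMod.toAddCircle r)).hasMellin
        ((s + 1) / 2)
      have h3 := h2.const_smul (χ r)
      rw [HurwitzZeta.completedHurwitzZetaOdd, mul_div_cancel₀ _ two_ne_zero]
      exact h3
    have h2 := mellin_finset_sum Finset.univ h1
    rw [hpar, Nat.cast_one, DirichletCharacter.completedLFunction,
      ZMod.completedLFunction_def_odd hχ.to_fun]
    have hm0 : (m : ℂ) ≠ 0 := Nat.cast_ne_zero.mpr (NeZero.ne m)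
    have h3 : (2 * (m : ℂ) ^ s * ((m : ℂ) ^ (-s) * ∑ r, χ r *
        HurwitzZeta.completedHurwitzZetaOdd (ZMod.toAddCircle r) s)) =
        ∑ r, χ r * (2 * HurwitzZeta.completedHurwitzZetaOdd (ZMod.toAddCircle r) s) := by
      rw [← mul_assoc, mul_assoc 2, ← Complex.cpow_add _ _ hm0, add_neg_cancel, Complex.cpow_zero,
        mul_one, Finset.mul_sum]
      exact Finset.sum_congr rfl fun r _ => by ring
    rw [h3, ← h2]
    congr 1
    ext x
    push_cast
    refine Finset.sum_congr rfl fun r _ => ?_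
    rw [ofReal_re_of_real hreal, smul_eq_mul]
  · refine dirichletPhi_eq_sum χ fun r x hx => ?_
    rw [ZMod.toAddCircle_apply]
    refine (HurwitzZeta.hasSum_int_oddKernel _ hx).congr_fun fun k => ?_
    rw [hpar, pow_one]

end Existence

theorem differentiable_dirichletXi {m : ℕ} [NeZero m] {χ : DirichletCharacter ℂ m}
    (hχ1 : χ ≠ 1) : Differentiable ℂ (dirichletXi χ) := by
  have hm0 : (m : ℂ) ≠ 0 := Nat.cast_ne_zero.mpr (NeZero.ne m)
  have h1 : Differentiable ℂ fun z => χ.completedLFunction (1 / 2 + I * z) :=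
    (DirichletCharacter.differentiable_completedLFunction hχ1).comp (by fun_prop)
  have h2 : Differentiable ℂ fun z : ℂ => (m : ℂ) ^ ((1 / 2 + I * z + charParity χ) / 2) :=
    fun z => DifferentiableAt.const_cpow (by fun_prop) (Or.inl hm0)
  unfold dirichletXi
  fun_prop

namespace IsThetaKernel

variable {m : ℕ} [NeZero m] {χ : DirichletCharacter ℂ m} {K : ℝ → ℝ} (h : IsThetaKernel χ K)
include h

theorem continuous_phi : Continuous (dirichletPhi χ) := by
  have hm : (0 : ℝ) < m := by exact_mod_cast Nat.pos_of_ne_zero (NeZero.ne m)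
  have h1 : Continuous fun t : ℝ => K (m * Real.exp (-2 * t)) :=
    h.continuousOn.comp_continuous (by fun_prop) fun t => mul_pos hm (Real.exp_pos _)
  have h2 : Continuous fun t : ℝ =>
      Real.exp (-((1 + 2 * charParity χ) / 2) * t) * (m : ℝ) ^ charParity χ := by fun_prop
  rw [show dirichletPhi χ = _ from funext h.phi_eq]
  exact h2.mul h1

/-- As `t → +∞` the kernel argument `m exp(-2t)` tends to `0`, which calls on `isBigO_inv`; as `t →
-∞` it tends to infinity, which calls on `isBigO_top`. The smaller of the two rates serves both
ends. -/
theorem hasGaussianTails (hφ : ∀ t, 0 ≤ dirichletPhi χ t) :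
    HasGaussianTails (densityMeasure (dirichletPhi χ) Set.univ) := by
  have hm : (0 : ℝ) < m := by exact_mod_cast Nat.pos_of_ne_zero (NeZero.ne m)
  obtain ⟨p, hp, hpO⟩ := h.isBigO_top
  obtain ⟨q, hq, hqO⟩ := h.isBigO_inv
  set a : ℝ := (charParity χ : ℝ) with ha
  have hmono : ∀ {c : ℝ}, min (q / m) (p * m) ≤ c →
      (fun t : ℝ => Real.exp ((1 / 2 + a) * t - c * Real.exp (2 * t))) =O[atTop]
        fun t => Real.exp ((1 / 2 + a) * t - min (q / m) (p * m) * Real.exp (2 * t)) :=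
    fun {c} hc => by
    refine Asymptotics.IsBigO.of_bound 1 (Eventually.of_forall fun t => ?_)
    rw [Real.norm_of_nonneg (Real.exp_nonneg _), Real.norm_of_nonneg (Real.exp_nonneg _), one_mul]
    refine Real.exp_le_exp.mpr ?_
    have := mul_le_mul_of_nonneg_right hc (Real.exp_nonneg (2 * t))
    linarith
  have hexp : Tendsto (fun t : ℝ => Real.exp (2 * t)) atTop atTop :=
    Real.tendsto_exp_atTop.comp (tendsto_id.const_mul_atTop two_pos)
  refine hasGaussianTails_densityMeasure h.continuous_phi hφ (a := min (q / m) (p * m))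
    (b := 1 / 2 + a) (lt_min (by positivity) (by positivity)) ?_ ?_
  · refine Asymptotics.IsBigO.trans ?_ (hmono (min_le_left _ _))
    have h1 := hqO.comp_tendsto (hexp.atTop_div_const hm)
    have h2 := (Asymptotics.isBigO_refl (fun t : ℝ =>
      Real.exp (-((1 + 2 * a) / 2) * t) * (m : ℝ) ^ charParity χ) atTop).mul h1
    have h3 : ∀ t : ℝ, Real.exp (-((1 + 2 * a) / 2) * t) * (m : ℝ) ^ charParity χ *
        ((Real.exp (2 * t) / m) ^ (1 / 2 + a) * Real.exp (-q * (Real.exp (2 * t) / m))) =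
        (m : ℝ) ^ charParity χ / (m : ℝ) ^ (1 / 2 + a) *
          Real.exp ((1 / 2 + a) * t - q / m * Real.exp (2 * t)) := fun t => by
      rw [Real.div_rpow (Real.exp_nonneg _) hm.le, ← Real.exp_mul]
      have e : Real.exp ((1 / 2 + a) * t - q / m * Real.exp (2 * t)) =
          Real.exp (-((1 + 2 * a) / 2) * t) * Real.exp (2 * t * (1 / 2 + a)) *
            Real.exp (-q * (Real.exp (2 * t) / m)) := by
        rw [← Real.exp_add, ← Real.exp_add]
        congr 1
        ring
      rw [e]
      ring
    refine (h2.trans ?_).congr_left fun t => ?_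
    · simp only [Function.comp_apply, h3]
      exact Asymptotics.isBigO_const_mul_self _ _ _
    · rw [h.phi_eq]
      simp only [Function.comp_apply]
      congr 2
      rw [one_div_div, neg_mul, Real.exp_neg, div_eq_mul_inv]
  · refine Asymptotics.IsBigO.trans ?_ (hmono (min_le_right _ _))
    have h1 := hpO.comp_tendsto (hexp.const_mul_atTop hm)
    have h2 := (Asymptotics.isBigO_refl (fun t : ℝ =>
      Real.exp (-((1 + 2 * a) / 2) * -t) * (m : ℝ) ^ charParity χ) atTop).mul h1
    have h3 : ∀ t : ℝ, Real.exp (-((1 + 2 * a) / 2) * -t) * (m : ℝ) ^ charParity χ *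
        Real.exp (-p * (m * Real.exp (2 * t))) =
        (m : ℝ) ^ charParity χ * Real.exp ((1 / 2 + a) * t - p * m * Real.exp (2 * t)) :=
      fun t => by
      have e : Real.exp ((1 / 2 + a) * t - p * m * Real.exp (2 * t)) =
          Real.exp (-((1 + 2 * a) / 2) * -t) * Real.exp (-p * (m * Real.exp (2 * t))) := by
        rw [← Real.exp_add]
        congr 1
        ring
      rw [e]
      ring
    refine (h2.trans ?_).congr_left fun t => ?_
    · simp only [Function.comp_apply, h3]
      exact Asymptotics.isBigO_const_mul_self _ _ _
    · rw [h.phi_eq, show -2 * -t = 2 * t by ring]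
      rfl

/-- Again an identity theorem from `Re s > 1`. The `2` in `mellin_eq` cancels the `1/2` of the
substitution, and the powers of `m` combine to the normalization of `dirichletXi`. -/
theorem dirichletXi_eq_laplaceTr (hχ1 : χ ≠ 1) (hφ : ∀ t, 0 ≤ dirichletPhi χ t) (z : ℂ) :
    dirichletXi χ z = laplaceTr (densityMeasure (dirichletPhi χ) Set.univ) (-I * z) := by
  have hm : (0 : ℝ) < m := by exact_mod_cast Nat.pos_of_ne_zero (NeZero.ne m)
  have hm0 : (m : ℂ) ≠ 0 := Nat.cast_ne_zero.mpr (NeZero.ne m)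
  have hL : Differentiable ℂ fun z =>
      laplaceTr (densityMeasure (dirichletPhi χ) Set.univ) (-I * z) :=
    (h.hasGaussianTails hφ).differentiable_laplaceTr.comp (by fun_prop)
  refine congrFun (eq_of_eqOn_im_lt (differentiable_dirichletXi hχ1) hL (r := -1 / 2)
    fun z hz => ?_) z
  have hsre : 1 < (1 / 2 + I * z).re := by
    rw [re_half_add_I_mul]
    linarith
  have hint := integral_exp_mul_comp_exp (fun u : ℝ => (K (m * u) : ℂ))
    ((1 / 2 + I * z + charParity χ) / 2)
  rw [mellin_comp_mul_left (fun u : ℝ => (K u : ℂ)) _ hm, h.mellin_eq _ hsre] at hint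
  rw [laplaceTr, integral_densityMeasure h.continuous_phi.measurable hφ, setIntegral_univ]
  have e1 : ∀ t : ℝ, dirichletPhi χ t • Complex.exp (-I * z * t) = (m : ℂ) ^ charParity χ *
      (Complex.exp (-2 * ((1 / 2 + I * z + charParity χ) / 2) * t) *
        (K (m * Real.exp (-2 * t)) : ℂ)) := fun t => by
    have e2 : Complex.exp (-2 * ((1 / 2 + I * z + charParity χ) / 2) * t) =
        Real.exp (-((1 + 2 * charParity χ) / 2) * t) * Complex.exp (-I * z * t) := by
      rw [Complex.ofReal_exp, ← Complex.exp_add]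
      congr 1
      push_cast
      ring
    rw [h.phi_eq, e2, Complex.real_smul]
    push_cast
    ring
  simp only [e1]
  rw [integral_const_mul, hint, dirichletXi]
  have e3 : (m : ℂ) ^ ((1 / 2 + I * z + charParity χ) / 2) = (m : ℂ) ^ charParity χ *
      (((m : ℝ) : ℂ) ^ (-((1 / 2 + I * z + charParity χ) / 2)) * (m : ℂ) ^ (1 / 2 + I * z)) := by
    rw [← Complex.cpow_natCast, Complex.ofReal_natCast, ← Complex.cpow_add _ _ hm0,
      ← Complex.cpow_add _ _ hm0]
    congr 1
    ring
  rw [e3, smul_eq_mul]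
  ring

end IsThetaKernel

/-! ### Zero-free half-plane and functional equation of `Ξ(z, χ)`. -/

theorem dirichletXi_ne_zero_of_im_lt {m : ℕ} [NeZero m] (hm : m ≠ 1) {χ : DirichletCharacter ℂ m}
    {z : ℂ} (hz : z.im < -(1 / 2)) : dirichletXi χ z ≠ 0 := by
  have hre := re_half_add_I_mul z
  have ha : (0 : ℝ) ≤ charParity χ := Nat.cast_nonneg _
  have hG : ∀ n : ℕ, (1 + 2 * charParity χ + 2 * I * z) / 4 ≠ -n := fun n hn => by
    rw [show (1 + 2 * charParity χ + 2 * I * z) / 4 = ((1 / 2 : ℝ) : ℂ) * (1 / 2 + I * z) +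
      ((charParity χ / 2 : ℝ) : ℂ) by push_cast; ring] at hn
    have := congrArg Complex.re hn
    rw [Complex.add_re, Complex.re_ofReal_mul, hre, Complex.ofReal_re, Complex.neg_re,
      Complex.natCast_re] at this
    have hn0 : (0 : ℝ) ≤ n := Nat.cast_nonneg n
    linarith
  rw [dirichletXi_eq hm χ z hG, show (1 + 2 * I * z) / 2 = 1 / 2 + I * z by ring]
  have hm0 : (0 : ℝ) < m := by exact_mod_cast Nat.pos_of_ne_zero (NeZero.ne m)
  refine mul_ne_zero (mul_ne_zero ?_ (Complex.Gamma_ne_zero hG)) ?_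
  · rw [Ne, Complex.cpow_eq_zero_iff, Complex.ofReal_eq_zero]
    exact fun hc => (div_pos Real.pi_pos hm0).ne' hc.1
  · refine DirichletCharacter.LFunction_ne_zero_of_one_le_re χ (Or.inr ?_) (by linarith)
    intro hc
    rw [hc] at hre
    simp at hre
    linarith

/-- A real character is its own inverse, so the functional equation relates `χ` to itself; the power
of `m` built into `dirichletXi` absorbs the conductor factor. -/
theorem dirichletXi_neg_eq_mul {m : ℕ} [NeZero m] {χ : DirichletCharacter ℂ m}
    (hprim : χ.IsPrimitive) (hreal : ∀ u : ZMod m, (χ u).im = 0) (z : ℂ) :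
    dirichletXi χ (-z) = χ.rootNumber * dirichletXi χ z := by
  have hm0 : (m : ℂ) ≠ 0 := Nat.cast_ne_zero.mpr (NeZero.ne m)
  have hinv : χ⁻¹ = χ := by
    ext u
    rw [← MulChar.star_apply' χ u, Complex.star_def, Complex.conj_eq_iff_im.mpr (hreal _)]
  have h1 := hprim.completedLFunction_one_sub (1 / 2 + I * z)
  rw [hinv, show 1 - (1 / 2 + I * z) = 1 / 2 + I * -z by ring] at h1
  rw [dirichletXi, dirichletXi, h1]
  have h2 : (m : ℂ) ^ ((1 / 2 + I * z + charParity χ) / 2) =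
      (m : ℂ) ^ ((1 / 2 + I * -z + charParity χ) / 2) * (m : ℂ) ^ (1 / 2 + I * z - 1 / 2) := by
    rw [← Complex.cpow_add _ _ hm0]
    congr 1
    ring
  rw [h2]
  ring

theorem exists_dirichletXi {m : ℕ} [NeZero m] {χ : DirichletCharacter ℂ m} (hm : 1 < m)
    (hprim : χ.IsPrimitive) (hreal : ∀ u : ZMod m, (χ u).im = 0)
    (hφ : ∀ t : ℝ, 0 ≤ dirichletPhi χ t) {n : ℕ} (hn : 1 ≤ n) :
    ∃ S ∈ IntermediateField.adjoin ℚ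
        {w : ℂ | ∃ j : ℕ, 1 ≤ j ∧ j ≤ n ∧
          w = ((dirichletMoment χ (2 * j) / dirichletMoment χ 0 : ℝ) : ℂ)},
      HasSum (fun z : {z : ℂ // 0 < z.re ∧ dirichletXi χ z = 0} =>
        (analyticOrderNatAt (dirichletXi χ) z : ℂ) * (1 / (z : ℂ) ^ (2 * n))) S := by
  have hm1 : m ≠ 1 := hm.ne'
  have hχ1 : χ ≠ 1 := fun hc => hm1 (by
    rw [DirichletCharacter.IsPrimitive, hc, DirichletCharacter.conductor_one] at hprim
    exact hprim.symm)
  obtain ⟨K, hK⟩ : ∃ K, IsThetaKernel χ K := by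
    rcases χ.even_or_odd with h | h
    · exact ⟨_, isThetaKernel_even hm1 hχ1 hreal h⟩
    · exact ⟨_, isThetaKernel_odd hreal h⟩
  have htails := hK.hasGaussianTails hφ
  have hXi := hK.dirichletXi_eq_laplaceTr hχ1 hφ
  have hmom : ∀ k, dirichletMoment χ k =
      ∫ x, x ^ k ∂(densityMeasure (dirichletPhi χ) Set.univ) := fun k => by
    rw [integral_densityMeasure hK.continuous_phi.measurable hφ, setIntegral_univ,
      dirichletMoment]
    exact integral_congr_ae (Eventually.of_forall fun t => by simp [mul_comm])
  have hμ : ∫ x, x ^ 0 ∂(densityMeasure (dirichletPhi χ) Set.univ) ≠ 0 := by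
    -- This argument corresponds to `Ξ(-i, χ)`, which lies in the zero-free half-plane.
    refine htails.integral_pow_zero_ne_zero (z := -I * -I) ?_
    rw [← hXi]
    refine dirichletXi_ne_zero_of_im_lt hm1 ?_
    rw [Complex.neg_im, Complex.I_im]
    norm_num
  -- The value at `0` is the total mass of the density, hence nonzero; the functional equation at
  -- its fixed point then determines the root number.
  have hroot : χ.rootNumber = 1 := by
    have h1 := dirichletXi_neg_eq_mul hprim hreal 0
    have h2 : dirichletXi χ 0 ≠ 0 := by
      have h3 := htails.coeff_taylorPS_laplaceTr 0
      rw [coeff_taylorPS] at h3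
      simp only [iteratedDeriv_zero, Nat.factorial_zero, Nat.cast_one, div_one] at h3
      rw [hXi, mul_zero, h3]
      exact Complex.ofReal_ne_zero.mpr hμ
    rw [neg_zero] at h1
    exact (mul_right_cancel₀ h2 ((one_mul _).trans h1)).symm
  have heven : ∀ z, dirichletXi χ (-z) = dirichletXi χ z := fun z => by
    rw [dirichletXi_neg_eq_mul hprim hreal, hroot, one_mul]
  have hstrip : ∀ z, dirichletXi χ z = 0 → |z.im| ≤ 1 / 2 := fun z hz => by
    rw [abs_le]
    constructor
    · by_contra! hlt
      exact dirichletXi_ne_zero_of_im_lt hm1 hlt hz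
    · by_contra! hlt
      refine dirichletXi_ne_zero_of_im_lt (χ := χ) (z := -z) hm1 ?_ (by rw [heven, hz])
      rw [Complex.neg_im]
      linarith
  simp only [hmom]
  exact htails.exists_hasSum_zeros hμ one_ne_zero (fun z => by rw [one_mul, hXi]) heven hstrip hn

/-! ### Assembly of the statement. -/

theorem proposition3p1 :
    -- the objects are well defined
    (∀ lam : ℕ → ℂ, Summable (fun n => ‖lam n‖) →
      (∀ z : ℂ, Multipliable (fun n => 1 - lam n * z)) ∧
      (∃! e : ℕ → ℂ, IsCoeffSeq lam e) ∧
      (∀ k : ℕ, 1 ≤ k → Summable (fun n => lam n ^ k))) ∧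
    -- rational coefficients
    (∀ lam e : ℕ → ℂ, Summable (fun n => ‖lam n‖) → IsCoeffSeq lam e →
      (∀ k, ∃ c : ℚ, e k = (c : ℂ)) →
      ∀ k : ℕ, 1 ≤ k → ∃ c : ℚ, powerSum lam k = (c : ℂ)) ∧
    -- coefficients in the field generated by complex numbers `q₁, …, q_ℓ`
    (∀ (ℓ : ℕ) (q : Fin ℓ → ℂ) (lam e : ℕ → ℂ),
      Summable (fun n => ‖lam n‖) → IsCoeffSeq lam e →
      (∀ k, e k ∈ IntermediateField.adjoin ℚ (Set.range q)) →
      ∀ k : ℕ, 1 ≤ k → powerSum lam k ∈ IntermediateField.adjoin ℚ (Set.range q)) ∧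
    -- coefficients that are rational functions of variables `q₁, …, q_ℓ` ranging over a set `D`
    (∀ (ℓ : ℕ) (D : Set (Fin ℓ → ℂ)) (lam e : (Fin ℓ → ℂ) → ℕ → ℂ),
      (∀ q ∈ D, Summable (fun n => ‖lam q n‖)) → (∀ q ∈ D, IsCoeffSeq (lam q) (e q)) →
      (∀ k, IsRationalOn D (fun q => e q k)) →
      ∀ k : ℕ, 1 ≤ k → IsRationalOn D (fun q => powerSum (lam q) k)) ∧
    -- hypergeometric entire functions `ᵣFₛ(a; b; c z)` of genus zero
    (∀ (r s : ℕ) (D : Set (Fin r ⊕ Fin s → ℂ)) (c : (Fin r ⊕ Fin s → ℂ) → ℂ),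
      (∀ x ∈ D, ∀ (j : Fin s) (n : ℕ), x (Sum.inr j) ≠ -(n : ℂ)) →
      IsRationalOn D c →
      (∀ x ∈ D, ∀ z : ℂ, Summable (fun n =>
        hypCoeff (fun i => x (Sum.inl i)) (fun j => x (Sum.inr j)) n * (c x * z) ^ n)) →
      (∀ x ∈ D, HasGenusZero (fun z =>
        hypSeries (fun i => x (Sum.inl i)) (fun j => x (Sum.inr j)) (c x * z))) →
      (∀ x ∈ D, ∃ lam : ℕ → ℂ, IsGenusZeroFactorization (fun z =>
        hypSeries (fun i => x (Sum.inl i)) (fun j => x (Sum.inr j)) (c x * z)) lam) ∧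
      ∀ lam : (Fin r ⊕ Fin s → ℂ) → ℕ → ℂ,
        (∀ x ∈ D, IsGenusZeroFactorization (fun z =>
          hypSeries (fun i => x (Sum.inl i)) (fun j => x (Sum.inr j)) (c x * z)) (lam x)) →
        ∀ k : ℕ, 1 ≤ k → IsRationalOn D (fun x => powerSum (lam x) k)) ∧
    -- basic hypergeometric entire functions `ᵣφₛ(a; b; q, c z)` of genus zero; `x none` is `q`
    (∀ (r s : ℕ) (D : Set (Option (Fin r ⊕ Fin s) → ℂ))
      (c : (Option (Fin r ⊕ Fin s) → ℂ) → ℂ),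
      (∀ x ∈ D, 0 < ‖x none‖ ∧ ‖x none‖ < 1) →
      (∀ x ∈ D, ∀ (j : Fin s) (n : ℕ), x (some (Sum.inr j)) * x none ^ n ≠ 1) →
      IsRationalOn D c →
      (∀ x ∈ D, ∀ z : ℂ, Summable (fun n =>
        qHypCoeff (x none) (fun i => x (some (Sum.inl i))) (fun j => x (some (Sum.inr j))) n *
          (c x * z) ^ n)) →
      (∀ x ∈ D, HasGenusZero (fun z =>
        qHypSeries (x none) (fun i => x (some (Sum.inl i))) (fun j => x (some (Sum.inr j)))
          (c x * z))) →
      (∀ x ∈ D, ∃ lam : ℕ → ℂ, IsGenusZeroFactorization (fun z =>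
        qHypSeries (x none) (fun i => x (some (Sum.inl i))) (fun j => x (some (Sum.inr j)))
          (c x * z)) lam) ∧
      ∀ lam : (Option (Fin r ⊕ Fin s) → ℂ) → ℕ → ℂ,
        (∀ x ∈ D, IsGenusZeroFactorization (fun z =>
          qHypSeries (x none) (fun i => x (some (Sum.inl i))) (fun j => x (some (Sum.inr j)))
            (c x * z)) (lam x)) →
        ∀ k : ℕ, 1 ≤ k → IsRationalOn D (fun x => powerSum (lam x) k)) ∧
    -- even zeta values
    (∀ n : ℕ, 1 ≤ n →
      riemannZeta (2 * n) ∈ IntermediateField.adjoin ℚ {(π : ℂ) ^ 2}) ∧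
    -- positive zeros of Bessel functions
    (∀ n : ℕ, 1 ≤ n → ∃ P Q : Polynomial ℚ, ∀ ν : ℝ, -1 < ν →
      Polynomial.aeval ν Q ≠ 0 ∧
      HasSum (fun x : {x : ℝ // 0 < x ∧ besselJ ν x = 0} => 1 / (x : ℝ) ^ (2 * n))
        (Polynomial.aeval ν P / Polynomial.aeval ν Q)) ∧
    -- zeros of the Airy function
    (∀ n : ℕ, 1 ≤ n →
      ∃ S ∈ IntermediateField.adjoin ℚ {√3, π, Real.Gamma (1 / 3)},
        HasSum (fun x : {x : ℝ // 0 < x ∧ airyA x = 0} => 1 / (x : ℝ) ^ (2 * n)) S) ∧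
    -- positive zeros of `q`-Bessel functions
    (∀ n : ℕ, 1 ≤ n → ∃ P Q : MvPolynomial (Fin 2) ℚ,
      ∀ ν q : ℝ, -1 < ν → 0 < q → q < 1 →
        MvPolynomial.aeval ![q, q ^ ν] Q ≠ 0 ∧
        HasSum (fun x : {x : ℝ // 0 < x ∧ qBesselJ ν q x = 0} => 1 / (x : ℝ) ^ (2 * n))
          (MvPolynomial.aeval ![q, q ^ ν] P / MvPolynomial.aeval ![q, q ^ ν] Q)) ∧
    -- zeros of Ramanujan's entire function
    (∀ n : ℕ, 1 ≤ n → ∃ P Q : Polynomial ℚ, ∀ q : ℝ, 0 < q → q < 1 →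
      Polynomial.aeval q Q ≠ 0 ∧
      HasSum (fun x : {x : ℝ // 0 < x ∧ ramanujanA q x = 0} => 1 / (x : ℝ) ^ n)
        (Polynomial.aeval q P / Polynomial.aeval q Q)) ∧
    -- zeros of `Ξ` with positive real part, with multiplicity
    (∀ n : ℕ, 1 ≤ n →
      ∃ S ∈ IntermediateField.adjoin ℚ
          {w : ℂ | ∃ j : ℕ, 1 ≤ j ∧ j ≤ n ∧ w = ((xiMoment (2 * j) / xiMoment 0 : ℝ) : ℂ)},
        HasSum (fun z : {z : ℂ // 0 < z.re ∧ riemannXi z = 0} =>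
          (analyticOrderNatAt riemannXi z : ℂ) * (1 / (z : ℂ) ^ (2 * n))) S) ∧
    -- zeros of `Ξ(·, χ)` with positive real part, with multiplicity
    (∀ (m : ℕ) [NeZero m] (χ : DirichletCharacter ℂ m), 1 < m → χ.IsPrimitive →
      (∀ u : ZMod m, (χ u).im = 0) → (∀ t : ℝ, 0 ≤ dirichletPhi χ t) →
      ∀ n : ℕ, 1 ≤ n →
        ∃ S ∈ IntermediateField.adjoin ℚ
            {w : ℂ | ∃ j : ℕ, 1 ≤ j ∧ j ≤ n ∧
              w = ((dirichletMoment χ (2 * j) / dirichletMoment χ 0 : ℝ) : ℂ)},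
          HasSum (fun z : {z : ℂ // 0 < z.re ∧ dirichletXi χ z = 0} =>
            (analyticOrderNatAt (dirichletXi χ) z : ℂ) * (1 / (z : ℂ) ^ (2 * n))) S) := by
  refine ⟨fun lam h => ⟨multipliable_one_sub_mul h, existsUnique_isCoeffSeq h,
      fun k hk => summable_pow_of_summable_norm h hk⟩, ?_,
    fun ℓ q lam e h he hF k hk => he.powerSum_mem h hF hk,
    fun ℓ D lam e h he hr k hk => IsRationalOn.powerSum h he hr hk, ?_, ?_,
    fun n hn => riemannZeta_two_mul_mem_adjoin hn, fun n hn => exists_rational_bessel hn,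
    fun n hn => exists_airy hn, fun n hn => exists_rational_qBessel hn,
    fun n hn => exists_rational_ramanujan hn, fun n hn => exists_riemannXi hn,
    fun m _ χ hm hprim hreal hφ n hn => exists_dirichletXi hm hprim hreal hφ hn⟩
  · intro lam e h he hF k hk
    -- Rational numbers form the bottom intermediate field, so this is another case of the subfield
    -- statement.
    have hmem := he.powerSum_mem (F := (⊥ : IntermediateField ℚ ℂ)) h (fun k => by
      obtain ⟨c, hc⟩ := hF k
      exact IntermediateField.mem_bot.mpr ⟨c, by rw [hc]; rfl⟩) hk
    obtain ⟨c, hc⟩ := IntermediateField.mem_bot.mp hmem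
    exact ⟨c, hc.symm⟩
  · intro r s D c hD hc hs hg
    refine ⟨fun x hx => (hg x hx).exists_factorization ?_, fun lam hl k hk =>
      IsRationalOn.powerSum_of_series (isRationalOn_hypCoeff hD) hc hs hl hk⟩
    simp only [mul_zero]
    exact hypSeries_zero _ _
  · intro r s D c hq hD hc hs hg
    refine ⟨fun x hx => (hg x hx).exists_factorization ?_, fun lam hl k hk =>
      IsRationalOn.powerSum_of_series (isRationalOn_qHypCoeff hq hD) hc hs hl hk⟩
    simp only [mul_zero]
    exact qHypSeries_zero _ _ _
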